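/- **Setting.** A dynamical linear bandit has a hidden state $x_t\in\mathbb R^n$ and actions $u_t$ in a set $\mathcal U\subseteq\mathbb R^d$, $d\ge 1$. For rounds $t=1,2,\dots$ $$y_t=\langle\omega,x_t\rangle+\langle\theta,u_t\rangle+\eta_t,\qquad x_{t+1}=Ax_t+Bu_t+\epsilon_t ,$$ where the noises $\eta_t,\epsilon_t$ are zero-mean and $\sigma^2$-subgaussian conditionally on the past. A policy $\pi$ chooses $u_t\in\mathcal U$ as a measurable function of $(u_1,y_1,\dots,u_{t-1},y_{t-1})$. Put $J(\pi)=\liminf_{H}\mathbb E[\frac1H\sum_{t\le H}y_t]$, let $J(u)$ be its value for the policy that always plays $u$, and let $J^*=\sup_\pi J(\pi)$. The regret and the offline regret are $R(\pi,T)=TJ^*-\sum_{t\le T}y_t$ and $R^{\rm off}(\pi,T)=TJ^*-\sum_{t\le T}J(u_t)$. Let $\rho(A)$ be the spectral radius of $A$ and $\Phi(A)=\sup_{\tau\ge0}\|A^\tau\|_2/\rho(A)^\tau$ (with $0/0=0$ and $0^0=1$). **Assumptions.** $\rho(A)\le\overline\rho<1$ and $\Phi(A)\le\overline\Phi<\infty$;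 $\|\theta\|_2\le\Theta$, $\|\omega\|_2\le\Omega$, $\|B\|_2\le B$, $\|u\|_2\le U$ and $|J(u)|\le1$ for all $u\in\mathcal U$, and $\|x_t\|_2\le X$ for all $t$ almost surely. Moreover $\overline\rho\ge\rho_0$ for a fixed $\rho_0>0$. **Algorithm.** DynLin-UCB with parameters $\lambda>0$, $\overline\rho$ and $\delta$ proceeds in epochs $m=1,2,\dots$ of $1+H_m$ rounds, $H_m=\lfloor\log m/\log(1/\overline\rho)\rfloor$. In the first round $t$ of an epoch it plays a maximiser over $u\in\mathcal U$ of $\langle V_{t-1}^{-1}b_{t-1},u\rangle+\beta_{t-1}\|u\|_{V_{t-1}^{-1}}$, and it repeats this action until the end of the epoch. Here $V_0=\lambda I$ and $b_0=0$; in the last round $t$ of each epoch $V_t=V_{t-1}+u_tu_t^{\top}$ and $b_t=b_{t-1}+u_ty_t$, and in the other rounds $V_t=V_{t-1}$, $b_t=b_{t-1}$; and $$\beta_t=\frac{\overline c_1}{\sqrt\lambda}\log(e(t+1))+\overline c_2\sqrt\lambda+\sqrt{2\overline\sigma^2\Big(\log\frac1\delta+\frac d2\log\Big(1+\frac{tU^2}{d\lambda}\Big)\Big)},$$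 $\overline c_1=U\Omega\overline\Phi\big(\frac{UB}{1-\overline\rho}+X\big)$, $\overline c_2=\Theta+\frac{\Omega B\overline\Phi}{1-\overline\rho}$, $\overline\sigma^2=\sigma^2\big(1+\frac{\Omega^2\overline\Phi^2}{1-\overline\rho^2}\big)$. **Theorem 3 (Upper Bound).** Fix $\Theta,\Omega,B,U,X,\overline\Phi$, $\lambda>0$ and $\rho_0>0$. (i) For every $\delta\in(0,1)$ there is a constant $C$, depending only on these quantities and $\delta$, such that for every bandit as above and every $T\ge2$, DynLin-UCB run with $\delta$ satisfies with probability at least $1-\delta$ $$R^{\rm off}(\pi,T)\le C\left(\frac{d\sigma\sqrt T(\log T)^{3/2}}{1-\overline\rho}+\frac{\sqrt{dT}(\log T)^2}{(1-\overline\rho)^{3/2}}\right).$$ (ii) There is a constant $C$, depending only on these quantities, such that for every bandit as above and every $T\ge2$, DynLin-UCB run with $\delta=1/T$ has integrable regret and offline regret with $$\big|\mathbb E R^{\rm off}(\pi,T)-\mathbb E R(\pi,T)\big|\le\frac{\Omega\,\Phi(A)\,BU}{(1-\rho(A))^2}+\frac{\Omega\,\Phi(A)\,X}{1-\rho(A)},$$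 $$\mathbb E R(\pi,T)\le C\left(\frac{d\sigma\sqrt T(\log T)^{3/2}}{1-\overline\rho}+\frac{\sqrt{dT}(\log T)^2}{(1-\overline\rho)^{3/2}}+\frac1{(1-\rho(A))^2}\right).$$ -/

import Mathlib

open MeasureTheory Filter Matrix
open scoped Matrix.Norms.L2Operator

noncomputable section

namespace DLB

/-- The spectral radius of a real square matrix: the largest modulus of its complex
eigenvalues (a real number, since the spectrum of a matrix is finite). -/
def specRad {n : ℕ} (A : Matrix (Fin n) (Fin n) ℝ) : ℝ :=
  (spectralRadius ℂ (A.map Complex.ofReal)).toReal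

/-- The maximum spectral norm to spectral radius ratio `sup_τ ‖A ^ τ‖₂ / ρ(A) ^ τ` of the powers
of `A`, as an extended number: it is infinite if `A` is nilpotent and nonzero, and `0 / 0 = 0`. -/
def normRatio {n : ℕ} (A : Matrix (Fin n) (Fin n) ℝ) : ENNReal :=
  ⨆ τ : ℕ, ENNReal.ofReal ‖A ^ τ‖ / ENNReal.ofReal (specRad A) ^ τ

/-- `Z` is zero-mean and `σ²`-subgaussian, conditionally on the sub-σ-algebra `m`. -/
structure CondSubgaussian {S E : Type*} [NormedAddCommGroup E] [InnerProductSpace ℝ E]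
    [CompleteSpace E] {mS : MeasurableSpace S} (μ : Measure S) (m : MeasurableSpace S)
    (σ : ℝ) (Z : S → E) : Prop where
  integrable : Integrable Z μ
  mean_zero : μ[Z | m] =ᵐ[μ] 0
  integrable_exp : ∀ ζ : E, Integrable (fun s => Real.exp (inner ℝ ζ (Z s))) μ
  mgf_le : ∀ ζ : E, ∀ᵐ s ∂μ,
    (μ[fun s => Real.exp (inner ℝ ζ (Z s)) | m]) s ≤ Real.exp (‖ζ‖ ^ 2 * σ ^ 2 / 2)

/-- The data of a dynamical linear bandit with `n`-dimensional hidden state and `d`-dimensional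
actions, with its randomness realised on the sample space `S`. Rounds are numbered `0, 1, 2, …`;
`x₁` is the state in the first round. -/
structure Bandit (n d : ℕ) (S : Type*) where
  /-- dynamic matrix -/
  A : Matrix (Fin n) (Fin n) ℝ
  /-- action-state matrix -/
  B : Matrix (Fin n) (Fin d) ℝ
  /-- state-reward vector -/
  ω : EuclideanSpace ℝ (Fin n)
  /-- action-reward vector -/
  θ : EuclideanSpace ℝ (Fin d)
  /-- initial state -/
  x₁ : S → EuclideanSpace ℝ (Fin n)
  /-- state noise -/
  ε : ℕ → S → EuclideanSpace ℝ (Fin n)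
  /-- reward noise -/
  η : ℕ → S → ℝ

/-- The actions and rewards of `t` consecutive rounds. -/
abbrev History (d t : ℕ) : Type := Fin t → EuclideanSpace ℝ (Fin d) × ℝ

/-- A deterministic decision rule: after `t` rounds, it maps the history to the next action. -/
abbrev Rule (d : ℕ) : Type := (t : ℕ) → History d t → EuclideanSpace ℝ (Fin d)

/-- A policy: a measurable rule with actions in the action space `𝒰`. -/
structure IsPolicy {d : ℕ} (𝒰 : Set (EuclideanSpace ℝ (Fin d))) (π : Rule d) : Prop where
  measurable : ∀ t, Measurable (π t)
  mem : ∀ t (h : History d t), (∀ i, (h i).1 ∈ 𝒰) → π t h ∈ 𝒰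

/-- The constant rule that always plays `u`. -/
def constRule {d : ℕ} (u : EuclideanSpace ℝ (Fin d)) : Rule d := fun _ _ => u

section ClosedLoop

variable {n d : ℕ} {S : Type*}

/-- The closed loop after `t` rounds: the current hidden state and the history. -/
def run (D : Bandit n d S) (π : Rule d) (s : S) :
    (t : ℕ) → EuclideanSpace ℝ (Fin n) × History d t
  | 0 => (D.x₁ s, fun i => i.elim0)
  | t + 1 =>
    let p := run D π s t
    let u := π t p.2
    (D.A.toEuclideanLin p.1 + D.B.toEuclideanLin u + D.ε t s,
      Fin.snoc p.2 (u, inner ℝ D.ω p.1 + inner ℝ D.θ u + D.η t s))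

/-- The hidden state in round `t`. -/
def state (D : Bandit n d S) (π : Rule d) (t : ℕ) (s : S) : EuclideanSpace ℝ (Fin n) :=
  (run D π s t).1

/-- The action in round `t`. -/
def action (D : Bandit n d S) (π : Rule d) (t : ℕ) (s : S) : EuclideanSpace ℝ (Fin d) :=
  π t (run D π s t).2

/-- The reward in round `t`. -/
def reward (D : Bandit n d S) (π : Rule d) (t : ℕ) (s : S) : ℝ :=
  inner ℝ D.ω (state D π t s) + inner ℝ D.θ (action D π t s) + D.η t s

variable [MeasurableSpace S]

/-- The infinite-horizon expected average reward `J(π)`. -/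
def avgReward (μ : Measure S) (D : Bandit n d S) (π : Rule d) : ℝ :=
  liminf (fun H : ℕ => ∫ s, (1 / (H : ℝ)) * ∑ t ∈ Finset.range H, reward D π t s ∂μ) atTop

/-- The optimal expected average reward `J*`, the supremum of `J(π)` over all policies. -/
def optReward (μ : Measure S) (D : Bandit n d S) (𝒰 : Set (EuclideanSpace ℝ (Fin d))) : ℝ :=
  sSup {r | ∃ π : Rule d, IsPolicy 𝒰 π ∧ r = avgReward μ D π}

/-- The regret over `T` rounds. -/
def regret (μ : Measure S) (D : Bandit n d S) (𝒰 : Set (EuclideanSpace ℝ (Fin d)))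
    (π : Rule d) (T : ℕ) (s : S) : ℝ :=
  T * optReward μ D 𝒰 - ∑ t ∈ Finset.range T, reward D π t s

/-- The offline regret over `T` rounds: the rewards are replaced by the steady-state performances
of the actions played. -/
def offRegret (μ : Measure S) (D : Bandit n d S) (𝒰 : Set (EuclideanSpace ℝ (Fin d)))
    (π : Rule d) (T : ℕ) (s : S) : ℝ :=
  T * optReward μ D 𝒰 -
    ∑ t ∈ Finset.range T, avgReward μ D (constRule (action D π t s))

end ClosedLoop

/-- The constants known to the learner: bounds on `‖θ‖`, `‖ω‖`, `‖B‖`, on the norms of the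
actions and of the states, and on `Φ(A)`. -/
structure Bounds where
  Θ : ℝ
  Ω : ℝ
  B : ℝ
  U : ℝ
  X : ℝ
  Φ : ℝ

/-- The noise model: with respect to the filtration `ℱ` (`ℱ t` is the information before the
noise of round `t` is drawn), both noises are zero-mean and `σ²`-subgaussian conditionally on
the past. -/
structure Noise {n d : ℕ} {S : Type*} {mS : MeasurableSpace S} (μ : Measure S)
    (ℱ : Filtration ℕ mS) (D : Bandit n d S) (σ : ℝ) : Prop where
  init_meas : StronglyMeasurable[ℱ 0] D.x₁
  state_meas : ∀ t, StronglyMeasurable[ℱ (t + 1)] (D.ε t)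
  reward_meas : ∀ t, StronglyMeasurable[ℱ (t + 1)] (D.η t)
  state_sub : ∀ t, CondSubgaussian μ (ℱ t) σ (D.ε t)
  reward_sub : ∀ t, CondSubgaussian μ (ℱ t) σ (D.η t)

/-- Stability, with known upper bounds `ρbar < 1` and `Φ < ∞` on `ρ(A)` and `Φ(A)`. -/
structure Stable {n d : ℕ} {S : Type*} (D : Bandit n d S) (b : Bounds) (ρbar : ℝ) : Prop where
  lt_one : ρbar < 1
  specRad_le : specRad D.A ≤ ρbar
  nonneg : 0 ≤ b.Φ
  normRatio_le : normRatio D.A ≤ ENNReal.ofReal b.Φ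

/-- Boundedness, for the bandit `D` with action space `𝒰` and the states visited by `π`. -/
structure Bounded {n d : ℕ} {S : Type*} [MeasurableSpace S] (μ : Measure S) (D : Bandit n d S)
    (𝒰 : Set (EuclideanSpace ℝ (Fin d))) (b : Bounds) (π : Rule d) : Prop where
  theta_le : ‖D.θ‖ ≤ b.Θ
  omega_le : ‖D.ω‖ ≤ b.Ω
  matrix_le : ‖D.B‖ ≤ b.B
  action_le : ∀ u ∈ 𝒰, ‖u‖ ≤ b.U
  state_le : ∀ᵐ s ∂μ, ∀ t, ‖state D π t s‖ ≤ b.X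
  avgReward_le : ∀ u ∈ 𝒰, |avgReward μ D (constRule u)| ≤ 1

/-- The number `H_m` of additional rounds for which the action of epoch `m ≥ 1` is persisted. -/
def persist (ρbar : ℝ) (m : ℕ) : ℕ := ⌊Real.log m / Real.log (1 / ρbar)⌋₊

/-- The number `t_m` of rounds in the first `m` epochs. -/
def epochEnd (ρbar : ℝ) (m : ℕ) : ℕ := ∑ j ∈ Finset.Icc 1 m, (1 + persist ρbar j)

/-- After `t` rounds an epoch is completed, so that round `t` (counted from `0`) starts an
epoch. -/
def IsBoundary (ρbar : ℝ) (t : ℕ) : Prop := ∃ m, epochEnd ρbar m = t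

section Algorithm

variable {d : ℕ}

open Classical in
/-- The Gram matrix `V_t`: only the last round of every epoch contributes. -/
def gram (lam ρbar : ℝ) {t : ℕ} (h : History d t) : Matrix (Fin d) (Fin d) ℝ :=
  lam • (1 : Matrix (Fin d) (Fin d) ℝ) +
    ∑ i : Fin t, if IsBoundary ρbar (i + 1) then
      vecMulVec (h i).1.ofLp (h i).1.ofLp else 0

open Classical in
/-- The vector `b_t`. -/
def corr (ρbar : ℝ) {t : ℕ} (h : History d t) : Fin d → ℝ :=
  ∑ i : Fin t, if IsBoundary ρbar (i + 1) then (h i).2 • (h i).1.ofLp else 0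

/-- The ridge regression estimate `V_t⁻¹ b_t`. -/
def ridge (lam ρbar : ℝ) {t : ℕ} (h : History d t) : Fin d → ℝ :=
  (gram lam ρbar h)⁻¹ *ᵥ corr ρbar h

/-- The exploration coefficient `β_t`. -/
def beta (b : Bounds) (ρbar σ lam δ : ℝ) (d t : ℕ) : ℝ :=
  let c₁ := b.U * b.Ω * b.Φ * (b.U * b.B / (1 - ρbar) + b.X)
  let c₂ := b.Θ + b.Ω * b.B * b.Φ / (1 - ρbar)
  let v := σ ^ 2 * (1 + b.Ω ^ 2 * b.Φ ^ 2 / (1 - ρbar ^ 2))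
  c₁ / √lam * Real.log (Real.exp 1 * (t + 1)) + c₂ * √lam
    + √(2 * v * (Real.log (1 / δ) + d / 2 * Real.log (1 + t * b.U ^ 2 / (d * lam))))

/-- The upper confidence bound of the action `u` after the history `h` of `t` rounds. -/
def ucb (b : Bounds) (ρbar σ lam δ : ℝ) {t : ℕ} (h : History d t)
    (u : EuclideanSpace ℝ (Fin d)) : ℝ :=
  ridge lam ρbar h ⬝ᵥ u.ofLp
    + beta b ρbar σ lam δ d t * √(u.ofLp ⬝ᵥ ((gram lam ρbar h)⁻¹ *ᵥ u.ofLp))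

/-- `π` is a DynLin-UCB policy: in the first round of an epoch it plays a maximiser of the upper
confidence bound, and in the other rounds it repeats the previous action. -/
structure IsDynLinUCB (𝒰 : Set (EuclideanSpace ℝ (Fin d))) (b : Bounds) (ρbar σ lam δ : ℝ)
    (π : Rule d) : Prop where
  policy : IsPolicy 𝒰 π
  optimistic : ∀ t (h : History d t), (∀ i, (h i).1 ∈ 𝒰) → IsBoundary ρbar t →
    ∀ u ∈ 𝒰, ucb b ρbar σ lam δ h u ≤ ucb b ρbar σ lam δ h (π t h)
  persistent : ∀ t (h : History d (t + 1)), (∀ i, (h i).1 ∈ 𝒰) → ¬ IsBoundary ρbar (t + 1) →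
    π (t + 1) h = (h (Fin.last t)).1

end Algorithm

end DLB

end

/-!
Why the bounds hold.

**The regression problem.** With the transfer matrix `N = ∑ τ, A ^ τ`, the state equation solves to
`x t = N B (u t) + N (ε t) + N (x t) - N (x (t + 1))`. Hence playing `u` forever earns
`J(u) = ⟪h, u⟫`, where `h = θ + (N B)ᵀ ω` is the cumulative Markov parameter, and the reward of any
policy differs from `∑ t, ⟪h, u t⟫` by a martingale and a telescoping boundary term
(`Noise.abs_integral_sum_sub_le`). This compares the regret with the offline regret, and it shows
that no policy beats the supremum of `⟪h, u⟫` over the actions (`Noise.optReward_le`). The reward at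
the end of an epoch of `1 + H` rounds is `⟪h, u⟫` plus accumulated noise plus a bias of order
`ρbar ^ H` (`reward_epoch_eq`). In the `m`-th epoch `ρbar ^ H` would be `1 / m` but for the rounding
of `H`, which costs a factor `1 / ρbar` at worst (`pow_persist_le`).

**Confidence.** The noise accumulated over an epoch is, in every scalar direction known beforehand,
subgaussian with proxy `σ² (1 + Ω² Φ² / (1 - ρbar²))`. For the self-normalised inequality
(`measure_selfNormalized_le`) the mixture over a `d`-dimensional Gaussian is taken one dimension at
a time: by the Sherman–Morrison formula and the rank-one determinant formula, the process
`√(det V₀ / det V k) * exp (‖S k‖² / 2)`, with the norm weighted by the inverse of `V k`, is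
multiplied in step `k` by the average of `exp (g z - g² / 2)` over a one-dimensional Gaussian `g`
whose mean and variance are known before the noise `z` is drawn (`exp_increment_eq_lintegral`). It
is therefore a supermartingale, and Ville's inequality applies to it.

**Optimism.** On the resulting event the ridge estimate errs in the direction `x` by at most
`‖x‖` (in the inverse Gram norm) times the sum of the noise radius, the regularisation term, and
the Euclidean norm of the bias sequence (`ridge_error_le`). As the biases decay like `1 / m` they
are square summable, so the last contribution is bounded; the logarithm in `beta` exceeds it, with
the factor `1 / ρbar`, after a number of epochs that depends only on the bounds, on `lam` and on the
lower bound for `ρbar` (`exists_warm_epoch`). From then on an action of the algorithm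
loses at most `2 beta ‖u‖` per round (`Noise.gap_le`). The earlier epochs lose at most two per round,
because rewards `J` lie in `[-1, 1]`.

**Summation.** Each epoch has at most `1 + log T / (1 - ρbar)` rounds, so by Cauchy–Schwarz and the
elliptical potential lemma `sum_min_one_le` the total is at most
`√(T (1 + log T / (1 - ρbar)) * ∑ gap²)`, with the sum over epochs of order
`beta² d log (1 + T U² / (d lam))` (`Noise.offRegret_le`, `exists_rate`). The complementary event
has probability at most `δ`; for `δ = 1 / T` it contributes at most two to the expectation.
-/

namespace DLB

/-! ### Regularised Gram matrices -/

/-- The regularised Gram matrix `lam • 1 + ∑ j < k, u j (u j)ᵀ` of the first `k` vectors. -/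
noncomputable def gramSeq {d : ℕ} (lam : ℝ) (u : ℕ → Fin d → ℝ) (k : ℕ) :
    Matrix (Fin d) (Fin d) ℝ :=
  lam • (1 : Matrix (Fin d) (Fin d) ℝ) + ∑ j ∈ Finset.range k, vecMulVec (u j) (u j)

section Gram

variable {d : ℕ} {lam : ℝ} {u : ℕ → Fin d → ℝ} {k : ℕ}

lemma gramSeq_zero : gramSeq lam u 0 = lam • 1 := by simp [gramSeq]

lemma gramSeq_succ : gramSeq lam u (k + 1) = gramSeq lam u k + vecMulVec (u k) (u k) := by
  simp [gramSeq, Finset.sum_range_succ, add_assoc]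

lemma gramSeq_posDef (hlam : 0 < lam) : (gramSeq lam u k).PosDef := by
  induction k with
  | zero => rw [gramSeq_zero]; exact Matrix.PosDef.one.smul hlam
  | succ k ih =>
    rw [gramSeq_succ]
    refine ih.add_posSemidef ?_
    simpa using Matrix.posSemidef_vecMulVec_self_star (u k)

lemma gramSeq_transpose (hlam : 0 < lam) : (gramSeq lam u k)ᵀ = gramSeq lam u k := by
  simpa [Matrix.IsHermitian] using (gramSeq_posDef (u := u) (k := k) hlam).isHermitian

lemma dotProduct_gramSeq_mulVec (x y : Fin d → ℝ) :
    x ⬝ᵥ (gramSeq lam u k *ᵥ y)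
      = lam * (x ⬝ᵥ y) + ∑ j ∈ Finset.range k, (u j ⬝ᵥ x) * (u j ⬝ᵥ y) := by
  induction k with
  | zero => simp [gramSeq_zero, Matrix.smul_mulVec]
  | succ k ih =>
    rw [gramSeq_succ, Matrix.add_mulVec, dotProduct_add, ih, Finset.sum_range_succ,
      Matrix.vecMulVec_mulVec]
    simp [dotProduct_smul, dotProduct_comm x (u k)]
    ring

end Gram

/-! ### Rank-one updates -/

section RankOne

variable {d : ℕ} {V : Matrix (Fin d) (Fin d) ℝ}

lemma dotProduct_inv_mulVec_comm (hV : Vᵀ = V) (x y : Fin d → ℝ) :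
    x ⬝ᵥ (V⁻¹ *ᵥ y) = y ⬝ᵥ (V⁻¹ *ᵥ x) := by
  rw [Matrix.dotProduct_mulVec, ← Matrix.mulVec_transpose, Matrix.transpose_nonsing_inv, hV,
    dotProduct_comm]

lemma det_add_vecMulVec (hV : V.PosDef) (u : Fin d → ℝ) :
    (V + vecMulVec u u).det = V.det * (1 + u ⬝ᵥ (V⁻¹ *ᵥ u)) := by
  rw [Matrix.vecMulVec_eq (Fin 1), Matrix.det_add_mul _ _ hV.det_pos.ne'.isUnit]
  congr 1
  rw [Matrix.det_unique, Matrix.add_apply, Matrix.one_apply_eq, Matrix.mul_assoc]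
  rfl

/-- The Sherman–Morrison formula, in the form of the change of the squared `V⁻¹`-norm of `S` when
`S` moves by `z • u` and `V` by `u uᵀ`. -/
lemma inv_quadForm_add (hV : V.PosDef) (u S : Fin d → ℝ) (z : ℝ) :
    (S + z • u) ⬝ᵥ ((V + vecMulVec u u)⁻¹ *ᵥ (S + z • u))
      = S ⬝ᵥ (V⁻¹ *ᵥ S)
        + (2 * (u ⬝ᵥ (V⁻¹ *ᵥ S)) * z + (u ⬝ᵥ (V⁻¹ *ᵥ u)) * z ^ 2 - (u ⬝ᵥ (V⁻¹ *ᵥ S)) ^ 2)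
          / (1 + u ⬝ᵥ (V⁻¹ *ᵥ u)) := by
  have hVt : Vᵀ = V := by simpa [Matrix.IsHermitian] using hV.isHermitian
  have hw : 0 ≤ u ⬝ᵥ (V⁻¹ *ᵥ u) := by simpa using hV.inv.posSemidef.dotProduct_mulVec_nonneg u
  have hpsd : (vecMulVec u u).PosSemidef := by
    simpa using Matrix.posSemidef_vecMulVec_self_star u
  have hV' : IsUnit (V + vecMulVec u u).det := (hV.add_posSemidef hpsd).det_pos.ne'.isUnit
  have hVu : IsUnit V.det := hV.det_pos.ne'.isUnit
  set a := u ⬝ᵥ (V⁻¹ *ᵥ S) with ha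
  set w := u ⬝ᵥ (V⁻¹ *ᵥ u) with hw'
  have key : (V + vecMulVec u u) *ᵥ (V⁻¹ *ᵥ S + ((z - a) / (1 + w)) • (V⁻¹ *ᵥ u))
      = S + z • u := by
    rw [Matrix.add_mulVec, Matrix.mulVec_add, Matrix.mulVec_add, Matrix.mulVec_smul,
      Matrix.mulVec_smul, Matrix.mulVec_mulVec, Matrix.mulVec_mulVec,
      Matrix.mul_nonsing_inv _ hVu, Matrix.one_mulVec, Matrix.one_mulVec,
      Matrix.vecMulVec_mulVec, Matrix.vecMulVec_mulVec, ← ha, ← hw']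
    ext i
    simp
    field_simp
    ring
  have hinv : (V + vecMulVec u u)⁻¹ *ᵥ (S + z • u)
      = V⁻¹ *ᵥ S + ((z - a) / (1 + w)) • (V⁻¹ *ᵥ u) := by
    rw [← key, Matrix.mulVec_mulVec, Matrix.nonsing_inv_mul _ hV', Matrix.one_mulVec]
  rw [hinv, add_dotProduct, dotProduct_add, dotProduct_add, dotProduct_smul, dotProduct_smul,
    smul_dotProduct, smul_dotProduct, ← ha, ← hw', dotProduct_inv_mulVec_comm hVt S u, ← ha]
  simp only [smul_eq_mul]
  field_simp
  ring

end RankOne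

/-! ### Determinants and the elliptical potential -/

section Potential

variable {d : ℕ} {lam : ℝ} {u : ℕ → Fin d → ℝ}

lemma gramSeq_det_pos (hlam : 0 < lam) (k : ℕ) : 0 < (gramSeq lam u k).det :=
  (gramSeq_posDef hlam).det_pos

lemma gramSeq_inv_nonneg (hlam : 0 < lam) (k : ℕ) (x : Fin d → ℝ) :
    0 ≤ x ⬝ᵥ ((gramSeq lam u k)⁻¹ *ᵥ x) := by
  simpa using (gramSeq_posDef (u := u) (k := k) hlam).inv.posSemidef.dotProduct_mulVec_nonneg x

lemma trace_gramSeq (k : ℕ) :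
    (gramSeq lam u k).trace = lam * d + ∑ j ∈ Finset.range k, u j ⬝ᵥ u j := by
  simp [gramSeq, Matrix.trace_add, Matrix.trace_smul, Matrix.trace_sum, Matrix.trace_vecMulVec]

/-- The logarithm of the determinant of a Gram matrix, from the trace: `log x ≤ x / c - 1 + log c`
at every eigenvalue, with `c` the bound on their mean. -/
lemma log_det_gramSeq_le (hd : 0 < d) (hlam : 0 < lam) {U : ℝ} {k : ℕ}
    (hu : ∀ j < k, u j ⬝ᵥ u j ≤ U ^ 2) :
    Real.log (gramSeq lam u k).det - d * Real.log lam
      ≤ d * Real.log (1 + k * U ^ 2 / (d * lam)) := by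
  have hd' : (0 : ℝ) < d := by exact_mod_cast hd
  have hV := gramSeq_posDef (u := u) (k := k) hlam
  set c := lam * (1 + k * U ^ 2 / (d * lam)) with hc
  have h1 : 0 < 1 + k * U ^ 2 / (d * lam) := by positivity
  have hcpos : 0 < c := by positivity
  have hdet : (gramSeq lam u k).det = ∏ i, hV.isHermitian.eigenvalues i := by
    simpa using hV.isHermitian.det_eq_prod_eigenvalues
  have htr : ∑ i, hV.isHermitian.eigenvalues i = (gramSeq lam u k).trace := by
    simpa using hV.isHermitian.trace_eq_sum_eigenvalues.symm
  have htr' : (gramSeq lam u k).trace ≤ d * c := by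
    rw [trace_gramSeq]
    have : ∑ j ∈ Finset.range k, u j ⬝ᵥ u j ≤ k * U ^ 2 := by
      calc _ ≤ ∑ j ∈ Finset.range k, U ^ 2 :=
            Finset.sum_le_sum fun j hj => hu j (Finset.mem_range.1 hj)
        _ = k * U ^ 2 := by simp
    have h2 : d * c = lam * d + k * U ^ 2 := by rw [hc]; field_simp
    linarith
  have hlog : Real.log (gramSeq lam u k).det ≤ d * Real.log c := by
    rw [hdet, Real.log_prod fun i _ => (hV.eigenvalues_pos i).ne']
    have : ∀ i, Real.log (hV.isHermitian.eigenvalues i)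
        ≤ hV.isHermitian.eigenvalues i / c - 1 + Real.log c := by
      intro i
      have h3 := Real.log_le_sub_one_of_pos (div_pos (hV.eigenvalues_pos i) hcpos)
      rw [Real.log_div (hV.eigenvalues_pos i).ne' hcpos.ne'] at h3
      linarith
    calc _ ≤ ∑ i, (hV.isHermitian.eigenvalues i / c - 1 + Real.log c) :=
          Finset.sum_le_sum fun i _ => this i
      _ = (gramSeq lam u k).trace / c - d + d * Real.log c := by
          rw [Finset.sum_add_distrib, Finset.sum_sub_distrib, ← Finset.sum_div, htr]; simp
      _ ≤ d * Real.log c := by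
          have : (gramSeq lam u k).trace / c ≤ d := by rwa [div_le_iff₀ hcpos]
          linarith
  rw [hc, Real.log_mul hlam.ne' h1.ne'] at hlog
  linarith

lemma min_one_le_two_mul_log {w : ℝ} (hw : 0 ≤ w) : min 1 w ≤ 2 * Real.log (1 + w) := by
  have h := Real.one_sub_inv_le_log_of_pos (by linarith : 0 < 1 + w)
  have h2 : 1 - (1 + w)⁻¹ = w / (1 + w) := by field_simp; ring
  rw [h2] at h
  have h3 : min 1 w / 2 ≤ w / (1 + w) := by
    rw [div_le_div_iff₀ (by norm_num) (by linarith)]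
    rcases le_total 1 w with h1 | h1
    · rw [min_eq_left h1]; linarith
    · rw [min_eq_right h1]; nlinarith
  linarith

/-- The elliptical potential lemma. -/
lemma sum_min_one_le (hlam : 0 < lam) (k : ℕ) :
    ∑ j ∈ Finset.range k, min 1 (u j ⬝ᵥ ((gramSeq lam u j)⁻¹ *ᵥ u j))
      ≤ 2 * (Real.log (gramSeq lam u k).det - d * Real.log lam) := by
  induction k with
  | zero => simp [gramSeq_zero, Real.log_pow]
  | succ k ih =>
    have hw := gramSeq_inv_nonneg (u := u) hlam k (u k)
    rw [Finset.sum_range_succ, gramSeq_succ, det_add_vecMulVec (gramSeq_posDef hlam),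
      Real.log_mul (gramSeq_det_pos hlam k).ne' (by linarith)]
    linarith [min_one_le_two_mul_log hw]

end Potential

/-! ### The confidence ellipsoid -/

section Ellipsoid

variable {d : ℕ} {lam : ℝ} {u : ℕ → Fin d → ℝ}

/-- The error of ridge regression in the direction `x`, when the `j`-th response is
`⟨h, u j⟩ + e j + z j`: the regularisation bias, the misspecification `e`, and the noise `z` each
contribute a multiple of the `V⁻¹`-norm of `x`. -/
lemma ridge_error_le (hlam : 0 < lam) (k : ℕ) (h x : Fin d → ℝ) (e z : ℕ → ℝ) {c E N : ℝ}
    (hc : √(h ⬝ᵥ h) ≤ c) (hE : √(∑ j ∈ Finset.range k, e j ^ 2) ≤ E)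
    (hN : √((∑ j ∈ Finset.range k, z j • u j) ⬝ᵥ
      ((gramSeq lam u k)⁻¹ *ᵥ (∑ j ∈ Finset.range k, z j • u j))) ≤ N) :
    |((gramSeq lam u k)⁻¹ *ᵥ (∑ j ∈ Finset.range k, (h ⬝ᵥ u j + e j + z j) • u j)) ⬝ᵥ x - h ⬝ᵥ x|
      ≤ (c * √lam + E + N) * √(x ⬝ᵥ ((gramSeq lam u k)⁻¹ *ᵥ x)) := by
  have hV := gramSeq_posDef (u := u) (k := k) hlam
  have hVt := gramSeq_transpose (u := u) (k := k) hlam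
  have hVu : IsUnit (gramSeq lam u k).det := hV.det_pos.ne'.isUnit
  set V := gramSeq lam u k with hVdef
  set p := V⁻¹ *ᵥ x with hp
  have hVp : V *ᵥ p = x := by
    rw [hp, Matrix.mulVec_mulVec, Matrix.mul_nonsing_inv _ hVu, Matrix.one_mulVec]
  have hxp : x ⬝ᵥ p = lam * (p ⬝ᵥ p) + ∑ j ∈ Finset.range k, (u j ⬝ᵥ p) ^ 2 := by
    conv_lhs => rw [← hVp]
    rw [dotProduct_comm, hVdef, dotProduct_gramSeq_mulVec]
    simp [sq]
  have hpp : 0 ≤ p ⬝ᵥ p := by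
    simpa [dotProduct, ← sq] using Finset.sum_nonneg fun i (_ : i ∈ Finset.univ) => sq_nonneg (p i)
  have hsum : 0 ≤ ∑ j ∈ Finset.range k, (u j ⬝ᵥ p) ^ 2 := Finset.sum_nonneg fun _ _ => sq_nonneg _
  have hx0 : 0 ≤ x ⬝ᵥ p := by rw [hxp]; positivity
  set Sz := ∑ j ∈ Finset.range k, z j • u j with hSz
  -- the decomposition of the error
  have hhx : h ⬝ᵥ x = lam * (h ⬝ᵥ p) + ∑ j ∈ Finset.range k, (u j ⬝ᵥ h) * (u j ⬝ᵥ p) := by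
    conv_lhs => rw [← hVp]
    rw [hVdef, dotProduct_gramSeq_mulVec]
  have hdec : (V⁻¹ *ᵥ (∑ j ∈ Finset.range k, (h ⬝ᵥ u j + e j + z j) • u j)) ⬝ᵥ x - h ⬝ᵥ x
      = -(lam * (h ⬝ᵥ p)) + ∑ j ∈ Finset.range k, e j * (u j ⬝ᵥ p) + Sz ⬝ᵥ p := by
    rw [dotProduct_comm, dotProduct_inv_mulVec_comm hVt, ← hp, hhx, sum_dotProduct, hSz,
      sum_dotProduct]
    simp only [smul_dotProduct, smul_eq_mul, add_mul, Finset.sum_add_distrib,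
      dotProduct_comm h (u _)]
    ring
  have b1 : |lam * (h ⬝ᵥ p)| ≤ c * √lam * √(x ⬝ᵥ p) := by
    have h1 : |h ⬝ᵥ p| ≤ √(h ⬝ᵥ h) * √(p ⬝ᵥ p) := by
      rw [← Real.sqrt_mul' _ hpp]
      refine Real.abs_le_sqrt ?_
      have := Finset.sum_mul_sq_le_sq_mul_sq Finset.univ h p
      simpa [dotProduct, sq] using this
    have h2 : √lam * √(p ⬝ᵥ p) ≤ √(x ⬝ᵥ p) := by
      rw [← Real.sqrt_mul hlam.le]
      exact Real.sqrt_le_sqrt (by rw [hxp]; linarith)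
    rw [abs_mul, abs_of_pos hlam]
    calc lam * |h ⬝ᵥ p| ≤ (√lam * √lam) * (c * √(p ⬝ᵥ p)) := by
          rw [Real.mul_self_sqrt hlam.le]
          exact mul_le_mul_of_nonneg_left
            (h1.trans (mul_le_mul_of_nonneg_right hc (Real.sqrt_nonneg _))) hlam.le
      _ = c * √lam * (√lam * √(p ⬝ᵥ p)) := by ring
      _ ≤ c * √lam * √(x ⬝ᵥ p) :=
          mul_le_mul_of_nonneg_left h2
            (mul_nonneg ((Real.sqrt_nonneg _).trans hc) (Real.sqrt_nonneg _))
  have b2 : |∑ j ∈ Finset.range k, e j * (u j ⬝ᵥ p)| ≤ E * √(x ⬝ᵥ p) := by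
    have h1 : |∑ j ∈ Finset.range k, e j * (u j ⬝ᵥ p)|
        ≤ √(∑ j ∈ Finset.range k, e j ^ 2) * √(∑ j ∈ Finset.range k, (u j ⬝ᵥ p) ^ 2) := by
      rw [← Real.sqrt_mul' _ hsum]
      exact Real.abs_le_sqrt (Finset.sum_mul_sq_le_sq_mul_sq _ _ _)
    refine h1.trans (mul_le_mul hE (Real.sqrt_le_sqrt ?_) (Real.sqrt_nonneg _)
      ((Real.sqrt_nonneg _).trans hE))
    rw [hxp]
    have := mul_nonneg hlam.le hpp
    linarith
  have b3 : |Sz ⬝ᵥ p| ≤ N * √(x ⬝ᵥ p) := by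
    have h1 : |Sz ⬝ᵥ p| ≤ √(Sz ⬝ᵥ (V⁻¹ *ᵥ Sz)) * √(x ⬝ᵥ p) := by
      rw [← Real.sqrt_mul' _ hx0]
      refine Real.abs_le_sqrt ?_
      -- the discriminant of `r ↦ ‖r • Sz + x‖²` in the `V⁻¹`-norm is nonpositive
      have hq : ∀ r : ℝ, 0 ≤ (Sz ⬝ᵥ (V⁻¹ *ᵥ Sz)) * (r * r) + (2 * (Sz ⬝ᵥ p)) * r + x ⬝ᵥ p := by
        intro r
        have h0 : 0 ≤ (r • Sz + x) ⬝ᵥ (V⁻¹ *ᵥ (r • Sz + x)) :=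
          gramSeq_inv_nonneg hlam k _
        rw [Matrix.mulVec_add, Matrix.mulVec_smul, add_dotProduct, dotProduct_add, dotProduct_add,
          smul_dotProduct, smul_dotProduct, dotProduct_smul, dotProduct_smul, ← hp,
          dotProduct_inv_mulVec_comm hVt x Sz, ← hp] at h0
        simp only [smul_eq_mul] at h0
        linarith
      have := discrim_le_zero hq
      rw [discrim] at this
      linarith
    exact h1.trans (mul_le_mul_of_nonneg_right hN (Real.sqrt_nonneg _))
  rw [hdec]
  calc _ ≤ |lam * (h ⬝ᵥ p)| + |∑ j ∈ Finset.range k, e j * (u j ⬝ᵥ p)| + |Sz ⬝ᵥ p| := by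
        refine (abs_add_le _ _).trans (add_le_add_left ((abs_add_le _ _).trans ?_) _)
        rw [abs_neg]
    _ ≤ _ := by linarith

end Ellipsoid

/-! ### Conditional subgaussianity in random directions -/

section RandomDirection

variable {S E : Type*} [NormedAddCommGroup E] [InnerProductSpace ℝ E] [CompleteSpace E]
  {m mS : MeasurableSpace S} {μ : Measure S} [IsFiniteMeasure μ] {σ : ℝ} {Z : S → E}

/-- The moment generating function bound in a fixed direction, integrated against a weight known
at the time of conditioning. -/
lemma CondSubgaussian.lintegral_const_le (hm : m ≤ mS) (hZ : CondSubgaussian μ m σ Z)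
    (hZm : StronglyMeasurable Z) (ζ : E) {Y : S → ENNReal} (hY : Measurable[m] Y) :
    ∫⁻ s, Y s * ENNReal.ofReal (Real.exp (inner ℝ ζ (Z s) - ‖ζ‖ ^ 2 * σ ^ 2 / 2)) ∂μ
      ≤ ∫⁻ s, Y s ∂μ := by
  set f : S → ℝ := fun s => Real.exp (inner ℝ ζ (Z s) - ‖ζ‖ ^ 2 * σ ^ 2 / 2) with hf
  have hfm : Measurable f :=
    Real.measurable_exp.comp ((stronglyMeasurable_const.inner hZm).measurable.sub_const _)
  have hfe : ∀ s, f s = Real.exp (-(‖ζ‖ ^ 2 * σ ^ 2 / 2)) * Real.exp (inner ℝ ζ (Z s)) := by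
    intro s; simp only [hf]; rw [← Real.exp_add]; congr 1; ring
  have hfi : Integrable f μ := by
    simp only [funext hfe]; exact (hZ.integrable_exp ζ).const_mul _
  -- the bound on the events of `m`, as a comparison of measures
  have hle : (μ.withDensity fun s => ENNReal.ofReal (f s)).trim hm ≤ μ.trim hm := by
    refine Measure.le_iff.2 fun F hF => ?_
    rw [trim_measurableSet_eq hm hF, trim_measurableSet_eq hm hF, withDensity_apply _ (hm F hF),
      ← ofReal_integral_eq_lintegral_ofReal hfi.integrableOn
        (Eventually.of_forall fun s => (Real.exp_pos _).le), ← ENNReal.ofReal_toReal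
        (measure_ne_top μ F)]
    refine ENNReal.ofReal_le_ofReal ?_
    simp only [funext hfe]
    rw [integral_const_mul, ← setIntegral_condExp hm (hZ.integrable_exp ζ) hF]
    have h1 : ∫ s in F, (μ[fun s => Real.exp (inner ℝ ζ (Z s)) | m]) s ∂μ
        ≤ ∫ s in F, Real.exp (‖ζ‖ ^ 2 * σ ^ 2 / 2) ∂μ :=
      setIntegral_mono_ae integrable_condExp.integrableOn (integrable_const _).integrableOn
        (hZ.mgf_le ζ)
    rw [setIntegral_const, smul_eq_mul] at h1
    calc _ ≤ Real.exp (-(‖ζ‖ ^ 2 * σ ^ 2 / 2)) * (μ.real F * Real.exp (‖ζ‖ ^ 2 * σ ^ 2 / 2)) :=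
          mul_le_mul_of_nonneg_left h1 (Real.exp_pos _).le
      _ = (μ F).toReal := by
          rw [mul_left_comm, ← Real.exp_add]; simp [Measure.real]
  calc ∫⁻ s, Y s * ENNReal.ofReal (f s) ∂μ
      = ∫⁻ s, Y s ∂(μ.withDensity fun s => ENNReal.ofReal (f s)) := by
        rw [lintegral_withDensity_eq_lintegral_mul _ hfm.ennreal_ofReal (hY.mono hm le_rfl)]
        simp [mul_comm]
    _ = ∫⁻ s, Y s ∂((μ.withDensity fun s => ENNReal.ofReal (f s)).trim hm) :=
        (lintegral_trim hm hY).symm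
    _ ≤ ∫⁻ s, Y s ∂(μ.trim hm) := lintegral_mono' hle le_rfl
    _ = ∫⁻ s, Y s ∂μ := lintegral_trim hm hY

/-- The moment generating function bound in a random direction known at the time of
conditioning. -/
lemma CondSubgaussian.lintegral_le (hm : m ≤ mS) (hZ : CondSubgaussian μ m σ Z)
    (hZm : StronglyMeasurable Z) {ζ : S → E} (hζ : StronglyMeasurable[m] ζ) {Y : S → ENNReal}
    (hY : Measurable[m] Y) :
    ∫⁻ s, Y s * ENNReal.ofReal (Real.exp (inner ℝ (ζ s) (Z s) - ‖ζ s‖ ^ 2 * σ ^ 2 / 2)) ∂μ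
      ≤ ∫⁻ s, Y s ∂μ := by
  set F : E → S → ENNReal := fun c s =>
    ENNReal.ofReal (Real.exp (inner ℝ c (Z s) - ‖c‖ ^ 2 * σ ^ 2 / 2)) with hF
  have hFm : ∀ c, Measurable (F c) := fun c =>
    (Real.measurable_exp.comp
      ((stronglyMeasurable_const.inner hZm).measurable.sub_const _)).ennreal_ofReal
  have hsimple : ∀ φ : S → E, (Set.range φ).Finite → (∀ c, MeasurableSet[m] (φ ⁻¹' {c})) →
      ∫⁻ s, Y s * F (φ s) s ∂μ ≤ ∫⁻ s, Y s ∂μ := by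
    intro φ hfin hφ
    have hsplit : ∀ G : S → E → ENNReal, ∀ s, Y s * G s (φ s)
        = ∑ c ∈ hfin.toFinset, (φ ⁻¹' {c}).indicator Y s * G s c := by
      intro G s
      rw [Finset.sum_eq_single (φ s)]
      · simp
      · intro c _ hc
        rw [Set.indicator_of_notMem (fun h => hc h.symm), zero_mul]
      · intro h; exact absurd (hfin.mem_toFinset.2 ⟨s, rfl⟩) h
    have hYc : ∀ c, Measurable[m] ((φ ⁻¹' {c}).indicator Y) := fun c => hY.indicator (hφ c)
    calc ∫⁻ s, Y s * F (φ s) s ∂μ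
        = ∑ c ∈ hfin.toFinset, ∫⁻ s, (φ ⁻¹' {c}).indicator Y s * F c s ∂μ := by
          refine Eq.trans ?_ (lintegral_finsetSum hfin.toFinset
            fun c _ => ((hYc c).mono hm le_rfl).mul (hFm c))
          exact lintegral_congr fun s => hsplit (fun s c => F c s) s
      _ ≤ ∑ c ∈ hfin.toFinset, ∫⁻ s, (φ ⁻¹' {c}).indicator Y s ∂μ :=
          Finset.sum_le_sum fun c _ => hZ.lintegral_const_le hm hZm c (hYc c)
      _ = ∫⁻ s, Y s ∂μ := by
          refine Eq.trans (lintegral_finsetSum hfin.toFinset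
            fun c _ => (hYc c).mono hm le_rfl).symm ?_
          exact lintegral_congr fun s => by simpa using (hsplit (fun _ _ => 1) s).symm
  have hapm : ∀ n, StronglyMeasurable (fun s => hζ.approx n s) := fun n =>
    (@SimpleFunc.stronglyMeasurable S E m _ (hζ.approx n)).mono hm
  have hlim : ∀ s, Tendsto (fun n => Y s * F (hζ.approx n s) s) atTop
      (nhds (Y s * F (ζ s) s)) := by
    intro s
    refine ENNReal.Tendsto.const_mul ?_ (Or.inl ?_)
    · have hc : Continuous fun c : E => F c s := by
        rw [hF]; exact ENNReal.continuous_ofReal.comp (by fun_prop)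
      exact (hc.tendsto (ζ s)).comp (hζ.tendsto_approx s)
    · simp [hF, Real.exp_pos]
  calc ∫⁻ s, Y s * F (ζ s) s ∂μ
      = ∫⁻ s, liminf (fun n => Y s * F (hζ.approx n s) s) atTop ∂μ :=
        lintegral_congr fun s => (hlim s).liminf_eq.symm
    _ ≤ liminf (fun n => ∫⁻ s, Y s * F (hζ.approx n s) s ∂μ) atTop := by
        refine lintegral_liminf_le fun n => (hY.mono hm le_rfl).mul ?_
        refine (Real.measurable_exp.comp ?_).ennreal_ofReal
        exact (((hapm n).inner hZm).measurable).sub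
          ((((hapm n).norm.measurable).pow_const 2).mul_const _ |>.div_const _)
    _ ≤ ∫⁻ s, Y s ∂μ := by
        refine liminf_le_of_le (by isBoundedDefault) fun b hb => ?_
        obtain ⟨n, hn⟩ := hb.exists
        exact hn.trans (hsimple _ (@SimpleFunc.finite_range S E m (hζ.approx n))
          (@SimpleFunc.measurableSet_fiber S E m (hζ.approx n)))

end RandomDirection

/-- `z` is `v`-subgaussian in every scalar direction `g` known before `z` is drawn: the
exponential supermartingale property, with an arbitrary weight `Y` known before `z` is drawn. -/
def PredSubgaussian {S : Type*} {mS : MeasurableSpace S} (μ : Measure S) (m : MeasurableSpace S)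
    (v : ℝ) (z : S → ℝ) : Prop :=
  ∀ (g : S → ℝ) (Y : S → ENNReal), Measurable[m] g → Measurable[m] Y →
    ∫⁻ s, Y s * ENNReal.ofReal (Real.exp (g s * z s - g s ^ 2 * v / 2)) ∂μ ≤ ∫⁻ s, Y s ∂μ

section Pred

variable {S : Type*} {m mS : MeasurableSpace S} {μ : Measure S} {v : ℝ} {z : S → ℝ}

lemma PredSubgaussian.mono {v' : ℝ} (h : PredSubgaussian μ m v z) (hv : v ≤ v') :
    PredSubgaussian μ m v' z := by
  intro g Y hg hY
  refine le_trans (lintegral_mono fun s => ?_) (h g Y hg hY)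
  gcongr

/-- Scaling to variance proxy one. -/
lemma PredSubgaussian.div_sqrt (h : PredSubgaussian μ m v z) (hv : 0 < v) :
    PredSubgaussian μ m 1 (fun s => z s / √v) := by
  intro g Y hg hY
  refine le_trans (le_of_eq (lintegral_congr fun s => ?_)) (h (fun s => g s / √v) Y
    (hg.div_const _) hY)
  congr 3
  rw [div_pow, Real.sq_sqrt hv.le]
  field_simp

/-- A `0`-subgaussian variable vanishes: `E[exp z + exp (-z) - 2] ≤ 0`. -/
lemma PredSubgaussian.ae_eq_zero [IsProbabilityMeasure μ] (h : PredSubgaussian μ m 0 z)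
    (hz : Measurable z) : z =ᵐ[μ] 0 := by
  have h1 := h (fun _ => 1) (fun _ => 1) measurable_const measurable_const
  have h2 := h (fun _ => -1) (fun _ => 1) measurable_const measurable_const
  simp only [one_mul, mul_zero, zero_div, sub_zero, neg_mul, lintegral_const, measure_univ] at h1 h2
  have hm1 : Measurable fun s => ENNReal.ofReal (Real.exp (z s)) :=
    (Real.measurable_exp.comp hz).ennreal_ofReal
  have hsum : ∫⁻ s, ENNReal.ofReal (Real.exp (z s) + Real.exp (-z s)) ∂μ ≤ 2 := by
    calc _ = ∫⁻ s, (ENNReal.ofReal (Real.exp (z s)) + ENNReal.ofReal (Real.exp (-z s))) ∂μ :=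
          lintegral_congr fun s => ENNReal.ofReal_add (Real.exp_pos _).le (Real.exp_pos _).le
      _ ≤ 1 + 1 := by rw [lintegral_add_left hm1]; exact add_le_add h1 h2
      _ = 2 := one_add_one_eq_two
  have hpt : ∀ s, (2 : ENNReal) ≤ ENNReal.ofReal (Real.exp (z s) + Real.exp (-z s)) := by
    intro s
    have := Real.one_le_cosh (z s)
    rw [Real.cosh_eq] at this
    rw [show (2 : ENNReal) = ENNReal.ofReal 2 by simp]
    exact ENNReal.ofReal_le_ofReal (by linarith)
  have hae : (fun _ => (2 : ENNReal)) =ᵐ[μ]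
      fun s => ENNReal.ofReal (Real.exp (z s) + Real.exp (-z s)) := by
    refine ae_eq_of_ae_le_of_lintegral_le (Eventually.of_forall hpt) (by simp) ?_ (by simpa)
    exact (((Real.measurable_exp.comp hz).add
      (Real.measurable_exp.comp hz.neg)).ennreal_ofReal).aemeasurable
  filter_upwards [hae] with s hs
  have h3 : Real.exp (z s) + Real.exp (-z s) = 2 := by
    have := congrArg ENNReal.toReal hs
    rw [ENNReal.toReal_ofReal (by positivity)] at this
    simpa using this.symm
  by_contra hne
  have := Real.one_lt_cosh.2 hne
  rw [Real.cosh_eq] at this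
  linarith

end Pred

/-! ### One step of the method of mixtures -/

/-- The exponential of the increment of the squared self-normalised norm is an average of
exponential supermartingale increments over a Gaussian direction `g ∼ N(a, w)`. -/
lemma exp_increment_eq_lintegral {a w z : ℝ} (hw : 0 ≤ w) :
    ENNReal.ofReal (Real.exp ((2 * a * z + w * z ^ 2 - a ^ 2) / (1 + w) / 2) / √(1 + w))
      = ∫⁻ x, ENNReal.ofReal (Real.exp ((a + √w * x) * z - (a + √w * x) ^ 2 * 1 / 2))
          * ProbabilityTheory.gaussianPDF 0 1 x := by
  have hw1 : 0 < 1 + w := by linarith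
  set q : NNReal := ((1 + w)⁻¹).toNNReal with hq
  have hqc : (q : ℝ) = (1 + w)⁻¹ := Real.coe_toNNReal _ (by positivity)
  have hq0 : q ≠ 0 := (Real.toNNReal_pos.2 (by positivity)).ne'
  have key : ∀ x : ℝ, Real.exp ((a + √w * x) * z - (a + √w * x) ^ 2 * 1 / 2)
        * ProbabilityTheory.gaussianPDFReal 0 1 x
      = Real.exp ((2 * a * z + w * z ^ 2 - a ^ 2) / (1 + w) / 2) / √(1 + w)
        * ProbabilityTheory.gaussianPDFReal (√w * (z - a) / (1 + w)) q x := by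
    intro x
    have hsw : √w ^ 2 = w := Real.sq_sqrt hw
    have hsq : √(2 * Real.pi * (1 + w)⁻¹) = √(2 * Real.pi) / √(1 + w) := by
      rw [← div_eq_mul_inv, Real.sqrt_div (by positivity)]
    simp only [ProbabilityTheory.gaussianPDFReal, hqc, NNReal.coe_one, mul_one,
      sub_zero, hsq]
    have hs1 : √(1 + w) ≠ 0 := (Real.sqrt_pos.2 hw1).ne'
    have hs2 : √(2 * Real.pi) ≠ 0 := (Real.sqrt_pos.2 (by positivity)).ne'
    rw [show Real.exp ((a + √w * x) * z - (a + √w * x) ^ 2 / 2)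
          * ((√(2 * Real.pi))⁻¹ * Real.exp (-x ^ 2 / 2))
        = Real.exp ((a + √w * x) * z - (a + √w * x) ^ 2 / 2) * Real.exp (-x ^ 2 / 2)
          * (√(2 * Real.pi))⁻¹ by ring,
      show ∀ A D : ℝ, A / √(1 + w) * ((√(2 * Real.pi) / √(1 + w))⁻¹ * D)
        = A * D * (√(2 * Real.pi))⁻¹ from fun A D => by field_simp,
      ← Real.exp_add, ← Real.exp_add]
    -- the exponents agree after completing the square in `x`
    congr 2
    field_simp
    ring_nf
    rw [hsw]
    ring
  calc _ = ENNReal.ofReal (Real.exp ((2 * a * z + w * z ^ 2 - a ^ 2) / (1 + w) / 2) / √(1 + w))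
        * ∫⁻ x, ProbabilityTheory.gaussianPDF (√w * (z - a) / (1 + w)) q x := by
        rw [ProbabilityTheory.lintegral_gaussianPDF_eq_one _ hq0, mul_one]
    _ = _ := by
        rw [← lintegral_const_mul _ (ProbabilityTheory.measurable_gaussianPDF _ _)]
        refine lintegral_congr fun x => ?_
        rw [ProbabilityTheory.gaussianPDF, ProbabilityTheory.gaussianPDF,
          ← ENNReal.ofReal_mul (by positivity), ← ENNReal.ofReal_mul (Real.exp_pos _).le, key]

/-- One step of the supermartingale of the method of mixtures, for a weight `Y` known before the
step: by Tonelli, the bound for each direction drawn from the Gaussian is averaged. -/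
lemma PredSubgaussian.lintegral_increment_le {S : Type*} {m mS : MeasurableSpace S}
    {μ : Measure S} [SFinite μ] {z : S → ℝ} (hm : m ≤ mS) (h : PredSubgaussian μ m 1 z)
    (hz : Measurable z) {a w : S → ℝ} (ha : Measurable[m] a) (hwm : Measurable[m] w)
    (hw : ∀ s, 0 ≤ w s) {Y : S → ENNReal} (hY : Measurable[m] Y) :
    ∫⁻ s, Y s * ENNReal.ofReal
        (Real.exp ((2 * a s * z s + w s * z s ^ 2 - a s ^ 2) / (1 + w s) / 2) / √(1 + w s)) ∂μ
      ≤ ∫⁻ s, Y s ∂μ := by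
  have ha' : Measurable a := ha.mono hm le_rfl
  have hw' : Measurable w := hwm.mono hm le_rfl
  have hY' : Measurable Y := hY.mono hm le_rfl
  set G : ℝ → ENNReal := ProbabilityTheory.gaussianPDF 0 1 with hG
  have hGm : Measurable G := ProbabilityTheory.measurable_gaussianPDF _ _
  set f : S → ℝ → ENNReal := fun s x => Y s * ENNReal.ofReal
    (Real.exp ((a s + √(w s) * x) * z s - (a s + √(w s) * x) ^ 2 * 1 / 2)) with hf
  have hfm : Measurable (Function.uncurry fun s x => f s x * G x) := by
    have h1 : Measurable fun p : S × ℝ => a p.1 + √(w p.1) * p.2 := by fun_prop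
    have h2 : Measurable fun p : S × ℝ => z p.1 := by fun_prop
    exact ((hY'.comp measurable_fst).mul (Real.measurable_exp.comp
      ((h1.mul h2).sub ((h1.pow_const 2).mul_const 1 |>.div_const 2))).ennreal_ofReal).mul
      (hGm.comp measurable_snd)
  calc _ = ∫⁻ s, ∫⁻ x, f s x * G x ∂volume ∂μ := by
        refine lintegral_congr fun s => ?_
        rw [exp_increment_eq_lintegral (hw s), ← lintegral_const_mul _ (by fun_prop)]
        simp only [hf, mul_assoc, hG]
    _ = ∫⁻ x, ∫⁻ s, f s x * G x ∂μ ∂volume := lintegral_lintegral_swap hfm.aemeasurable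
    _ ≤ ∫⁻ x, (∫⁻ s, Y s ∂μ) * G x ∂volume := by
        refine lintegral_mono fun x => ?_
        have hfx : Measurable fun s => f s x := by
          have h1 : Measurable fun s => a s + √(w s) * x := by fun_prop
          exact hY'.mul (Real.measurable_exp.comp
            ((h1.mul hz).sub ((h1.pow_const 2).mul_const 1 |>.div_const 2))).ennreal_ofReal
        rw [lintegral_mul_const _ hfx]
        exact mul_le_mul_left
          (h (fun s => a s + √(w s) * x) Y (ha.add (hwm.sqrt.mul_const x)) hY) _
    _ = ∫⁻ s, Y s ∂μ := by
        rw [lintegral_const_mul _ hGm, hG,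
          ProbabilityTheory.lintegral_gaussianPDF_eq_one _ one_ne_zero, mul_one]

/-! ### A maximal inequality -/

/-- Ville's maximal inequality for nonnegative supermartingales, over a finite horizon. -/
lemma mul_measure_exists_le_lintegral {S : Type*} {mS : MeasurableSpace S} {μ : Measure S}
    (𝒢 : Filtration ℕ mS) {W : ℕ → S → ENNReal} (hW : ∀ k, Measurable[𝒢 k] (W k))
    (hstep : ∀ k F, MeasurableSet[𝒢 k] F → ∫⁻ s in F, W (k + 1) s ∂μ ≤ ∫⁻ s in F, W k s ∂μ)
    (c : ENNReal) (K : ℕ) :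
    c * μ {s | ∃ k < K, c ≤ W k s} ≤ ∫⁻ s, W 0 s ∂μ := by
  set N : ℕ → Set S := fun k => {s | ∃ j < k, c ≤ W j s} with hN
  have hNs : ∀ k, N (k + 1) = N k ∪ {s | c ≤ W k s} := by
    intro k; ext s; simp only [hN, Set.mem_ofPred_eq, Set.mem_union, Nat.lt_succ_iff_lt_or_eq]
    constructor
    · rintro ⟨j, hj | rfl, h⟩
      · exact Or.inl ⟨j, hj, h⟩
      · exact Or.inr h
    · rintro (⟨j, hj, h⟩ | h)
      · exact ⟨j, Or.inl hj, h⟩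
      · exact ⟨k, Or.inr rfl, h⟩
  have hcur : ∀ k, MeasurableSet[𝒢 k] {s | c ≤ W k s} := fun k =>
    @measurableSet_le _ _ _ _ _ (𝒢 k) _ _ _ _ _ measurable_const (hW k)
  have hNm : ∀ k j, k ≤ j + 1 → MeasurableSet[𝒢 j] (N k) := by
    intro k
    induction k with
    | zero => intro j _; simp [hN]
    | succ k ih =>
      intro j hj
      rw [hNs]
      exact (ih j (by omega)).union (𝒢.mono (by omega : k ≤ j) _ (hcur k))
  have hinv : ∀ k, ∫⁻ s in (N k)ᶜ, W k s ∂μ + c * μ (N k) ≤ ∫⁻ s, W 0 s ∂μ := by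
    intro k
    induction k with
    | zero => simp [hN]
    | succ k ih =>
      refine le_trans ?_ ih
      have hNk : MeasurableSet (N k) := 𝒢.le k _ (hNm k k (by omega))
      have hNk1 : MeasurableSet (N (k + 1)) := 𝒢.le k _ (hNm (k + 1) k le_rfl)
      have hsub : N k ⊆ N (k + 1) := by rw [hNs]; exact Set.subset_union_left
      set D := N (k + 1) \ N k with hD
      have hDm : MeasurableSet D := hNk1.diff hNk
      have hDc : ∀ s ∈ D, c ≤ W k s := by
        rintro s ⟨h1, h2⟩
        rw [hNs] at h1
        exact h1.resolve_left h2
      have hcompl : (N k)ᶜ = (N (k + 1))ᶜ ∪ D := by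
        ext s
        simp only [hD, Set.mem_compl_iff, Set.mem_union, Set.mem_sdiff]
        have := @hsub s
        tauto
      have hdisj : Disjoint (N (k + 1))ᶜ D :=
        Set.disjoint_left.2 fun s h1 h2 => h1 h2.1
      have hmeas : μ (N (k + 1)) = μ (N k) + μ D := by
        rw [← measure_union (Set.disjoint_left.2 fun s h1 h2 => h2.2 h1) hDm, hD,
          Set.union_sdiff_cancel hsub]
      rw [hcompl, lintegral_union hDm hdisj, hmeas, mul_add]
      have h1 := hstep k _ (hNm (k + 1) k le_rfl).compl
      have h2 : c * μ D ≤ ∫⁻ s in D, W k s ∂μ := by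
        rw [← setLIntegral_const]
        exact setLIntegral_mono' hDm hDc
      calc _ ≤ ∫⁻ s in (N (k + 1))ᶜ, W k s ∂μ + (c * μ (N k) + ∫⁻ s in D, W k s ∂μ) := by gcongr
        _ = _ := by rw [add_comm (c * μ (N k)), add_assoc]
  exact le_trans le_add_self (hinv K)

/-! ### The self-normalised concentration inequality -/

section Measurability

variable {S : Type*} [MeasurableSpace S] {d : ℕ}

lemma measurable_matrix_det {M : S → Matrix (Fin d) (Fin d) ℝ}
    (hM : ∀ i j, Measurable fun s => M s i j) : Measurable fun s => (M s).det := by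
  simp only [Matrix.det_apply]
  exact Finset.measurable_fun_sum _ fun p _ =>
    (Finset.measurable_fun_prod _ fun i _ => hM _ _).const_smul _

lemma measurable_matrix_inv {M : S → Matrix (Fin d) (Fin d) ℝ}
    (hM : ∀ i j, Measurable fun s => M s i j) (i j : Fin d) :
    Measurable fun s => (M s)⁻¹ i j := by
  simp only [Matrix.inv_def, Ring.inverse_eq_inv', Matrix.smul_apply, smul_eq_mul,
    Matrix.adjugate_apply]
  refine (measurable_matrix_det hM).inv.mul (measurable_matrix_det fun a b => ?_)
  simp only [Matrix.updateRow_apply]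
  split_ifs
  · exact measurable_const
  · exact hM a b

lemma measurable_dotProduct_mulVec {M : S → Matrix (Fin d) (Fin d) ℝ} {x y : S → Fin d → ℝ}
    (hM : ∀ i j, Measurable fun s => M s i j) (hx : ∀ i, Measurable fun s => x s i)
    (hy : ∀ i, Measurable fun s => y s i) : Measurable fun s => x s ⬝ᵥ (M s *ᵥ y s) := by
  simp only [dotProduct, Matrix.mulVec]
  exact Finset.measurable_fun_sum _ fun i _ =>
    (hx i).mul (Finset.measurable_fun_sum _ fun j _ => (hM i j).mul (hy j))

lemma measurable_gramSeq (lam : ℝ) {u : ℕ → S → Fin d → ℝ} {k : ℕ}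
    (hu : ∀ j < k, ∀ i, Measurable fun s => u j s i) (i i' : Fin d) :
    Measurable fun s => gramSeq lam (fun j => u j s) k i i' := by
  simp only [gramSeq, Matrix.add_apply, Matrix.sum_apply, Matrix.vecMulVec_apply]
  exact measurable_const.add (Finset.measurable_fun_sum _ fun j hj =>
    (hu j (Finset.mem_range.1 hj) i).mul (hu j (Finset.mem_range.1 hj) i'))

lemma measurable_weightedSum {u : ℕ → S → Fin d → ℝ} {z : ℕ → S → ℝ} {k : ℕ}
    (hu : ∀ j < k, ∀ i, Measurable fun s => u j s i) (hz : ∀ j < k, Measurable (z j))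
    (i : Fin d) : Measurable fun s => (∑ j ∈ Finset.range k, z j s • u j s) i := by
  simp only [Finset.sum_apply, Pi.smul_apply, smul_eq_mul]
  exact Finset.measurable_fun_sum _ fun j hj =>
    (hz j (Finset.mem_range.1 hj)).mul (hu j (Finset.mem_range.1 hj) i)

end Measurability

section SelfNormalized

variable {S : Type*} {mS : MeasurableSpace S} {μ : Measure S} [IsProbabilityMeasure μ] {d : ℕ}
  {𝒢 : Filtration ℕ mS} {lam v δ : ℝ} {u : ℕ → S → Fin d → ℝ} {z : ℕ → S → ℝ}

/-- The self-normalised bound at variance proxy one. The supermartingale is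
`det (V k / lam) ^ (-1/2) * exp (‖∑ j < k, z j • u j‖² / 2)`, in the `(V k)⁻¹`-norm. -/
lemma measure_selfNormalized_one_le (hlam : 0 < lam) (hδ : 0 < δ)
    (hu : ∀ k i, Measurable[𝒢 k] fun s => u k s i) (hz : ∀ k, Measurable[𝒢 (k + 1)] (z k))
    (hsub : ∀ k, PredSubgaussian μ (𝒢 k) 1 (z k)) (K : ℕ) :
    μ {s | ∃ k < K, 2 * (Real.log (1 / δ)
          + (Real.log (gramSeq lam (fun j => u j s) k).det - d * Real.log lam) / 2)
        < (∑ j ∈ Finset.range k, z j s • u j s) ⬝ᵥ ((gramSeq lam (fun j => u j s) k)⁻¹ *ᵥ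
          (∑ j ∈ Finset.range k, z j s • u j s))} ≤ ENNReal.ofReal δ := by
  set V : ℕ → S → Matrix (Fin d) (Fin d) ℝ := fun k s => gramSeq lam (fun j => u j s) k with hV
  set Sz : ℕ → S → Fin d → ℝ := fun k s => ∑ j ∈ Finset.range k, z j s • u j s with hSz
  set ψ : ℕ → S → ℝ := fun k s => (Sz k s ⬝ᵥ ((V k s)⁻¹ *ᵥ Sz k s)
    - (Real.log (V k s).det - d * Real.log lam)) / 2 with hψ
  have hu' : ∀ k, ∀ j ≤ k, ∀ i, Measurable[𝒢 k] fun s => u j s i :=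
    fun k j hj i => (hu j i).mono (𝒢.mono hj) le_rfl
  have hz' : ∀ k, ∀ j < k, Measurable[𝒢 k] (z j) :=
    fun k j hj => (hz j).mono (𝒢.mono hj) le_rfl
  have hVm : ∀ k i i', Measurable[𝒢 k] fun s => V k s i i' := fun k i i' =>
    @measurable_gramSeq S (𝒢 k) d lam u k (fun j hj => hu' k j hj.le) i i'
  have hVim : ∀ k i i', Measurable[𝒢 k] fun s => (V k s)⁻¹ i i' := fun k i i' =>
    @measurable_matrix_inv S (𝒢 k) d _ (hVm k) i i'
  have hSm : ∀ k i, Measurable[𝒢 k] fun s => Sz k s i := fun k i =>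
    @measurable_weightedSum S (𝒢 k) d u z k (fun j hj => hu' k j hj.le) (hz' k) i
  have hψm : ∀ k, Measurable[𝒢 k] (ψ k) := fun k =>
    ((@measurable_dotProduct_mulVec S (𝒢 k) d _ _ _ (hVim k) (hSm k) (hSm k)).sub
      ((@measurable_matrix_det S (𝒢 k) d _ (hVm k)).log.sub_const _)).div_const 2
  set W : ℕ → S → ENNReal := fun k s => ENNReal.ofReal (Real.exp (ψ k s)) with hW
  have hWm : ∀ k, Measurable[𝒢 k] (W k) := fun k =>
    (Real.measurable_exp.comp (hψm k)).ennreal_ofReal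
  set a : ℕ → S → ℝ := fun k s => u k s ⬝ᵥ ((V k s)⁻¹ *ᵥ Sz k s) with ha
  set w : ℕ → S → ℝ := fun k s => u k s ⬝ᵥ ((V k s)⁻¹ *ᵥ u k s) with hw
  have ham : ∀ k, Measurable[𝒢 k] (a k) := fun k =>
    @measurable_dotProduct_mulVec S (𝒢 k) d _ _ _ (hVim k) (hu k) (hSm k)
  have hwm : ∀ k, Measurable[𝒢 k] (w k) := fun k =>
    @measurable_dotProduct_mulVec S (𝒢 k) d _ _ _ (hVim k) (hu k) (hu k)
  have hw0 : ∀ k s, 0 ≤ w k s := fun k s => gramSeq_inv_nonneg hlam k _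
  have hWsucc : ∀ k s, W (k + 1) s = W k s * ENNReal.ofReal (Real.exp
      ((2 * a k s * z k s + w k s * z k s ^ 2 - a k s ^ 2) / (1 + w k s) / 2)
        / √(1 + w k s)) := by
    intro k s
    have h1 : 0 < 1 + w k s := by linarith [hw0 k s]
    have hpd : (V k s).PosDef := gramSeq_posDef hlam
    have hVs : V (k + 1) s = V k s + vecMulVec (u k s) (u k s) := gramSeq_succ
    have hSs : Sz (k + 1) s = Sz k s + z k s • u k s := Finset.sum_range_succ _ _
    have hsqrt : (√(1 + w k s))⁻¹ = Real.exp (-(Real.log (1 + w k s) / 2)) := by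
      rw [Real.sqrt_eq_rpow, Real.exp_neg, Real.rpow_def_of_pos h1]
      congr 2; ring
    simp only [hW]
    rw [← ENNReal.ofReal_mul (Real.exp_pos _).le, div_eq_mul_inv, hsqrt, ← Real.exp_add,
      ← Real.exp_add]
    congr 2
    simp only [hψ]
    rw [hVs, hSs, inv_quadForm_add hpd, det_add_vecMulVec hpd,
      Real.log_mul hpd.det_pos.ne' h1.ne']
    simp only [ha, hw]
    ring
  have hstep : ∀ k F, MeasurableSet[𝒢 k] F →
      ∫⁻ s in F, W (k + 1) s ∂μ ≤ ∫⁻ s in F, W k s ∂μ := by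
    intro k F hF
    rw [← lintegral_indicator (𝒢.le k F hF), ← lintegral_indicator (𝒢.le k F hF)]
    refine le_trans (le_of_eq (lintegral_congr fun s => ?_))
      ((hsub k).lintegral_increment_le (𝒢.le k) ((hz k).mono (𝒢.le (k + 1)) le_rfl) (ham k)
        (hwm k) (hw0 k) (Y := F.indicator (W k)) ((hWm k).indicator hF))
    by_cases hs : s ∈ F
    · simp only [Set.indicator_of_mem hs]; exact hWsucc k s
    · simp [Set.indicator_of_notMem hs]
  have hW0 : ∫⁻ s, W 0 s ∂μ = 1 := by
    simp [hW, hψ, hSz, hV, gramSeq_zero, Real.log_pow]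
  have hville := mul_measure_exists_le_lintegral 𝒢 hWm hstep (ENNReal.ofReal (1 / δ)) K
  rw [hW0] at hville
  have hsub' : {s | ∃ k < K, 2 * (Real.log (1 / δ)
          + (Real.log (V k s).det - d * Real.log lam) / 2) < Sz k s ⬝ᵥ ((V k s)⁻¹ *ᵥ Sz k s)}
      ⊆ {s | ∃ k < K, ENNReal.ofReal (1 / δ) ≤ W k s} := by
    rintro s ⟨k, hk, h⟩
    refine ⟨k, hk, ENNReal.ofReal_le_ofReal ?_⟩
    rw [← Real.exp_log (by positivity : 0 < 1 / δ)]
    refine Real.exp_le_exp.2 ?_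
    simp only [hψ]
    linarith
  refine (measure_mono hsub').trans ?_
  rw [one_div, ENNReal.ofReal_inv_of_pos hδ] at hville
  rw [mul_comm, ← div_eq_mul_inv] at hville
  have h3 := (ENNReal.div_le_iff (by simpa using hδ) ENNReal.ofReal_ne_top).1 hville
  simpa [ENNReal.ofReal_inv_of_pos hδ] using h3

/-- The self-normalised concentration inequality, uniformly over a finite horizon. -/
theorem measure_selfNormalized_le (hlam : 0 < lam) (hδ : 0 < δ) (hv : 0 ≤ v)
    (hu : ∀ k i, Measurable[𝒢 k] fun s => u k s i) (hz : ∀ k, Measurable[𝒢 (k + 1)] (z k))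
    (hsub : ∀ k, PredSubgaussian μ (𝒢 k) v (z k)) (K : ℕ) :
    μ {s | ∃ k < K, 2 * v * (Real.log (1 / δ)
          + (Real.log (gramSeq lam (fun j => u j s) k).det - d * Real.log lam) / 2)
        < (∑ j ∈ Finset.range k, z j s • u j s) ⬝ᵥ ((gramSeq lam (fun j => u j s) k)⁻¹ *ᵥ
          (∑ j ∈ Finset.range k, z j s • u j s))} ≤ ENNReal.ofReal δ := by
  rcases hv.eq_or_lt with rfl | hv
  -- at proxy zero the noise vanishes almost surely, and there is nothing to rescale
  · have h0 : ∀ᵐ s ∂μ, ∀ k, z k s = 0 := ae_all_iff.2 fun k =>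
      (hsub k).ae_eq_zero ((hz k).mono (𝒢.le _) le_rfl)
    refine le_trans (le_of_eq ?_) zero_le
    refine measure_mono_null (t := {s | ¬ ∀ k, z k s = 0}) ?_ (ae_iff.1 h0)
    rintro s ⟨k, -, hk⟩ h
    simp [h] at hk
  · refine le_trans (measure_mono ?_) (measure_selfNormalized_one_le (u := u) hlam hδ hu
      (fun k => (hz k).div_const _) (fun k => (hsub k).div_sqrt hv) K)
    rintro s ⟨k, hk, h⟩
    refine ⟨k, hk, ?_⟩
    have hscale : ∑ j ∈ Finset.range k, (z j s / √v) • u j s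
        = (√v)⁻¹ • ∑ j ∈ Finset.range k, z j s • u j s := by
      rw [Finset.smul_sum]
      exact Finset.sum_congr rfl fun j _ => by rw [smul_smul]; congr 1; ring
    rw [hscale, Matrix.mulVec_smul, smul_dotProduct, dotProduct_smul, smul_smul, ← mul_inv,
      Real.mul_self_sqrt hv.le, smul_eq_mul, lt_inv_mul_iff₀ hv]
    linarith

end SelfNormalized

/-! ### The noise accumulated over an epoch -/

section EpochNoise

variable {n d : ℕ} {S : Type*} {mS : MeasurableSpace S} {μ : Measure S} [IsProbabilityMeasure μ]
  {ℱ : Filtration ℕ mS} {D : Bandit n d S} {σ : ℝ}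

/-- The compensated exponentials of `k` successive state noises, in directions `g • c i` with `g`
known at time `t`, form a supermartingale. -/
lemma Noise.lintegral_exp_state_le (hN : Noise μ ℱ D σ) (t : ℕ)
    (c : ℕ → EuclideanSpace ℝ (Fin n)) {g : S → ℝ} {Y : S → ENNReal} (hg : Measurable[ℱ t] g)
    (hY : Measurable[ℱ t] Y) (k : ℕ) :
    (Measurable[ℱ (t + k)] fun s => Y s * ENNReal.ofReal (Real.exp (∑ i ∈ Finset.range k,
        (g s * inner ℝ (c i) (D.ε (t + i) s) - g s ^ 2 * ‖c i‖ ^ 2 * σ ^ 2 / 2)))) ∧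
    ∫⁻ s, Y s * ENNReal.ofReal (Real.exp (∑ i ∈ Finset.range k,
        (g s * inner ℝ (c i) (D.ε (t + i) s) - g s ^ 2 * ‖c i‖ ^ 2 * σ ^ 2 / 2))) ∂μ
      ≤ ∫⁻ s, Y s ∂μ := by
  have hεm : ∀ i, Measurable[ℱ (t + i + 1)] fun s => inner ℝ (c i) (D.ε (t + i) s) := fun i =>
    (stronglyMeasurable_const.inner (hN.state_meas (t + i))).measurable
  have hmeas : ∀ k, Measurable[ℱ (t + k)] fun s => Y s * ENNReal.ofReal (Real.exp
      (∑ i ∈ Finset.range k,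
        (g s * inner ℝ (c i) (D.ε (t + i) s) - g s ^ 2 * ‖c i‖ ^ 2 * σ ^ 2 / 2))) := by
    intro k
    have hgk : Measurable[ℱ (t + k)] g := hg.mono (ℱ.mono (by omega)) le_rfl
    refine (hY.mono (ℱ.mono (by omega)) le_rfl).mul
      (Real.measurable_exp.comp ?_).ennreal_ofReal
    refine Finset.measurable_fun_sum _ fun i hi => ?_
    have hik : t + i + 1 ≤ t + k := by have := Finset.mem_range.1 hi; omega
    exact (hgk.mul ((hεm i).mono (ℱ.mono hik) le_rfl)).sub
      ((((hgk.pow_const 2).mul_const _).mul_const _).div_const _)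
  refine ⟨hmeas k, ?_⟩
  induction k with
  | zero => simp
  | succ k ih =>
    refine le_trans ?_ ih
    have hζ : StronglyMeasurable[ℱ (t + k)] fun s => g s • c k :=
      (hg.mono (ℱ.mono (by omega)) le_rfl).stronglyMeasurable.smul_const (c k)
    refine le_trans (le_of_eq (lintegral_congr fun s => ?_))
      ((hN.state_sub (t + k)).lintegral_le (ℱ.le _)
        ((hN.state_meas (t + k)).mono (ℱ.le _)) hζ (hmeas k))
    rw [mul_assoc, ← ENNReal.ofReal_mul (Real.exp_pos _).le, ← Real.exp_add,
      Finset.sum_range_succ, real_inner_smul_left, norm_smul, mul_pow, Real.norm_eq_abs, sq_abs]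

/-- Noises of distinct rounds add up to a noise that is subgaussian conditionally on the beginning
of the epoch: the rounds are integrated out one by one, from the last to the first. -/
lemma Noise.predSubgaussian (hN : Noise μ ℱ D σ) (t H : ℕ) (c : ℕ → EuclideanSpace ℝ (Fin n)) :
    PredSubgaussian μ (ℱ t) (σ ^ 2 * (1 + ∑ i ∈ Finset.range H, ‖c i‖ ^ 2))
      fun s => ∑ i ∈ Finset.range H, inner ℝ (c i) (D.ε (t + i) s) + D.η (t + H) s := by
  intro g Y hg hY
  obtain ⟨hm, hle⟩ := hN.lintegral_exp_state_le t c hg hY H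
  refine le_trans ?_ hle
  have hζ : StronglyMeasurable[ℱ (t + H)] g :=
    (hg.mono (ℱ.mono (by omega)) le_rfl).stronglyMeasurable
  refine le_trans (le_of_eq (lintegral_congr fun s => ?_))
    ((hN.reward_sub (t + H)).lintegral_le (ℱ.le _)
      ((hN.reward_meas (t + H)).mono (ℱ.le _)) hζ hm)
  rw [mul_assoc, ← ENNReal.ofReal_mul (Real.exp_pos _).le, ← Real.exp_add]
  congr 3
  have hin : inner ℝ (g s) (D.η (t + H) s) = g s * D.η (t + H) s := by simp [mul_comm]
  rw [hin, Finset.sum_sub_distrib, ← Finset.mul_sum, Real.norm_eq_abs, sq_abs, ← Finset.sum_div,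
    ← Finset.sum_mul, ← Finset.mul_sum]
  ring

end EpochNoise

/-! ### Powers and resolvent of a stable matrix -/

lemma norm_pow_le_normRatio {n : ℕ} {A : Matrix (Fin n) (Fin n) ℝ} (h : normRatio A ≠ ⊤) (τ : ℕ) :
    ‖A ^ τ‖ ≤ (normRatio A).toReal * specRad A ^ τ := by
  have hρ : 0 ≤ specRad A := ENNReal.toReal_nonneg
  have h1 : ENNReal.ofReal ‖A ^ τ‖ / ENNReal.ofReal (specRad A) ^ τ ≤ normRatio A :=
    le_iSup (fun τ : ℕ => ENNReal.ofReal ‖A ^ τ‖ / ENNReal.ofReal (specRad A) ^ τ) τ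
  rw [ENNReal.div_le_iff_le_mul (Or.inr h) (Or.inl (by finiteness)),
    ← ENNReal.ofReal_toReal h, ← ENNReal.ofReal_pow hρ,
    ← ENNReal.ofReal_mul ENNReal.toReal_nonneg] at h1
  exact (ENNReal.ofReal_le_ofReal_iff (by positivity)).1 h1

lemma norm_toEuclideanLin_le {n m : ℕ} (M : Matrix (Fin m) (Fin n) ℝ)
    (x : EuclideanSpace ℝ (Fin n)) : ‖M.toEuclideanLin x‖ ≤ ‖M‖ * ‖x‖ :=
  M.l2_opNorm_mulVec x

lemma toEuclideanLin_mul_apply {n m l : ℕ} (M : Matrix (Fin l) (Fin m) ℝ)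
    (M' : Matrix (Fin m) (Fin n) ℝ) (x : EuclideanSpace ℝ (Fin n)) :
    (M * M').toEuclideanLin x = M.toEuclideanLin (M'.toEuclideanLin x) := by
  simp [Matrix.toLpLin_apply, Matrix.mulVec_mulVec]

lemma inner_toEuclideanLin {n m : ℕ} (M : Matrix (Fin m) (Fin n) ℝ)
    (w : EuclideanSpace ℝ (Fin m)) (x : EuclideanSpace ℝ (Fin n)) :
    inner ℝ w (M.toEuclideanLin x) = inner ℝ (Mᴴ.toEuclideanLin w) x := by
  rw [Matrix.toEuclideanLin_conjTranspose_eq_adjoint, LinearMap.adjoint_inner_left]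

/-- `⟨w, M x⟩` is controlled by the operator norm of `M`. -/
lemma abs_inner_toEuclideanLin_le {n m : ℕ} (M : Matrix (Fin m) (Fin n) ℝ)
    (w : EuclideanSpace ℝ (Fin m)) (x : EuclideanSpace ℝ (Fin n)) :
    |inner ℝ w (M.toEuclideanLin x)| ≤ ‖w‖ * (‖M‖ * ‖x‖) :=
  (abs_real_inner_le_norm _ _).trans
    (mul_le_mul_of_nonneg_left (norm_toEuclideanLin_le M x) (norm_nonneg _))

/-- The Neumann series `∑ τ, A ^ τ`, which is `(1 - A)⁻¹` when `A` is stable. -/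
noncomputable def neumann {n : ℕ} (A : Matrix (Fin n) (Fin n) ℝ) : Matrix (Fin n) (Fin n) ℝ :=
  ∑' τ : ℕ, A ^ τ

section Neumann

variable {n : ℕ} {A : Matrix (Fin n) (Fin n) ℝ} {Φ ρ : ℝ}

lemma hasSum_geometric_bound (hρ : 0 ≤ ρ) (hρ1 : ρ < 1) (k : ℕ) :
    HasSum (fun τ => Φ * ρ ^ (τ + k)) (Φ * ρ ^ k / (1 - ρ)) := by
  have h := (hasSum_geometric_of_lt_one hρ hρ1).mul_left (Φ * ρ ^ k)
  simpa only [div_eq_mul_inv, pow_add, mul_assoc, mul_comm, mul_left_comm] using h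

lemma summable_pow_of_norm_le (hA : ∀ τ, ‖A ^ τ‖ ≤ Φ * ρ ^ τ) (hρ : 0 ≤ ρ) (hρ1 : ρ < 1) :
    Summable fun τ : ℕ => A ^ τ :=
  Summable.of_norm_bounded (by simpa using (hasSum_geometric_bound hρ hρ1 0).summable) hA

lemma neumann_mul_pow (hA : ∀ τ, ‖A ^ τ‖ ≤ Φ * ρ ^ τ) (hρ : 0 ≤ ρ) (hρ1 : ρ < 1) (k : ℕ) :
    neumann A * A ^ k = ∑' τ : ℕ, A ^ (τ + k) := by
  rw [neumann, ← (summable_pow_of_norm_le hA hρ hρ1).tsum_mul_right]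
  simp [pow_add]

lemma norm_neumann_mul_pow_le (hA : ∀ τ, ‖A ^ τ‖ ≤ Φ * ρ ^ τ) (hρ : 0 ≤ ρ) (hρ1 : ρ < 1) (k : ℕ) :
    ‖neumann A * A ^ k‖ ≤ Φ * ρ ^ k / (1 - ρ) := by
  rw [neumann_mul_pow hA hρ hρ1]
  exact tsum_of_norm_bounded (hasSum_geometric_bound hρ hρ1 k) fun τ => hA _

lemma neumann_sub_neumann_mul_pow (hA : ∀ τ, ‖A ^ τ‖ ≤ Φ * ρ ^ τ) (hρ : 0 ≤ ρ) (hρ1 : ρ < 1)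
    (k : ℕ) : neumann A - neumann A * A ^ k = ∑ i ∈ Finset.range k, A ^ i := by
  rw [neumann_mul_pow hA hρ hρ1, neumann,
    ← (summable_pow_of_norm_le hA hρ hρ1).sum_add_tsum_nat_add k]
  simp

lemma sum_geometric_le (hρ : 0 ≤ ρ) (hρ1 : ρ < 1) (k : ℕ) :
    ∑ i ∈ Finset.range k, ρ ^ i ≤ 1 / (1 - ρ) := by
  rw [one_div, ← tsum_geometric_of_lt_one hρ hρ1]
  exact (summable_geometric_of_lt_one hρ hρ1).sum_le_tsum _ fun _ _ => by positivity

lemma norm_sum_pow_le (hA : ∀ τ, ‖A ^ τ‖ ≤ Φ * ρ ^ τ) (hΦ : 0 ≤ Φ) (hρ : 0 ≤ ρ) (hρ1 : ρ < 1)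
    (k : ℕ) : ‖∑ i ∈ Finset.range k, A ^ i‖ ≤ Φ / (1 - ρ) := by
  refine (norm_sum_le_of_le _ fun i _ => hA i).trans ?_
  rw [← Finset.mul_sum, div_eq_mul_one_div]
  exact mul_le_mul_of_nonneg_left (sum_geometric_le hρ hρ1 k) hΦ

end Neumann

/-! ### The closed loop -/

section Loop

variable {n d : ℕ} {S : Type*} {D : Bandit n d S} {π : Rule d}

/-- The cumulative Markov parameter `θ + ∑ τ, Bᵀ (A ^ τ)ᵀ ω`: the steady-state performance of the
action `u` is its inner product with `u`. -/
noncomputable def cumMarkov (D : Bandit n d S) : EuclideanSpace ℝ (Fin d) :=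
  D.θ + ((neumann D.A * D.B)ᴴ).toEuclideanLin D.ω

lemma inner_cumMarkov (u : EuclideanSpace ℝ (Fin d)) :
    inner ℝ (cumMarkov D) u
      = inner ℝ D.θ u + inner ℝ D.ω ((neumann D.A).toEuclideanLin (D.B.toEuclideanLin u)) := by
  rw [cumMarkov, inner_add_left, ← inner_toEuclideanLin, toEuclideanLin_mul_apply]

lemma norm_cumMarkov_le {Φ ρ : ℝ} (hA : ∀ τ, ‖D.A ^ τ‖ ≤ Φ * ρ ^ τ) (hρ : 0 ≤ ρ) (hρ1 : ρ < 1) :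
    ‖cumMarkov D‖ ≤ ‖D.θ‖ + ‖D.ω‖ * ‖D.B‖ * (Φ / (1 - ρ)) := by
  refine (norm_add_le _ _).trans (add_le_add_right ?_ _)
  refine (norm_toEuclideanLin_le _ _).trans ?_
  rw [Matrix.l2_opNorm_conjTranspose]
  have h1 : ‖neumann D.A‖ ≤ Φ / (1 - ρ) := by
    simpa using norm_neumann_mul_pow_le hA hρ hρ1 0
  calc ‖neumann D.A * D.B‖ * ‖D.ω‖ ≤ (‖neumann D.A‖ * ‖D.B‖) * ‖D.ω‖ := by
        gcongr; exact Matrix.l2_opNorm_mul _ _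
    _ ≤ (Φ / (1 - ρ) * ‖D.B‖) * ‖D.ω‖ := by gcongr
    _ = _ := by ring

lemma state_zero (s : S) : state D π 0 s = D.x₁ s := rfl

lemma state_succ (t : ℕ) (s : S) :
    state D π (t + 1) s = D.A.toEuclideanLin (state D π t s)
      + D.B.toEuclideanLin (action D π t s) + D.ε t s := rfl

lemma state_add (t k : ℕ) (s : S) :
    state D π (t + k) s = (D.A ^ k).toEuclideanLin (state D π t s)
      + ∑ i ∈ Finset.range k, (D.A ^ (k - 1 - i)).toEuclideanLin
          (D.B.toEuclideanLin (action D π (t + i) s) + D.ε (t + i) s) := by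
  induction k with
  | zero => simp [Matrix.toLpLin_apply]
  | succ k ih =>
    have h1 : ∀ i ∈ Finset.range k, D.A.toEuclideanLin ((D.A ^ (k - 1 - i)).toEuclideanLin
          (D.B.toEuclideanLin (action D π (t + i) s) + D.ε (t + i) s))
        = (D.A ^ (k + 1 - 1 - i)).toEuclideanLin
          (D.B.toEuclideanLin (action D π (t + i) s) + D.ε (t + i) s) := by
      intro i hi
      rw [← toEuclideanLin_mul_apply, ← pow_succ']
      congr 3
      have := Finset.mem_range.1 hi
      omega
    have h0 : (D.A ^ (k + 1 - 1 - k)).toEuclideanLin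
          (D.B.toEuclideanLin (action D π (t + k) s) + D.ε (t + k) s)
        = D.B.toEuclideanLin (action D π (t + k) s) + D.ε (t + k) s := by
      simp [Matrix.toLpLin_apply]
    rw [← add_assoc, state_succ, ih, map_add, map_sum, Finset.sum_congr rfl h1,
      Finset.sum_range_succ, h0, ← toEuclideanLin_mul_apply, ← pow_succ']
    abel

lemma history_apply (t : ℕ) (s : S) (i : Fin t) :
    (run D π s t).2 i = (action D π i s, reward D π i s) := by
  induction t with
  | zero => exact i.elim0
  | succ t ih =>
    induction i using Fin.lastCases with
    | last => simp [run, action, reward, state]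
    | cast i => simpa [run] using ih i

lemma action_mem {𝒰 : Set (EuclideanSpace ℝ (Fin d))} (hπ : IsPolicy 𝒰 π) (t : ℕ) (s : S) :
    action D π t s ∈ 𝒰 := by
  induction t using Nat.strong_induction_on with
  | _ t ih => exact hπ.mem t _ fun i => by rw [history_apply]; exact ih i i.2

/-- The cumulative deviation of the rewards from the steady-state performances of the actions, by
the identity `x_t = N B u_t + N ε_t + N x_t - N x_{t+1}` with `N = (1 - A)⁻¹`, summed over `t`:
a sum of noises, and a boundary term. -/
lemma sum_reward_sub {Φ ρ : ℝ} (hA : ∀ τ, ‖D.A ^ τ‖ ≤ Φ * ρ ^ τ) (hρ : 0 ≤ ρ) (hρ1 : ρ < 1)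
    (T : ℕ) (s : S) :
    ∑ t ∈ Finset.range T, (reward D π t s - inner ℝ (cumMarkov D) (action D π t s))
      = ∑ t ∈ Finset.range T, (inner ℝ D.ω ((neumann D.A
            - neumann D.A * D.A ^ (T - 1 - t)).toEuclideanLin (D.ε t s)) + D.η t s)
        + (inner ℝ D.ω ((∑ i ∈ Finset.range T, D.A ^ i).toEuclideanLin (D.x₁ s))
          - ∑ t ∈ Finset.range T, inner ℝ D.ω ((neumann D.A * D.A ^ (T - 1 - t)).toEuclideanLin
              (D.B.toEuclideanLin (action D π t s)))) := by
  set N := neumann D.A with hN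
  have hNA : N * D.A = N - 1 := by
    have := neumann_sub_neumann_mul_pow hA hρ hρ1 1
    rw [← hN] at this
    simp only [pow_one, Finset.range_one, Finset.sum_singleton, pow_zero] at this
    rw [← this]; abel
  have hstep : ∀ t, reward D π t s - inner ℝ (cumMarkov D) (action D π t s)
      = inner ℝ D.ω (N.toEuclideanLin (D.ε t s)) + D.η t s
        - (inner ℝ D.ω (N.toEuclideanLin (state D π (t + 1) s))
          - inner ℝ D.ω (N.toEuclideanLin (state D π t s))) := by
    intro t
    have h1 : N.toEuclideanLin (D.A.toEuclideanLin (state D π t s))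
        = N.toEuclideanLin (state D π t s) - state D π t s := by
      rw [← toEuclideanLin_mul_apply, hNA, map_sub, LinearMap.sub_apply]
      simp [Matrix.toLpLin_apply]
    rw [inner_cumMarkov, reward, state_succ, map_add, map_add, h1, inner_add_right,
      inner_add_right, inner_sub_right]
    ring
  have hlast : inner ℝ D.ω (N.toEuclideanLin (state D π T s))
      = inner ℝ D.ω ((N * D.A ^ T).toEuclideanLin (D.x₁ s))
        + ∑ t ∈ Finset.range T, (inner ℝ D.ω ((N * D.A ^ (T - 1 - t)).toEuclideanLin
              (D.B.toEuclideanLin (action D π t s)))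
          + inner ℝ D.ω ((N * D.A ^ (T - 1 - t)).toEuclideanLin (D.ε t s))) := by
    have := state_add (D := D) (π := π) 0 T s
    simp only [zero_add, state_zero] at this
    rw [this]
    simp only [map_add, map_sum, inner_add_right, inner_sum, toEuclideanLin_mul_apply]
  rw [Finset.sum_congr rfl fun t _ => hstep t, Finset.sum_sub_distrib,
    Finset.sum_range_sub (fun t => inner ℝ D.ω (N.toEuclideanLin (state D π t s))), hlast,
    state_zero, ← neumann_sub_neumann_mul_pow hA hρ hρ1 T]
  simp only [map_sub, LinearMap.sub_apply, inner_sub_right, Finset.sum_add_distrib,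
    Finset.sum_sub_distrib]
  ring

/-- The boundary term of `sum_reward_sub` is bounded uniformly in the horizon. -/
lemma abs_boundary_le {Φ ρ : ℝ} (hA : ∀ τ, ‖D.A ^ τ‖ ≤ Φ * ρ ^ τ) (hΦ : 0 ≤ Φ) (hρ : 0 ≤ ρ)
    (hρ1 : ρ < 1) {U X : ℝ} {s : S} (hX : ‖D.x₁ s‖ ≤ X) (hU : ∀ t, ‖action D π t s‖ ≤ U) (T : ℕ) :
    |inner ℝ D.ω ((∑ i ∈ Finset.range T, D.A ^ i).toEuclideanLin (D.x₁ s))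
        - ∑ t ∈ Finset.range T, inner ℝ D.ω ((neumann D.A * D.A ^ (T - 1 - t)).toEuclideanLin
            (D.B.toEuclideanLin (action D π t s)))|
      ≤ ‖D.ω‖ * Φ * ‖D.B‖ * U / (1 - ρ) ^ 2 + ‖D.ω‖ * Φ * X / (1 - ρ) := by
  have hr : 0 < 1 - ρ := by linarith
  have hU0 : 0 ≤ U := (norm_nonneg _).trans (hU 0)
  have h1 : |inner ℝ D.ω ((∑ i ∈ Finset.range T, D.A ^ i).toEuclideanLin (D.x₁ s))|
      ≤ ‖D.ω‖ * Φ * X / (1 - ρ) := by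
    refine (abs_inner_toEuclideanLin_le _ _ _).trans ?_
    calc _ ≤ ‖D.ω‖ * (Φ / (1 - ρ) * X) := by
          gcongr; exact norm_sum_pow_le hA hΦ hρ hρ1 T
      _ = _ := by ring
  have h2 : |∑ t ∈ Finset.range T, inner ℝ D.ω ((neumann D.A * D.A ^ (T - 1 - t)).toEuclideanLin
            (D.B.toEuclideanLin (action D π t s)))|
      ≤ ‖D.ω‖ * Φ * ‖D.B‖ * U / (1 - ρ) ^ 2 := by
    have hterm : ∀ t ∈ Finset.range T,
        |inner ℝ D.ω ((neumann D.A * D.A ^ (T - 1 - t)).toEuclideanLin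
            (D.B.toEuclideanLin (action D π t s)))|
          ≤ ‖D.ω‖ * (Φ / (1 - ρ)) * ‖D.B‖ * U * ρ ^ (T - 1 - t) := by
      intro t _
      refine (abs_inner_toEuclideanLin_le _ _ _).trans ?_
      calc _ ≤ ‖D.ω‖ * (Φ * ρ ^ (T - 1 - t) / (1 - ρ) * (‖D.B‖ * U)) := by
            gcongr
            · exact norm_neumann_mul_pow_le hA hρ hρ1 _
            · exact (norm_toEuclideanLin_le _ _).trans (by gcongr; exact hU t)
        _ = _ := by ring
    refine (Finset.abs_sum_le_sum_abs _ _).trans ((Finset.sum_le_sum hterm).trans ?_)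
    rw [← Finset.mul_sum, Finset.sum_range_reflect (fun i => ρ ^ i) T]
    calc _ ≤ ‖D.ω‖ * (Φ / (1 - ρ)) * ‖D.B‖ * U * (1 / (1 - ρ)) := by
          gcongr; exact sum_geometric_le hρ hρ1 T
      _ = _ := by field_simp
  rw [abs_le] at h1 h2 ⊢
  constructor <;> linarith

end Loop

/-! ### Measurability and integrability of the closed loop -/

section Measurability

variable {n d : ℕ} {S : Type*} {mS : MeasurableSpace S} {μ : Measure S} {ℱ : Filtration ℕ mS}
  {D : Bandit n d S} {π : Rule d} {σ : ℝ}

lemma measurable_toEuclideanLin {n m : ℕ} (M : Matrix (Fin m) (Fin n) ℝ) :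
    Measurable fun x : EuclideanSpace ℝ (Fin n) => M.toEuclideanLin x :=
  (LinearMap.continuous_of_finiteDimensional _).measurable

lemma measurable_snoc_pair [MeasurableSpace S] {t : ℕ} {h : S → History d t}
    {u : S → EuclideanSpace ℝ (Fin d)} {y : S → ℝ} (hh : Measurable h) (hu : Measurable u)
    (hy : Measurable y) :
    Measurable fun s => (Fin.snoc (h s) (u s, y s) : History d (t + 1)) := by
  refine measurable_pi_iff.2 fun i => ?_
  induction i using Fin.lastCases with
  | last => simpa using hu.prodMk hy
  | cast i => simpa using measurable_pi_iff.1 hh i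

lemma Noise.measurable_run (hN : Noise μ ℱ D σ) (hπ : ∀ t, Measurable (π t)) (t : ℕ) :
    Measurable[ℱ t] (state D π t) ∧ Measurable[ℱ t] fun s => (run D π s t).2 := by
  induction t with
  | zero =>
    refine ⟨hN.init_meas.measurable, ?_⟩
    have : (fun s => (run D π s 0).2) = fun _ => fun i : Fin 0 => i.elim0 := rfl
    rw [this]; exact measurable_const
  | succ t ih =>
    have hle : ℱ t ≤ ℱ (t + 1) := ℱ.mono (Nat.le_succ t)
    have hx : Measurable[ℱ (t + 1)] (state D π t) := ih.1.mono hle le_rfl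
    have hh : Measurable[ℱ (t + 1)] fun s => (run D π s t).2 := ih.2.mono hle le_rfl
    have hu : Measurable[ℱ (t + 1)] (action D π t) := (hπ t).comp hh
    have hε : Measurable[ℱ (t + 1)] (D.ε t) := (hN.state_meas t).measurable
    have hη : Measurable[ℱ (t + 1)] (D.η t) := (hN.reward_meas t).measurable
    have hw : Measurable fun x : EuclideanSpace ℝ (Fin n) => inner ℝ D.ω x :=
      (continuous_const.inner continuous_id).measurable
    have hθ : Measurable fun x : EuclideanSpace ℝ (Fin d) => inner ℝ D.θ x :=
      (continuous_const.inner continuous_id).measurable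
    refine ⟨?_, @measurable_snoc_pair d S (ℱ (t + 1)) t _ _ _ hh hu
      (((hw.comp hx).add (hθ.comp hu)).add hη)⟩
    exact (((measurable_toEuclideanLin D.A).comp hx).add
      ((measurable_toEuclideanLin D.B).comp hu)).add hε

lemma Noise.measurable_action (hN : Noise μ ℱ D σ) (hπ : ∀ t, Measurable (π t)) (t : ℕ) :
    Measurable[ℱ t] (action D π t) :=
  (hπ t).comp (hN.measurable_run hπ t).2

lemma integrable_toEuclideanLin {n m : ℕ} (M : Matrix (Fin m) (Fin n) ℝ)
    {f : S → EuclideanSpace ℝ (Fin n)} (hf : Integrable f μ) :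
    Integrable (fun s => M.toEuclideanLin (f s)) μ :=
  (LinearMap.toContinuousLinearMap M.toEuclideanLin).integrable_comp hf

variable [IsProbabilityMeasure μ]

lemma Noise.integral_stateNoise (hN : Noise μ ℱ D σ) (t : ℕ) : ∫ s, D.ε t s ∂μ = 0 := by
  rw [← integral_condExp (ℱ.le t), integral_congr_ae (hN.state_sub t).mean_zero]
  simp

lemma Noise.integral_rewardNoise (hN : Noise μ ℱ D σ) (t : ℕ) : ∫ s, D.η t s ∂μ = 0 := by
  rw [← integral_condExp (ℱ.le t), integral_congr_ae (hN.reward_sub t).mean_zero]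
  simp

lemma Noise.integrable_action (hN : Noise μ ℱ D σ) (hπ : ∀ t, Measurable (π t)) {U : ℝ}
    (hU : ∀ t s, ‖action D π t s‖ ≤ U) (t : ℕ) : Integrable (action D π t) μ :=
  Integrable.of_bound ((hN.measurable_action hπ t).mono (ℱ.le t) le_rfl).aestronglyMeasurable U
    (Eventually.of_forall (hU t))

lemma Noise.integrable_reward (hN : Noise μ ℱ D σ) (hπ : ∀ t, Measurable (π t)) {U X : ℝ}
    (hX : ∀ᵐ s ∂μ, ‖D.x₁ s‖ ≤ X) (hU : ∀ t s, ‖action D π t s‖ ≤ U) (t : ℕ) :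
    Integrable (reward D π t) μ := by
  have hu := hN.integrable_action hπ hU
  have hx : ∀ t, Integrable (state D π t) μ := by
    intro t
    induction t with
    | zero => exact Integrable.of_bound (hN.init_meas.mono (ℱ.le 0)).aestronglyMeasurable X hX
    | succ t ih =>
      exact ((integrable_toEuclideanLin D.A ih).add (integrable_toEuclideanLin D.B (hu t))).add
        (hN.state_sub t).integrable
  exact (((hx t).const_inner _).add ((hu t).const_inner _)).add (hN.reward_sub t).integrable

/-- The expected cumulative reward of any policy differs from the expected cumulative steady-state
performance of its actions by a bounded amount. -/
lemma Noise.abs_integral_sum_sub_le (hN : Noise μ ℱ D σ) (hπ : ∀ t, Measurable (π t))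
    {Φ ρ U X : ℝ} (hA : ∀ τ, ‖D.A ^ τ‖ ≤ Φ * ρ ^ τ) (hΦ : 0 ≤ Φ) (hρ : 0 ≤ ρ) (hρ1 : ρ < 1)
    (hX : ∀ᵐ s ∂μ, ‖D.x₁ s‖ ≤ X) (hU : ∀ t s, ‖action D π t s‖ ≤ U) (T : ℕ) :
    |∫ s, ∑ t ∈ Finset.range T, (reward D π t s - inner ℝ (cumMarkov D) (action D π t s)) ∂μ|
      ≤ ‖D.ω‖ * Φ * ‖D.B‖ * U / (1 - ρ) ^ 2 + ‖D.ω‖ * Φ * X / (1 - ρ) := by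
  set f : S → ℝ := fun s => ∑ t ∈ Finset.range T,
    (reward D π t s - inner ℝ (cumMarkov D) (action D π t s)) with hf
  set g : S → ℝ := fun s => ∑ t ∈ Finset.range T, (inner ℝ D.ω ((neumann D.A
            - neumann D.A * D.A ^ (T - 1 - t)).toEuclideanLin (D.ε t s)) + D.η t s) with hg
  have hfi : Integrable f μ := integrable_finsetSum _ fun t _ =>
    (hN.integrable_reward hπ hX hU t).sub ((hN.integrable_action hπ hU t).const_inner _)
  have hεi : ∀ t, Integrable (fun s => inner ℝ D.ω ((neumann D.A
      - neumann D.A * D.A ^ (T - 1 - t)).toEuclideanLin (D.ε t s))) μ := fun t =>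
    (integrable_toEuclideanLin _ (hN.state_sub t).integrable).const_inner _
  have hgi : Integrable g μ := integrable_finsetSum _ fun t _ =>
    (hεi t).add (hN.reward_sub t).integrable
  have hg0 : ∫ s, g s ∂μ = 0 := by
    refine (integral_finsetSum _ fun t _ => (hεi t).add (hN.reward_sub t).integrable).trans ?_
    refine Finset.sum_eq_zero fun t _ => ?_
    refine (integral_add (hεi t) (hN.reward_sub t).integrable).trans ?_
    rw [hN.integral_rewardNoise, add_zero]
    simp only [inner_toEuclideanLin _ D.ω]
    rw [integral_inner (hN.state_sub t).integrable, hN.integral_stateNoise, inner_zero_right]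
  have hsub : ∫ s, f s ∂μ = ∫ s, (f s - g s) ∂μ := by
    rw [integral_sub hfi hgi, hg0, sub_zero]
  rw [hsub, ← Real.norm_eq_abs]
  refine (norm_integral_le_of_norm_le_const (C := ‖D.ω‖ * Φ * ‖D.B‖ * U / (1 - ρ) ^ 2
    + ‖D.ω‖ * Φ * X / (1 - ρ)) ?_).trans (by simp)
  filter_upwards [hX] with s hs
  rw [Real.norm_eq_abs, hf, hg]
  simp only
  rw [sum_reward_sub hA hρ hρ1, add_sub_cancel_left]
  exact abs_boundary_le hA hΦ hρ hρ1 hs (fun t => hU t s) T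

end Measurability

/-! ### Average rewards -/

section Average

variable {n d : ℕ} {S : Type*} {mS : MeasurableSpace S} {μ : Measure S} [IsProbabilityMeasure μ]
  {ℱ : Filtration ℕ mS} {D : Bandit n d S} {σ Φ ρ X : ℝ}

/-- The expected average reward over `H` rounds is the expected average steady-state performance of
the actions, up to `O(1 / H)`. -/
lemma Noise.abs_avg_sub_le (hN : Noise μ ℱ D σ) (hA : ∀ τ, ‖D.A ^ τ‖ ≤ Φ * ρ ^ τ) (hΦ : 0 ≤ Φ)
    (hρ : 0 ≤ ρ) (hρ1 : ρ < 1) (hX : ∀ᵐ s ∂μ, ‖D.x₁ s‖ ≤ X) {π : Rule d}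
    (hπ : ∀ t, Measurable (π t)) {U : ℝ} (hU : ∀ t s, ‖action D π t s‖ ≤ U) (H : ℕ) :
    |(∫ s, (1 / (H : ℝ)) * ∑ t ∈ Finset.range H, reward D π t s ∂μ)
        - (1 / (H : ℝ)) * ∫ s, ∑ t ∈ Finset.range H, inner ℝ (cumMarkov D) (action D π t s) ∂μ|
      ≤ (‖D.ω‖ * Φ * ‖D.B‖ * U / (1 - ρ) ^ 2 + ‖D.ω‖ * Φ * X / (1 - ρ)) / H := by
  have h := hN.abs_integral_sum_sub_le hπ hA hΦ hρ hρ1 hX hU H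
  simp only [Finset.sum_sub_distrib] at h
  rw [integral_sub (integrable_finsetSum _ fun t _ => hN.integrable_reward hπ hX hU t)
    (integrable_finsetSum _ fun t _ => (hN.integrable_action hπ hU t).const_inner _)] at h
  rw [integral_const_mul, ← mul_sub, abs_mul, abs_of_nonneg (by positivity : 0 ≤ 1 / (H : ℝ)),
    one_div, div_eq_inv_mul _ (H : ℝ)]
  gcongr

/-- The steady-state performance of a constant action. -/
lemma Noise.avgReward_constRule (hN : Noise μ ℱ D σ) (hA : ∀ τ, ‖D.A ^ τ‖ ≤ Φ * ρ ^ τ)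
    (hΦ : 0 ≤ Φ) (hρ : 0 ≤ ρ) (hρ1 : ρ < 1) (hX : ∀ᵐ s ∂μ, ‖D.x₁ s‖ ≤ X)
    (u : EuclideanSpace ℝ (Fin d)) :
    avgReward μ D (constRule u) = inner ℝ (cumMarkov D) u := by
  refine Tendsto.liminf_eq ?_
  have h := fun H => hN.abs_avg_sub_le hA hΦ hρ hρ1 hX (π := constRule u)
    (fun _ => measurable_const) (U := ‖u‖) (fun t s => le_rfl) H
  rw [← tendsto_sub_nhds_zero_iff]
  refine squeeze_zero_norm' ?_ (tendsto_const_div_atTop_nhds_zero_nat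
    (‖D.ω‖ * Φ * ‖D.B‖ * ‖u‖ / (1 - ρ) ^ 2 + ‖D.ω‖ * Φ * X / (1 - ρ)))
  filter_upwards [eventually_gt_atTop 0] with H hH
  have hH' : (H : ℝ) ≠ 0 := by positivity
  refine le_trans (le_of_eq ?_) (h H)
  rw [Real.norm_eq_abs]
  congr 2
  simp only [action, constRule, Finset.sum_const, Finset.card_range, integral_const, nsmul_eq_mul,
    probReal_univ, one_smul]
  field_simp

/-- Adaptive policies do not beat the best constant action on average. -/
lemma Noise.optReward_le (hN : Noise μ ℱ D σ) (hA : ∀ τ, ‖D.A ^ τ‖ ≤ Φ * ρ ^ τ)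
    (hΦ : 0 ≤ Φ) (hρ : 0 ≤ ρ) (hρ1 : ρ < 1) (hX : ∀ᵐ s ∂μ, ‖D.x₁ s‖ ≤ X)
    {𝒰 : Set (EuclideanSpace ℝ (Fin d))} {U : ℝ} (hU : ∀ u ∈ 𝒰, ‖u‖ ≤ U) (hne : 𝒰.Nonempty)
    {M : ℝ} (hM : ∀ u ∈ 𝒰, inner ℝ (cumMarkov D) u ≤ M) : optReward μ D 𝒰 ≤ M := by
  obtain ⟨u₀, hu₀⟩ := hne
  refine csSup_le ⟨_, constRule u₀, ⟨fun _ => measurable_const, fun _ _ _ => hu₀⟩, rfl⟩ ?_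
  rintro _ ⟨π, hπ, rfl⟩
  have hUa : ∀ t s, ‖action D π t s‖ ≤ U := fun t s => hU _ (action_mem hπ t s)
  set K := ‖D.ω‖ * Φ * ‖D.B‖ * U / (1 - ρ) ^ 2 + ‖D.ω‖ * Φ * X / (1 - ρ) with hK
  have h := fun H => hN.abs_avg_sub_le hA hΦ hρ hρ1 hX hπ.measurable hUa H
  have hint : ∀ t, Integrable (fun s => inner ℝ (cumMarkov D) (action D π t s)) μ := fun t =>
    (hN.integrable_action hπ.measurable hUa t).const_inner _
  set I : ℕ → ℝ := fun H => ∫ s, ∑ t ∈ Finset.range H, inner ℝ (cumMarkov D) (action D π t s) ∂μ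
    with hI
  have hIub : ∀ H, I H ≤ H * M := by
    intro H
    rw [hI]
    simp only
    rw [integral_finsetSum _ fun t _ => hint t]
    refine (Finset.sum_le_sum fun t _ => (integral_mono (hint t) (integrable_const M)
      fun s => hM _ (action_mem hπ t s))).trans ?_
    simp
  have hIlb : ∀ H, H * (-(‖cumMarkov D‖ * U)) ≤ I H := by
    intro H
    rw [hI]
    simp only
    rw [integral_finsetSum _ fun t _ => hint t]
    refine le_trans ?_ (Finset.sum_le_sum fun t _ => (integral_mono
      (integrable_const (-(‖cumMarkov D‖ * U))) (hint t) fun s => ?_))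
    · simp
    · refine neg_le_of_abs_le ((abs_real_inner_le_norm _ _).trans ?_)
      gcongr
      exact hUa t s
  have hlim : Tendsto (fun H : ℕ => M + K / H) atTop (nhds M) := by
    simpa using (tendsto_const_div_atTop_nhds_zero_nat K).const_add M
  -- bounds from below make the lower limit genuine rather than a junk value
  have hlow : Tendsto (fun H : ℕ => -(‖cumMarkov D‖ * U) - K / H) atTop
      (nhds (-(‖cumMarkov D‖ * U))) := by
    simpa using (tendsto_const_div_atTop_nhds_zero_nat K).const_sub (-(‖cumMarkov D‖ * U))
  rw [avgReward, ← hlim.liminf_eq]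
  refine liminf_le_liminf ?_ ?_ hlim.isCoboundedUnder_ge
  · filter_upwards [eventually_gt_atTop 0] with H hH
    have hH' : (0 : ℝ) < H := by exact_mod_cast hH
    have h1 := (abs_le.1 (h H)).2
    have h2 : 1 / (H : ℝ) * I H ≤ M := by
      rw [one_div, inv_mul_le_iff₀ hH']; exact hIub H
    linarith
  · refine hlow.isBoundedUnder_ge.mono_ge ?_
    filter_upwards [eventually_gt_atTop 0] with H hH
    have hH' : (0 : ℝ) < H := by exact_mod_cast hH
    have h1 := (abs_le.1 (h H)).1
    have h2 : -(‖cumMarkov D‖ * U) ≤ 1 / (H : ℝ) * I H := by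
      rw [one_div, le_inv_mul_iff₀ hH']; exact hIlb H
    linarith

end Average

/-! ### Epochs -/

section Epochs

variable {ρbar : ℝ}

lemma epochEnd_zero : epochEnd ρbar 0 = 0 := by simp [epochEnd]

lemma epochEnd_succ (k : ℕ) :
    epochEnd ρbar (k + 1) = epochEnd ρbar k + persist ρbar (k + 1) + 1 := by
  rw [epochEnd, Finset.sum_Icc_succ_top (by omega), ← epochEnd]; omega

lemma epochEnd_strictMono : StrictMono (epochEnd ρbar) :=
  strictMono_nat_of_lt_succ fun k => by rw [epochEnd_succ]; omega

lemma le_epochEnd (k : ℕ) : k ≤ epochEnd ρbar k := epochEnd_strictMono.le_apply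

lemma isBoundary_epochEnd (k : ℕ) : IsBoundary ρbar (epochEnd ρbar k) := ⟨k, rfl⟩

lemma not_isBoundary {k i : ℕ} (hi : i < persist ρbar (k + 1)) :
    ¬ IsBoundary ρbar (epochEnd ρbar k + i + 1) := by
  rintro ⟨m, hm⟩
  have h1 : k < m := (epochEnd_strictMono (ρbar := ρbar)).lt_iff_lt.1 (by omega)
  have h2 : m < k + 1 := (epochEnd_strictMono (ρbar := ρbar)).lt_iff_lt.1
    (by rw [epochEnd_succ]; omega)
  omega

open Classical in
/-- The rounds that end an epoch, among those of the first `k` epochs. -/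
lemma sum_isBoundary {M : Type*} [AddCommMonoid M] (f : ℕ → M) (k : ℕ) :
    ∑ i ∈ Finset.range (epochEnd ρbar k), (if IsBoundary ρbar (i + 1) then f i else 0)
      = ∑ j ∈ Finset.range k, f (epochEnd ρbar j + persist ρbar (j + 1)) := by
  induction k with
  | zero => simp [epochEnd_zero]
  | succ k ih =>
    rw [Finset.sum_range_succ, ← ih, epochEnd_succ, Finset.sum_range_succ, Finset.sum_range_add,
      if_pos (by rw [← epochEnd_succ]; exact isBoundary_epochEnd _)]
    congr 1
    rw [Finset.sum_eq_zero fun i hi => if_neg (not_isBoundary (Finset.mem_range.1 hi)), add_zero]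

/-- Persisting for `H_m` rounds makes the forgetting factor `1 / m`, up to the factor `1 / ρbar`
lost by rounding `H_m` down. -/
lemma pow_persist_le (hρ : 0 < ρbar) (hρ1 : ρbar < 1) {m : ℕ} (hm : 0 < m) :
    ρbar ^ persist ρbar m ≤ 1 / (ρbar * m) := by
  have hm' : (0 : ℝ) < m := by exact_mod_cast hm
  have hL : 0 < Real.log (1 / ρbar) := Real.log_pos (by rw [lt_div_iff₀ hρ]; linarith)
  have h1 : Real.log m < (persist ρbar m + 1) * Real.log (1 / ρbar) := by
    rw [← div_lt_iff₀ hL]; exact Nat.lt_floor_add_one _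
  have h2 : (m : ℝ) ≤ (1 / ρbar) ^ (persist ρbar m + 1) := by
    rw [← Real.log_le_log_iff hm' (by positivity), Real.log_pow]
    push_cast; exact h1.le
  rw [le_div_iff₀ (by positivity)]
  calc ρbar ^ persist ρbar m * (ρbar * m) = ρbar ^ (persist ρbar m + 1) * m := by ring
    _ ≤ ρbar ^ (persist ρbar m + 1) * (1 / ρbar) ^ (persist ρbar m + 1) := by gcongr
    _ = 1 := by rw [← mul_pow, mul_one_div_cancel hρ.ne', one_pow]

lemma persist_le (hρ : 0 < ρbar) (hρ1 : ρbar < 1) {m T : ℕ} (hm : 0 < m) (hmT : m ≤ T) :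
    (persist ρbar m : ℝ) ≤ Real.log T / (1 - ρbar) := by
  have hm1 : (1 : ℝ) ≤ m := by exact_mod_cast hm
  have hmT' : (m : ℝ) ≤ T := by exact_mod_cast hmT
  have hL : 1 - ρbar ≤ Real.log (1 / ρbar) := by
    rw [one_div, Real.log_inv]
    linarith [Real.log_le_sub_one_of_pos hρ]
  have h0 : 0 ≤ Real.log m := Real.log_nonneg hm1
  have hL0 : 0 < Real.log (1 / ρbar) := by linarith
  refine (Nat.floor_le (by positivity)).trans ?_
  have : Real.log m ≤ Real.log T := Real.log_le_log (by linarith) hmT'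
  exact div_le_div₀ (h0.trans this) this (by linarith) hL

lemma sum_inv_sq_le_two (k : ℕ) : ∑ j ∈ Finset.range k, (1 / ((j : ℝ) + 1)) ^ 2 ≤ 2 := by
  suffices h : ∀ k : ℕ, ∑ j ∈ Finset.range (k + 1), (1 / ((j : ℝ) + 1)) ^ 2 ≤ 2 - 1 / ((k : ℝ) + 1) by
    rcases k with _ | k
    · simp
    · have : (0 : ℝ) ≤ 1 / ((k : ℝ) + 1) := by positivity
      linarith [h k]
  intro k
  induction k with
  | zero => norm_num
  | succ k ih =>
    rw [Finset.sum_range_succ]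
    have : (1 / (((k + 1 : ℕ) : ℝ) + 1)) ^ 2 ≤ 1 / ((k : ℝ) + 1) - 1 / (((k + 1 : ℕ) : ℝ) + 1) := by
      push_cast
      rw [div_pow, div_sub_div _ _ (by positivity) (by positivity),
        div_le_div_iff₀ (by positivity) (by positivity)]
      nlinarith [(Nat.cast_nonneg k : (0 : ℝ) ≤ k)]
    linarith

end Epochs

/-! ### The regression problem solved by the algorithm -/

lemma inner_eq_dotProduct {d : ℕ} (x y : EuclideanSpace ℝ (Fin d)) :
    inner ℝ x y = x.ofLp ⬝ᵥ y.ofLp := by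
  simp [PiLp.inner_apply, dotProduct, mul_comm]

lemma dotProduct_self_eq_norm_sq {d : ℕ} (x : EuclideanSpace ℝ (Fin d)) :
    x.ofLp ⬝ᵥ x.ofLp = ‖x‖ ^ 2 := by
  rw [← inner_eq_dotProduct, real_inner_self_eq_norm_sq]

section Stability

variable {n d : ℕ} {S : Type*} {D : Bandit n d S} {b : Bounds} {ρbar : ℝ}

lemma Stable.normRatio_ne_top (h : Stable D b ρbar) : normRatio D.A ≠ ⊤ :=
  ne_top_of_le_ne_top ENNReal.ofReal_ne_top h.normRatio_le

lemma Stable.toReal_normRatio_le (h : Stable D b ρbar) : (normRatio D.A).toReal ≤ b.Φ :=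
  ENNReal.toReal_le_of_le_ofReal h.nonneg h.normRatio_le

lemma specRad_nonneg {n : ℕ} (A : Matrix (Fin n) (Fin n) ℝ) : 0 ≤ specRad A :=
  ENNReal.toReal_nonneg

lemma Stable.norm_pow_le (h : Stable D b ρbar) (τ : ℕ) : ‖D.A ^ τ‖ ≤ b.Φ * ρbar ^ τ :=
  (norm_pow_le_normRatio h.normRatio_ne_top τ).trans
    (mul_le_mul h.toReal_normRatio_le (pow_le_pow_left₀ (specRad_nonneg _) h.specRad_le _)
      (pow_nonneg (specRad_nonneg _) _) h.nonneg)

end Stability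

section Epoch

variable {n d : ℕ} {S : Type*} {D : Bandit n d S} {π : Rule d}
  {𝒰 : Set (EuclideanSpace ℝ (Fin d))} {b : Bounds} {ρbar σ lam δ : ℝ}

/-- The action played throughout the `k`-th epoch (counted from `0`). -/
noncomputable def epochAction (D : Bandit n d S) (π : Rule d) (ρbar : ℝ) (k : ℕ) (s : S) :
    EuclideanSpace ℝ (Fin d) :=
  action D π (epochEnd ρbar k) s

/-- The noise in the reward of the last round of the `k`-th epoch, including the state noises
accumulated since the beginning of the epoch. -/
noncomputable def epochNoise (D : Bandit n d S) (ρbar : ℝ) (k : ℕ) (s : S) : ℝ :=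
  ∑ i ∈ Finset.range (persist ρbar (k + 1)),
      inner ℝ (((D.A ^ (persist ρbar (k + 1) - 1 - i))ᴴ).toEuclideanLin D.ω)
        (D.ε (epochEnd ρbar k + i) s)
    + D.η (epochEnd ρbar k + persist ρbar (k + 1)) s

/-- The bias of the reward of the last round of the `k`-th epoch as an observation of the
steady-state performance: the memory of the initial state of the epoch, minus the effect of the
action that is still to come. -/
noncomputable def epochBias (D : Bandit n d S) (π : Rule d) (ρbar : ℝ) (k : ℕ) (s : S) : ℝ :=
  inner ℝ D.ω ((D.A ^ persist ρbar (k + 1)).toEuclideanLin (state D π (epochEnd ρbar k) s))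
    - inner ℝ D.ω ((neumann D.A * D.A ^ persist ρbar (k + 1)).toEuclideanLin
        (D.B.toEuclideanLin (epochAction D π ρbar k s)))

lemma action_epochEnd_add (hπ : IsDynLinUCB 𝒰 b ρbar σ lam δ π) (k : ℕ) {i : ℕ}
    (hi : i ≤ persist ρbar (k + 1)) (s : S) :
    action D π (epochEnd ρbar k + i) s = epochAction D π ρbar k s := by
  induction i with
  | zero => rfl
  | succ i ih =>
    rw [← ih (by omega)]
    refine (hπ.persistent (epochEnd ρbar k + i) _ (fun j => ?_) (not_isBoundary (by omega))).trans
      ?_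
    · rw [history_apply]; exact action_mem hπ.policy _ _
    · rw [history_apply]; rfl

lemma gram_epochEnd (hπ : IsDynLinUCB 𝒰 b ρbar σ lam δ π) (k : ℕ) (s : S) :
    gram lam ρbar (run D π s (epochEnd ρbar k)).2
      = gramSeq lam (fun j => (epochAction D π ρbar j s).ofLp) k := by
  classical
  rw [gram, gramSeq]
  simp only [history_apply]
  congr 1
  rw [Fin.sum_univ_eq_sum_range (fun i => if IsBoundary ρbar (i + 1) then
    vecMulVec (action D π i s).ofLp (action D π i s).ofLp else 0)]
  refine (sum_isBoundary (fun i => vecMulVec (action D π i s).ofLp (action D π i s).ofLp)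
    k).trans ?_
  exact Finset.sum_congr rfl fun j _ => by rw [action_epochEnd_add hπ j le_rfl s]

lemma corr_epochEnd (hπ : IsDynLinUCB 𝒰 b ρbar σ lam δ π) (k : ℕ) (s : S) :
    corr ρbar (run D π s (epochEnd ρbar k)).2
      = ∑ j ∈ Finset.range k, reward D π (epochEnd ρbar j + persist ρbar (j + 1)) s
          • (epochAction D π ρbar j s).ofLp := by
  classical
  rw [corr]
  simp only [history_apply]
  rw [Fin.sum_univ_eq_sum_range (fun i => if IsBoundary ρbar (i + 1) then
    reward D π i s • (action D π i s).ofLp else 0)]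
  refine (sum_isBoundary (fun i => reward D π i s • (action D π i s).ofLp) k).trans ?_
  exact Finset.sum_congr rfl fun j _ => by rw [action_epochEnd_add hπ j le_rfl s]

/-- The reward of the last round of an epoch as an observation of the steady-state performance of
the action of the epoch. -/
lemma reward_epoch_eq (hS : Stable D b ρbar) (hρ : 0 ≤ ρbar)
    (hπ : IsDynLinUCB 𝒰 b ρbar σ lam δ π) (k : ℕ) (s : S) :
    reward D π (epochEnd ρbar k + persist ρbar (k + 1)) s
      = inner ℝ (cumMarkov D) (epochAction D π ρbar k s) + epochBias D π ρbar k s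
        + epochNoise D ρbar k s := by
  set H := persist ρbar (k + 1) with hH
  have hsum : ∑ i ∈ Finset.range H, (D.A ^ (H - 1 - i)).toEuclideanLin
        (D.B.toEuclideanLin (epochAction D π ρbar k s))
      = (neumann D.A).toEuclideanLin (D.B.toEuclideanLin (epochAction D π ρbar k s))
        - (neumann D.A * D.A ^ H).toEuclideanLin
          (D.B.toEuclideanLin (epochAction D π ρbar k s)) := by
    rw [Finset.sum_range_reflect (fun i => (D.A ^ i).toEuclideanLin
      (D.B.toEuclideanLin (epochAction D π ρbar k s))) H, ← LinearMap.sub_apply, ← map_sub,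
      neumann_sub_neumann_mul_pow hS.norm_pow_le hρ hS.lt_one, map_sum, LinearMap.sum_apply]
  rw [reward, state_add, action_epochEnd_add hπ k le_rfl]
  have h1 : ∀ i ∈ Finset.range H, (D.A ^ (H - 1 - i)).toEuclideanLin
        (D.B.toEuclideanLin (action D π (epochEnd ρbar k + i) s) + D.ε (epochEnd ρbar k + i) s)
      = (D.A ^ (H - 1 - i)).toEuclideanLin (D.B.toEuclideanLin (epochAction D π ρbar k s))
        + (D.A ^ (H - 1 - i)).toEuclideanLin (D.ε (epochEnd ρbar k + i) s) := by
    intro i hi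
    rw [action_epochEnd_add hπ k (Finset.mem_range.1 hi).le, map_add]
  rw [Finset.sum_congr rfl h1, Finset.sum_add_distrib, hsum, inner_cumMarkov, epochBias,
    epochNoise]
  simp only [inner_add_right, inner_sub_right, inner_sum, ← inner_toEuclideanLin, ← hH]
  ring

end Epoch

/-- The bound `Ω Φ (U B / (1 - ρbar) + X)` on the bias of a reward, before the discount by the
length of the epoch. -/
noncomputable def biasScale (b : Bounds) (ρbar : ℝ) : ℝ :=
  b.Ω * b.Φ * (b.U * b.B / (1 - ρbar) + b.X)

/-- The variance proxy of the noise accumulated over an epoch. -/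
noncomputable def noiseProxy (b : Bounds) (ρbar σ : ℝ) : ℝ :=
  σ ^ 2 * (1 + b.Ω ^ 2 * b.Φ ^ 2 / (1 - ρbar ^ 2))

section Probability

variable {n d : ℕ} {S : Type*} {mS : MeasurableSpace S} {μ : Measure S}
  {ℱ : Filtration ℕ mS} {D : Bandit n d S} {π : Rule d}
  {𝒰 : Set (EuclideanSpace ℝ (Fin d))} {b : Bounds} {ρbar σ lam δ : ℝ}

lemma abs_epochBias_le (hS : Stable D b ρbar) (hB : Bounded μ D 𝒰 b π) (hρ : 0 < ρbar)
    (hπ : IsDynLinUCB 𝒰 b ρbar σ lam δ π) {s : S} (hs : ∀ t, ‖state D π t s‖ ≤ b.X) (k : ℕ) :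
    |epochBias D π ρbar k s| ≤ biasScale b ρbar / ρbar * (1 / ((k : ℝ) + 1)) := by
  have hr : 0 < 1 - ρbar := by linarith [hS.lt_one]
  have hΦ := hS.nonneg
  have hΩ : 0 ≤ b.Ω := (norm_nonneg _).trans hB.omega_le
  have hBB : 0 ≤ b.B := (norm_nonneg _).trans hB.matrix_le
  have hX : 0 ≤ b.X := (norm_nonneg _).trans (hs 0)
  have hu : ‖epochAction D π ρbar k s‖ ≤ b.U := hB.action_le _ (action_mem hπ.policy _ _)
  have hU : 0 ≤ b.U := (norm_nonneg _).trans hu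
  set H := persist ρbar (k + 1) with hH
  have h1 : |inner ℝ D.ω ((D.A ^ H).toEuclideanLin (state D π (epochEnd ρbar k) s))|
      ≤ b.Ω * (b.Φ * ρbar ^ H * b.X) := by
    refine (abs_inner_toEuclideanLin_le _ _ _).trans ?_
    gcongr
    · exact hB.omega_le
    · exact hS.norm_pow_le H
    · exact hs _
  have h2 : |inner ℝ D.ω ((neumann D.A * D.A ^ H).toEuclideanLin
        (D.B.toEuclideanLin (epochAction D π ρbar k s)))|
      ≤ b.Ω * (b.Φ * ρbar ^ H / (1 - ρbar) * (b.B * b.U)) := by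
    refine (abs_inner_toEuclideanLin_le _ _ _).trans ?_
    gcongr
    · exact hB.omega_le
    · exact norm_neumann_mul_pow_le hS.norm_pow_le hρ.le hS.lt_one H
    · exact (norm_toEuclideanLin_le _ _).trans
        (mul_le_mul hB.matrix_le hu (norm_nonneg _) hBB)
  have h3 : |epochBias D π ρbar k s| ≤ biasScale b ρbar * ρbar ^ H := by
    rw [epochBias, ← hH]
    have h4 : biasScale b ρbar * ρbar ^ H = b.Ω * (b.Φ * ρbar ^ H * b.X)
        + b.Ω * (b.Φ * ρbar ^ H / (1 - ρbar) * (b.B * b.U)) := by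
      rw [biasScale]; ring
    rw [h4]
    rw [abs_le] at h1 h2 ⊢
    constructor <;> linarith
  have h0 : 0 ≤ biasScale b ρbar := by rw [biasScale]; positivity
  calc _ ≤ biasScale b ρbar * ρbar ^ H := h3
    _ ≤ biasScale b ρbar * (1 / (ρbar * ((k + 1 : ℕ) : ℝ))) := by
        gcongr; exact pow_persist_le hρ hS.lt_one (Nat.succ_pos k)
    _ = _ := by push_cast; field_simp

/-- The biases are square summable, as they decay like `1 / (k + 1)`. -/
lemma sqrt_sum_epochBias_sq_le (hS : Stable D b ρbar) (hB : Bounded μ D 𝒰 b π) (hρ : 0 < ρbar)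
    (hπ : IsDynLinUCB 𝒰 b ρbar σ lam δ π) {s : S} (hs : ∀ t, ‖state D π t s‖ ≤ b.X) (k : ℕ) :
    √(∑ j ∈ Finset.range k, epochBias D π ρbar j s ^ 2) ≤ 2 * (biasScale b ρbar / ρbar) := by
  have hb0 : 0 ≤ biasScale b ρbar / ρbar := by
    have := (abs_nonneg _).trans (abs_epochBias_le hS hB hρ hπ hs 0)
    simpa using this
  refine Real.sqrt_le_iff.2 ⟨by positivity, ?_⟩
  calc ∑ j ∈ Finset.range k, epochBias D π ρbar j s ^ 2
      ≤ ∑ j ∈ Finset.range k, (biasScale b ρbar / ρbar) ^ 2 * (1 / ((j : ℝ) + 1)) ^ 2 := by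
        refine Finset.sum_le_sum fun j _ => ?_
        rw [← mul_pow, ← sq_abs]
        exact pow_le_pow_left₀ (abs_nonneg _) (abs_epochBias_le hS hB hρ hπ hs j) 2
    _ ≤ (biasScale b ρbar / ρbar) ^ 2 * 2 := by
        rw [← Finset.mul_sum]; gcongr; exact sum_inv_sq_le_two k
    _ ≤ _ := by nlinarith [sq_nonneg (biasScale b ρbar / ρbar)]

lemma noiseProxy_nonneg (hρ : 0 ≤ ρbar) (hρ1 : ρbar < 1) : 0 ≤ noiseProxy b ρbar σ := by
  have : 0 ≤ 1 - ρbar ^ 2 := by nlinarith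
  rw [noiseProxy]; positivity

lemma beta_eq (t : ℕ) : beta b ρbar σ lam δ d t
    = b.U * b.Ω * b.Φ * (b.U * b.B / (1 - ρbar) + b.X) / √lam
        * Real.log (Real.exp 1 * ((t : ℝ) + 1))
      + (b.Θ + b.Ω * b.B * b.Φ / (1 - ρbar)) * √lam
      + √(2 * noiseProxy b ρbar σ
        * (Real.log (1 / δ) + d / 2 * Real.log (1 + t * b.U ^ 2 / (d * lam)))) := rfl

lemma Noise.predSubgaussian_epochNoise [IsProbabilityMeasure μ] (hN : Noise μ ℱ D σ)
    (hS : Stable D b ρbar) (hω : ‖D.ω‖ ≤ b.Ω) (hρ : 0 ≤ ρbar) (k : ℕ) :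
    PredSubgaussian μ (ℱ (epochEnd ρbar k)) (noiseProxy b ρbar σ) (epochNoise D ρbar k) := by
  have h := hN.predSubgaussian (epochEnd ρbar k) (persist ρbar (k + 1))
    (fun i => ((D.A ^ (persist ρbar (k + 1) - 1 - i))ᴴ).toEuclideanLin D.ω)
  refine h.mono ?_
  set H := persist ρbar (k + 1)
  have hΩ : 0 ≤ b.Ω := (norm_nonneg _).trans hω
  have hΦ := hS.nonneg
  have hρ2 : ρbar ^ 2 < 1 := by nlinarith [hS.lt_one]
  rw [noiseProxy]
  gcongr
  calc ∑ i ∈ Finset.range H, ‖((D.A ^ (H - 1 - i))ᴴ).toEuclideanLin D.ω‖ ^ 2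
      ≤ ∑ i ∈ Finset.range H, b.Ω ^ 2 * b.Φ ^ 2 * (ρbar ^ 2) ^ (H - 1 - i) := by
        refine Finset.sum_le_sum fun i _ => ?_
        have h1 : ‖((D.A ^ (H - 1 - i))ᴴ).toEuclideanLin D.ω‖
            ≤ b.Φ * ρbar ^ (H - 1 - i) * b.Ω := by
          refine (norm_toEuclideanLin_le _ _).trans ?_
          rw [Matrix.l2_opNorm_conjTranspose]
          exact mul_le_mul (hS.norm_pow_le _) hω (norm_nonneg _) (by positivity)
        calc _ ≤ (b.Φ * ρbar ^ (H - 1 - i) * b.Ω) ^ 2 := pow_le_pow_left₀ (norm_nonneg _) h1 2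
          _ = _ := by rw [mul_pow, mul_pow, ← pow_mul, ← pow_mul]; ring
    _ ≤ b.Ω ^ 2 * b.Φ ^ 2 * (1 / (1 - ρbar ^ 2)) := by
        rw [← Finset.mul_sum, Finset.sum_range_reflect (fun i => (ρbar ^ 2) ^ i) H]
        gcongr
        exact sum_geometric_le (sq_nonneg _) hρ2 H
    _ = _ := by ring

/-- The event on which the noise of the first `k` epochs stays within its confidence radius. -/
def NoiseControlled (D : Bandit n d S) (π : Rule d) (b : Bounds) (ρbar σ lam δ : ℝ) (k : ℕ)
    (s : S) : Prop :=
  (∑ j ∈ Finset.range k, epochNoise D ρbar j s • (epochAction D π ρbar j s).ofLp) ⬝ᵥ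
      ((gramSeq lam (fun j => (epochAction D π ρbar j s).ofLp) k)⁻¹ *ᵥ
        (∑ j ∈ Finset.range k, epochNoise D ρbar j s • (epochAction D π ρbar j s).ofLp))
    ≤ 2 * noiseProxy b ρbar σ * (Real.log (1 / δ)
      + (Real.log (gramSeq lam (fun j => (epochAction D π ρbar j s).ofLp) k).det
        - d * Real.log lam) / 2)

lemma Noise.measure_not_noiseControlled_le [IsProbabilityMeasure μ] (hN : Noise μ ℱ D σ)
    (hS : Stable D b ρbar) (hω : ‖D.ω‖ ≤ b.Ω) (hρ : 0 ≤ ρbar) (hπ : IsPolicy 𝒰 π)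
    (hlam : 0 < lam) (hδ : 0 < δ) (K : ℕ) :
    μ {s | ∃ k < K, ¬ NoiseControlled D π b ρbar σ lam δ k s} ≤ ENNReal.ofReal δ := by
  -- the filtration observed at the beginnings of the epochs
  let 𝒢 : Filtration ℕ mS :=
    { seq := fun k => ℱ (epochEnd ρbar k)
      mono' := fun i j hij => ℱ.mono (epochEnd_strictMono.monotone hij)
      le' := fun k => ℱ.le _ }
  have hu : ∀ k i, Measurable[𝒢 k] fun s => (epochAction D π ρbar k s).ofLp i := fun k i =>
    (measurable_pi_apply i).comp ((PiLp.continuous_ofLp 2 _).measurable.comp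
      (hN.measurable_action hπ.measurable (epochEnd ρbar k)))
  have hz : ∀ k, Measurable[𝒢 (k + 1)] (epochNoise D ρbar k) := by
    intro k
    have hlt : ∀ i ≤ persist ρbar (k + 1), epochEnd ρbar k + i + 1 ≤ epochEnd ρbar (k + 1) := by
      intro i hi; rw [epochEnd_succ]; omega
    refine Measurable.add (Finset.measurable_fun_sum _ fun i hi => ?_) ?_
    · exact ((stronglyMeasurable_const.inner (hN.state_meas _)).mono
        (ℱ.mono (hlt i (Finset.mem_range.1 hi).le))).measurable
    · exact ((hN.reward_meas _).mono (ℱ.mono (hlt _ le_rfl))).measurable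
  have h := measure_selfNormalized_le (𝒢 := 𝒢) hlam hδ
    (noiseProxy_nonneg (b := b) (σ := σ) hρ hS.lt_one) hu hz
    (fun k => hN.predSubgaussian_epochNoise hS hω hρ k) K
  refine le_trans (le_of_eq ?_) h
  congr 1
  ext s
  simp [NoiseControlled, not_le]

/-- The confidence ellipsoid of the algorithm, in epochs that start late enough for the logarithm
in the exploration coefficient to dominate the total bias `2 * biasScale b ρbar / ρbar`. -/
lemma abs_ridge_sub_le (hS : Stable D b ρbar) (hB : Bounded μ D 𝒰 b π) (hρ : 0 < ρbar)
    (hπ : IsDynLinUCB 𝒰 b ρbar σ lam δ π) (hd : 0 < d) (hlam : 0 < lam) {s : S}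
    (hs : ∀ t, ‖state D π t s‖ ≤ b.X) {k : ℕ} (hk : NoiseControlled D π b ρbar σ lam δ k s)
    (hwarm : b.U = 0 ∨
      2 * √lam ≤ ρbar * b.U * Real.log (Real.exp 1 * ((epochEnd ρbar k : ℝ) + 1)))
    {u : EuclideanSpace ℝ (Fin d)} (hu : u ∈ 𝒰) :
    |ridge lam ρbar (run D π s (epochEnd ρbar k)).2 ⬝ᵥ u.ofLp - inner ℝ (cumMarkov D) u|
      ≤ beta b ρbar σ lam δ d (epochEnd ρbar k)
        * √(u.ofLp ⬝ᵥ ((gram lam ρbar (run D π s (epochEnd ρbar k)).2)⁻¹ *ᵥ u.ofLp)) := by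
  rcases eq_or_ne b.U 0 with hU0 | hU0
  · -- without room for actions, the only action is zero
    have hu0 : u = 0 := norm_le_zero_iff.1 (hU0 ▸ hB.action_le u hu)
    simp [hu0]
  have hwarm := hwarm.resolve_left hU0
  have hr : 0 < 1 - ρbar := by linarith [hS.lt_one]
  have hΦ := hS.nonneg
  have hΩ : 0 ≤ b.Ω := (norm_nonneg _).trans hB.omega_le
  have hBB : 0 ≤ b.B := (norm_nonneg _).trans hB.matrix_le
  have hX : 0 ≤ b.X := (norm_nonneg _).trans (hs 0)
  have hU : 0 < b.U := lt_of_le_of_ne ((norm_nonneg _).trans (hB.action_le u hu)) hU0.symm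
  have hsl : 0 < √lam := Real.sqrt_pos.2 hlam
  have hc0 : 0 ≤ biasScale b ρbar := by rw [biasScale]; positivity
  have hv0 := noiseProxy_nonneg (b := b) (σ := σ) hρ.le hS.lt_one
  set t := epochEnd ρbar k with ht
  have hkt : (k : ℝ) ≤ t := by exact_mod_cast le_epochEnd k
  set L := Real.log (Real.exp 1 * ((t : ℝ) + 1)) with hL
  rw [gram_epochEnd hπ, ridge, gram_epochEnd hπ, corr_epochEnd hπ, inner_eq_dotProduct]
  have hy : ∀ j ∈ Finset.range k, reward D π (epochEnd ρbar j + persist ρbar (j + 1)) s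
        • (epochAction D π ρbar j s).ofLp
      = ((cumMarkov D).ofLp ⬝ᵥ (epochAction D π ρbar j s).ofLp + epochBias D π ρbar j s
        + epochNoise D ρbar j s) • (epochAction D π ρbar j s).ofLp := by
    intro j _
    rw [reward_epoch_eq hS hρ.le hπ, inner_eq_dotProduct]
  rw [Finset.sum_congr rfl hy]
  have hconf := ridge_error_le (u := fun j => (epochAction D π ρbar j s).ofLp) hlam k
    (cumMarkov D).ofLp u.ofLp (fun j => epochBias D π ρbar j s) (fun j => epochNoise D ρbar j s)
    (c := b.Θ + b.Ω * b.B * b.Φ / (1 - ρbar))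
    (N := √(2 * noiseProxy b ρbar σ
      * (Real.log (1 / δ) + d / 2 * Real.log (1 + t * b.U ^ 2 / (d * lam)))))
    ?_ (sqrt_sum_epochBias_sq_le hS hB hρ hπ hs k) ?_
  · refine hconf.trans (mul_le_mul_of_nonneg_right ?_ (Real.sqrt_nonneg _))
    have hE : 2 * (biasScale b ρbar / ρbar)
        ≤ b.U * b.Ω * b.Φ * (b.U * b.B / (1 - ρbar) + b.X) / √lam * L := by
      have : b.U * b.Ω * b.Φ * (b.U * b.B / (1 - ρbar) + b.X) = b.U * biasScale b ρbar := by
        rw [biasScale]; ring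
      rw [this, ← mul_div_assoc, div_mul_eq_mul_div, div_le_div_iff₀ hρ hsl]
      calc 2 * biasScale b ρbar * √lam = biasScale b ρbar * (2 * √lam) := by ring
        _ ≤ biasScale b ρbar * (ρbar * b.U * L) := by gcongr
        _ = _ := by ring
    rw [beta_eq]
    linarith
  · rw [dotProduct_self_eq_norm_sq, Real.sqrt_sq (norm_nonneg _)]
    refine (norm_cumMarkov_le hS.norm_pow_le hρ.le hS.lt_one).trans ?_
    have h1 : ‖D.ω‖ * ‖D.B‖ * (b.Φ / (1 - ρbar)) ≤ b.Ω * b.B * (b.Φ / (1 - ρbar)) := by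
      gcongr
      · exact hB.omega_le
      · exact hB.matrix_le
    have h2 : b.Ω * b.B * (b.Φ / (1 - ρbar)) = b.Ω * b.B * b.Φ / (1 - ρbar) := by ring
    linarith [hB.theta_le]
  · refine Real.sqrt_le_sqrt (hk.trans ?_)
    refine mul_le_mul_of_nonneg_left ?_ (by positivity)
    have hdet := log_det_gramSeq_le (u := fun j => (epochAction D π ρbar j s).ofLp) (k := k)
      (U := b.U) hd hlam fun j _ => by
        rw [dotProduct_self_eq_norm_sq]
        exact pow_le_pow_left₀ (norm_nonneg _) (hB.action_le _ (action_mem hπ.policy _ _)) 2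
    have hmono : Real.log (1 + k * b.U ^ 2 / (d * lam)) ≤ Real.log (1 + t * b.U ^ 2 / (d * lam)) :=
      Real.log_le_log (by positivity) (by gcongr)
    have hd0 : (0 : ℝ) ≤ d := Nat.cast_nonneg d
    nlinarith [mul_le_mul_of_nonneg_left hmono hd0]

/-- Optimism: the optimal performance is at most the upper confidence bound of the action played,
which exceeds the performance of that action by at most two confidence widths. -/
lemma Noise.gap_le [IsProbabilityMeasure μ] (hN : Noise μ ℱ D σ) (hS : Stable D b ρbar)
    (hB : Bounded μ D 𝒰 b π) (hρ : 0 < ρbar)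
    (hπ : IsDynLinUCB 𝒰 b ρbar σ lam δ π) (hd : 0 < d) (hlam : 0 < lam) {s : S}
    (hs : ∀ t, ‖state D π t s‖ ≤ b.X) {k : ℕ} (hk : NoiseControlled D π b ρbar σ lam δ k s)
    (hwarm : b.U = 0 ∨
      2 * √lam ≤ ρbar * b.U * Real.log (Real.exp 1 * ((epochEnd ρbar k : ℝ) + 1))) :
    optReward μ D 𝒰 - inner ℝ (cumMarkov D) (epochAction D π ρbar k s)
      ≤ 2 * (beta b ρbar σ lam δ d (epochEnd ρbar k)
        * √((epochAction D π ρbar k s).ofLp ⬝ᵥ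
          ((gramSeq lam (fun j => (epochAction D π ρbar j s).ofLp) k)⁻¹ *ᵥ
            (epochAction D π ρbar k s).ofLp))) := by
  have hmem : epochAction D π ρbar k s ∈ 𝒰 := action_mem hπ.policy _ _
  have hconf := fun u hu => abs_ridge_sub_le hS hB hρ hπ hd hlam hs hk hwarm (u := u) hu
  have hopt : optReward μ D 𝒰 ≤ ucb b ρbar σ lam δ (run D π s (epochEnd ρbar k)).2
      (epochAction D π ρbar k s) := by
    refine hN.optReward_le hS.norm_pow_le hS.nonneg hρ.le hS.lt_one (X := b.X)
      (hB.state_le.mono fun s h => h 0) hB.action_le ⟨_, hmem⟩ fun u hu => ?_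
    refine le_trans ?_ (hπ.optimistic _ _ (fun i => ?_) (isBoundary_epochEnd k) u hu)
    · have := (abs_le.1 (hconf u hu)).1
      rw [ucb]; linarith
    · rw [history_apply]; exact action_mem hπ.policy _ _
  have h2 := (abs_le.1 (hconf _ hmem)).2
  rw [ucb] at hopt
  rw [gram_epochEnd hπ] at h2 hopt
  linarith

end Probability

/-! ### The regret on the good event -/

section Regret

variable {ρbar : ℝ}

lemma sum_range_epochEnd {g : ℕ → ℝ}
    (hg : ∀ k, ∀ i ≤ persist ρbar (k + 1), g (epochEnd ρbar k + i) = g (epochEnd ρbar k)) (K : ℕ) :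
    ∑ t ∈ Finset.range (epochEnd ρbar K), g t
      = ∑ k ∈ Finset.range K, ((persist ρbar (k + 1) : ℝ) + 1) * g (epochEnd ρbar k) := by
  induction K with
  | zero => simp [epochEnd_zero]
  | succ K ih =>
    rw [epochEnd_succ, add_assoc, Finset.sum_range_add, ih, Finset.sum_range_succ _ K]
    congr 1
    rw [Finset.sum_congr rfl fun i hi => hg K i (by have := Finset.mem_range.1 hi; omega)]
    simp

/-- Cauchy–Schwarz over the rounds: a sum over `T` rounds of a quantity that is constant in every
epoch, in terms of its squares in the epochs that start before round `T`. The maximal length of an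
epoch enters as a square root only. -/
lemma sum_range_le_sqrt_epochs (hρ : 0 < ρbar) (hρ1 : ρbar < 1) {f : ℕ → ℝ}
    (hf : ∀ k, ∀ i ≤ persist ρbar (k + 1), f (epochEnd ρbar k + i) = f (epochEnd ρbar k))
    {T : ℕ} {Q : ℝ} (hQ : ∀ K ≤ T, (∀ k < K, epochEnd ρbar k < T) →
      ∑ k ∈ Finset.range K, max (f (epochEnd ρbar k)) 0 ^ 2 ≤ Q) :
    ∑ t ∈ Finset.range T, f t ≤ √(T * (1 + Real.log T / (1 - ρbar)) * Q) := by
  classical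
  set g : ℕ → ℝ := fun t => max (f t) 0 ^ 2 with hg
  -- `K` counts the epochs that start before round `T`
  have hex : ∃ K, T ≤ epochEnd ρbar K := ⟨T, le_epochEnd T⟩
  set K := Nat.find hex with hK
  have hTK : T ≤ epochEnd ρbar K := Nat.find_spec hex
  have hKT : K ≤ T := Nat.find_min' hex (le_epochEnd T)
  have hlt : ∀ k < K, epochEnd ρbar k < T := fun k hk => not_le.1 (Nat.find_min hex hk)
  have hg0 : ∀ t, 0 ≤ g t := fun t => sq_nonneg _
  have h1 : ∑ t ∈ Finset.range T, g t ≤ (1 + Real.log T / (1 - ρbar)) * Q := by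
    calc ∑ t ∈ Finset.range T, g t ≤ ∑ t ∈ Finset.range (epochEnd ρbar K), g t :=
          Finset.sum_le_sum_of_subset_of_nonneg (Finset.range_subset_range.2 hTK)
            fun t _ _ => hg0 t
      _ = ∑ k ∈ Finset.range K, ((persist ρbar (k + 1) : ℝ) + 1) * g (epochEnd ρbar k) :=
          sum_range_epochEnd (fun k i hi => by simp only [hg, hf k i hi]) K
      _ ≤ ∑ k ∈ Finset.range K, (1 + Real.log T / (1 - ρbar)) * g (epochEnd ρbar k) := by
          refine Finset.sum_le_sum fun k hk => mul_le_mul_of_nonneg_right ?_ (hg0 _)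
          have hk' := Finset.mem_range.1 hk
          have := persist_le hρ hρ1 (m := k + 1) (T := T) (Nat.succ_pos k) (by omega)
          linarith
      _ ≤ (1 + Real.log T / (1 - ρbar)) * Q := by
          rw [← Finset.mul_sum]
          refine mul_le_mul_of_nonneg_left (hQ K hKT hlt) ?_
          have : 0 ≤ Real.log T := Real.log_natCast_nonneg T
          have : 0 < 1 - ρbar := by linarith
          positivity
  calc ∑ t ∈ Finset.range T, f t ≤ ∑ t ∈ Finset.range T, max (f t) 0 :=
        Finset.sum_le_sum fun t _ => le_max_left _ _
    _ ≤ √((∑ t ∈ Finset.range T, max (f t) 0) ^ 2) := Real.le_sqrt_of_sq_le le_rfl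
    _ ≤ √(T * (1 + Real.log T / (1 - ρbar)) * Q) := by
        refine Real.sqrt_le_sqrt (sq_sum_le_card_mul_sum_sq.trans ?_)
        rw [Finset.card_range, mul_assoc]
        exact mul_le_mul_of_nonneg_left h1 (Nat.cast_nonneg T)

end Regret

section Beta

variable {b : Bounds} {ρbar σ lam δ : ℝ} {d : ℕ}

/-- The constants known to the learner are nonnegative, as soon as they bound something. -/
structure Bounds.Nonneg (b : Bounds) : Prop where
  Θ : 0 ≤ b.Θ
  Ω : 0 ≤ b.Ω
  B : 0 ≤ b.B
  U : 0 ≤ b.U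
  X : 0 ≤ b.X
  Φ : 0 ≤ b.Φ

lemma log_exp_one_mul_nonneg (t : ℕ) : 0 ≤ Real.log (Real.exp 1 * ((t : ℝ) + 1)) := by
  refine Real.log_nonneg ?_
  nlinarith only [Real.add_one_le_exp (1 : ℝ), (Nat.cast_nonneg t : (0 : ℝ) ≤ t)]

lemma beta_nonneg (hb : b.Nonneg) (hρ1 : ρbar < 1) (t : ℕ) : 0 ≤ beta b ρbar σ lam δ d t := by
  have hr : 0 < 1 - ρbar := by linarith
  obtain ⟨h1, h2, h3, h4, h5, h6⟩ := hb
  have h7 := log_exp_one_mul_nonneg t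
  unfold beta
  positivity

lemma beta_mono (hb : b.Nonneg) (hlam : 0 < lam) (hρ : 0 ≤ ρbar) (hρ1 : ρbar < 1) {t T : ℕ}
    (ht : t ≤ T) : beta b ρbar σ lam δ d t ≤ beta b ρbar σ lam δ d T := by
  have hr : 0 < 1 - ρbar := by linarith
  have hv := noiseProxy_nonneg (b := b) (σ := σ) hρ hρ1
  rw [noiseProxy] at hv
  obtain ⟨h1, h2, h3, h4, h5, h6⟩ := hb
  have ht' : (t : ℝ) ≤ T := by exact_mod_cast ht
  unfold beta
  refine add_le_add (add_le_add (mul_le_mul_of_nonneg_left ?_ (by positivity)) le_rfl)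
    (Real.sqrt_le_sqrt (mul_le_mul_of_nonneg_left ?_ (by positivity)))
  · exact Real.log_le_log (by positivity) (by gcongr)
  · have : Real.log (1 + t * b.U ^ 2 / (d * lam)) ≤ Real.log (1 + T * b.U ^ 2 / (d * lam)) :=
      Real.log_le_log (by positivity) (by gcongr)
    gcongr

end Beta

section OffRegret

variable {n d : ℕ} {S : Type*} {mS : MeasurableSpace S} {μ : Measure S} [IsProbabilityMeasure μ]
  {ℱ : Filtration ℕ mS} {D : Bandit n d S} {π : Rule d}
  {𝒰 : Set (EuclideanSpace ℝ (Fin d))} {b : Bounds} {ρbar σ lam δ : ℝ}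

lemma Bounded.nonneg (hB : Bounded μ D 𝒰 b π) (hS : Stable D b ρbar) (hπ : IsPolicy 𝒰 π) :
    b.Nonneg := by
  obtain ⟨s, hs⟩ := hB.state_le.exists
  exact ⟨(norm_nonneg _).trans hB.theta_le, (norm_nonneg _).trans hB.omega_le,
    (norm_nonneg _).trans hB.matrix_le,
    (norm_nonneg _).trans (hB.action_le _ (action_mem (D := D) hπ 0 s)),
    (norm_nonneg _).trans (hs 0), hS.nonneg⟩

lemma Noise.avgReward_eq (hN : Noise μ ℱ D σ) (hS : Stable D b ρbar) (hB : Bounded μ D 𝒰 b π)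
    (hρ : 0 ≤ ρbar) (u : EuclideanSpace ℝ (Fin d)) :
    avgReward μ D (constRule u) = inner ℝ (cumMarkov D) u :=
  hN.avgReward_constRule hS.norm_pow_le hS.nonneg hρ hS.lt_one (X := b.X)
    (hB.state_le.mono fun _ h => h 0) u

lemma Noise.optReward_le_one (hN : Noise μ ℱ D σ) (hS : Stable D b ρbar)
    (hB : Bounded μ D 𝒰 b π) (hρ : 0 ≤ ρbar) (hπ : IsPolicy 𝒰 π) : optReward μ D 𝒰 ≤ 1 := by
  obtain ⟨s, -⟩ := hB.state_le.exists
  refine hN.optReward_le hS.norm_pow_le hS.nonneg hρ hS.lt_one (X := b.X)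
    (hB.state_le.mono fun _ h => h 0) hB.action_le ⟨_, action_mem (D := D) hπ 0 s⟩ fun u hu => ?_
  rw [← hN.avgReward_eq hS hB hρ]
  exact (abs_le.1 (hB.avgReward_le u hu)).2

lemma Noise.gap_le_two (hN : Noise μ ℱ D σ) (hS : Stable D b ρbar)
    (hB : Bounded μ D 𝒰 b π) (hρ : 0 ≤ ρbar) (hπ : IsPolicy 𝒰 π) (t : ℕ) (s : S) :
    optReward μ D 𝒰 - inner ℝ (cumMarkov D) (action D π t s) ≤ 2 := by
  have h1 := hN.optReward_le_one hS hB hρ hπ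
  have h2 := (abs_le.1 (hB.avgReward_le _ (action_mem (D := D) hπ t s))).1
  rw [hN.avgReward_eq hS hB hρ] at h2
  linarith

lemma Noise.offRegret_eq (hN : Noise μ ℱ D σ) (hS : Stable D b ρbar) (hB : Bounded μ D 𝒰 b π)
    (hρ : 0 ≤ ρbar) (T : ℕ) (s : S) :
    offRegret μ D 𝒰 π T s = ∑ t ∈ Finset.range T,
      (optReward μ D 𝒰 - inner ℝ (cumMarkov D) (action D π t s)) := by
  simp only [offRegret, hN.avgReward_eq hS hB hρ, Finset.sum_sub_distrib, Finset.sum_const,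
    Finset.card_range, nsmul_eq_mul]

/-- The offline regret on the event where the noise is controlled; `N₀` early epochs, in which the
confidence ellipsoid need not be valid, cost at most two per round. -/
lemma Noise.offRegret_le (hN : Noise μ ℱ D σ) (hS : Stable D b ρbar)
    (hB : Bounded μ D 𝒰 b π) (hρ : 0 < ρbar)
    (hπ : IsDynLinUCB 𝒰 b ρbar σ lam δ π) (hd : 0 < d) (hlam : 0 < lam) {s : S}
    (hs : ∀ t, ‖state D π t s‖ ≤ b.X) {T N₀ : ℕ}
    (hk : ∀ k < T, NoiseControlled D π b ρbar σ lam δ k s)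
    (hwarm : ∀ k, N₀ ≤ k → b.U = 0 ∨
      2 * √lam ≤ ρbar * b.U * Real.log (Real.exp 1 * ((epochEnd ρbar k : ℝ) + 1))) :
    offRegret μ D 𝒰 π T s ≤ √(T * (1 + Real.log T / (1 - ρbar))
      * (4 * N₀ + 8 * (1 + beta b ρbar σ lam δ d T ^ 2)
        * (d * Real.log (1 + T * b.U ^ 2 / (d * lam))))) := by
  have hb := hB.nonneg hS hπ.policy
  rw [hN.offRegret_eq hS hB hρ.le]
  refine sum_range_le_sqrt_epochs hρ hS.lt_one (fun k i hi => ?_) fun K hKT hK => ?_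
  · rw [action_epochEnd_add hπ k hi]; rfl
  set u : ℕ → Fin d → ℝ := fun j => (epochAction D π ρbar j s).ofLp with hu
  set w : ℕ → ℝ := fun k => u k ⬝ᵥ ((gramSeq lam u k)⁻¹ *ᵥ u k) with hw
  have hw0 : ∀ k, 0 ≤ w k := fun k => gramSeq_inv_nonneg hlam k _
  set βT := beta b ρbar σ lam δ d T with hβT
  -- the gap is at most two, so its bound in terms of the width `w k` may be truncated at one
  have hterm : ∀ k ∈ Finset.range K,
      max (optReward μ D 𝒰 - inner ℝ (cumMarkov D) (action D π (epochEnd ρbar k) s)) 0 ^ 2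
        ≤ (if k < N₀ then 4 else 0) + 4 * (1 + βT ^ 2) * min 1 (w k) := by
    intro k hkK
    have hkK' := Finset.mem_range.1 hkK
    set g := optReward μ D 𝒰 - inner ℝ (cumMarkov D) (action D π (epochEnd ρbar k) s) with hg
    have hg2 : max g 0 ≤ 2 := max_le (hN.gap_le_two hS hB hρ.le hπ.policy _ s) (by norm_num)
    have hg0 : 0 ≤ max g 0 := le_max_right _ _
    have hmin : 0 ≤ min 1 (w k) := le_min zero_le_one (hw0 k)
    split_ifs with hlt
    · have : 0 ≤ 4 * (1 + βT ^ 2) * min 1 (w k) := by positivity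
      nlinarith
    · have hgap : g ≤ 2 * (beta b ρbar σ lam δ d (epochEnd ρbar k) * √(w k)) :=
        hN.gap_le hS hB hρ hπ hd hlam hs (hk k (by omega)) (hwarm k (by omega))
      have hβ : beta b ρbar σ lam δ d (epochEnd ρbar k) ≤ βT :=
        beta_mono hb hlam hρ.le hS.lt_one (hK k hkK').le
      have hβ0 : 0 ≤ βT := beta_nonneg hb hS.lt_one T
      have hgap' : max g 0 ≤ 2 * (βT * √(w k)) := by
        refine max_le (hgap.trans ?_) (by positivity)
        gcongr
      have hsq : max g 0 ^ 2 ≤ 4 * βT ^ 2 * w k := by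
        calc max g 0 ^ 2 ≤ (2 * (βT * √(w k))) ^ 2 := pow_le_pow_left₀ hg0 hgap' 2
          _ = 4 * βT ^ 2 * √(w k) ^ 2 := by ring
          _ = _ := by rw [Real.sq_sqrt (hw0 k)]
      rcases le_total 1 (w k) with h1 | h1
      · rw [min_eq_left h1]; nlinarith [sq_nonneg βT]
      · rw [min_eq_right h1]; nlinarith [hw0 k]
  refine (Finset.sum_le_sum hterm).trans ?_
  rw [Finset.sum_add_distrib, ← Finset.mul_sum]
  refine add_le_add ?_ ?_
  · calc ∑ k ∈ Finset.range K, (if k < N₀ then (4 : ℝ) else 0)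
        = ∑ k ∈ (Finset.range K).filter (· < N₀), (4 : ℝ) := (Finset.sum_filter _ _).symm
      _ ≤ ∑ k ∈ Finset.range N₀, (4 : ℝ) :=
          Finset.sum_le_sum_of_subset_of_nonneg
            (fun k hk => Finset.mem_range.2 (Finset.mem_filter.1 hk).2) fun _ _ _ => by norm_num
      _ = 4 * N₀ := by simp [mul_comm]
  · have hpot := sum_min_one_le (u := u) hlam K
    have hdet := log_det_gramSeq_le (u := u) (k := K) (U := b.U) hd hlam fun j _ => by
      rw [hu, dotProduct_self_eq_norm_sq]
      exact pow_le_pow_left₀ (norm_nonneg _) (hB.action_le _ (action_mem hπ.policy _ _)) 2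
    have hKT' : (K : ℝ) ≤ T := by exact_mod_cast hKT
    have hmono : (d : ℝ) * Real.log (1 + K * b.U ^ 2 / (d * lam))
        ≤ d * Real.log (1 + T * b.U ^ 2 / (d * lam)) :=
      mul_le_mul_of_nonneg_left (Real.log_le_log (by positivity) (by gcongr)) (Nat.cast_nonneg d)
    calc 4 * (1 + βT ^ 2) * ∑ k ∈ Finset.range K, min 1 (w k)
        ≤ 4 * (1 + βT ^ 2) * (2 * (d * Real.log (1 + T * b.U ^ 2 / (d * lam)))) := by
          refine mul_le_mul_of_nonneg_left ?_ (by positivity)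
          exact hpot.trans (by linarith)
      _ = _ := by ring

/-- After a number of epochs depending only on the constants, the exploration coefficient dominates
the bias. -/
lemma exists_warm_epoch (b : Bounds) (lam : ℝ) {ρ₀ : ℝ} (hρ₀ : 0 < ρ₀) :
    ∃ N₀ : ℕ, ∀ ρbar : ℝ, ρ₀ ≤ ρbar → 0 ≤ b.U → ∀ k, N₀ ≤ k → b.U = 0 ∨
      2 * √lam ≤ ρbar * b.U * Real.log (Real.exp 1 * ((epochEnd ρbar k : ℝ) + 1)) := by
  refine ⟨⌈Real.exp (2 * √lam / (ρ₀ * b.U))⌉₊, fun ρbar hρ hU k hk => ?_⟩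
  rcases hU.eq_or_lt with h0 | hU
  · exact Or.inl h0.symm
  refine Or.inr ?_
  have h1 : Real.exp (2 * √lam / (ρ₀ * b.U)) ≤ (epochEnd ρbar k : ℝ) :=
    (Nat.ceil_le.1 hk).trans (by exact_mod_cast le_epochEnd k)
  have h2 : 2 * √lam / (ρ₀ * b.U) ≤ Real.log (Real.exp 1 * ((epochEnd ρbar k : ℝ) + 1)) := by
    rw [Real.le_log_iff_exp_le (by positivity)]
    nlinarith [Real.add_one_le_exp (1 : ℝ), Real.exp_pos (2 * √lam / (ρ₀ * b.U))]
  rw [div_le_iff₀ (by positivity)] at h2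
  have h3 := log_exp_one_mul_nonneg (epochEnd ρbar k)
  calc 2 * √lam ≤ ρ₀ * b.U * Real.log (Real.exp 1 * ((epochEnd ρbar k : ℝ) + 1)) := by linarith
    _ ≤ _ := by gcongr

end OffRegret

/-! ### The rate -/

section Rate

lemma one_le_two_mul_log {T : ℕ} (hT : 2 ≤ T) : 1 ≤ 2 * Real.log T := by
  have hT' : (2 : ℝ) ≤ T := by exact_mod_cast hT
  have h1 : Real.log 2 ≤ Real.log T := Real.log_le_log (by norm_num) hT'
  linarith [Real.log_two_gt_d9]

variable {b : Bounds} {lam ρbar σ δ a : ℝ} {d T : ℕ}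

/-- The part of the exploration coefficient that does not depend on the noise is of order
`log T / (1 - ρbar)`. -/
lemma beta_bias_le (hb : b.Nonneg) (hρ : 0 < ρbar) (hρ1 : ρbar < 1) (hT : 2 ≤ T) :
    b.U * b.Ω * b.Φ * (b.U * b.B / (1 - ρbar) + b.X) / √lam * Real.log (Real.exp 1 * ((T : ℝ) + 1))
        + (b.Θ + b.Ω * b.B * b.Φ / (1 - ρbar)) * √lam
      ≤ (4 * (b.U * b.Ω * b.Φ * (b.U * b.B + b.X) / √lam)
          + 2 * ((b.Θ + b.Ω * b.B * b.Φ) * √lam)) * Real.log T / (1 - ρbar) := by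
  obtain ⟨hΘ, hΩ, hB, hU, hX, hΦ⟩ := hb
  set L := Real.log T with hL
  set r := 1 - ρbar with hr
  have hr0 : 0 < r := by rw [hr]; linarith
  have hr1 : r ≤ 1 := by rw [hr]; linarith
  have hT' : (2 : ℝ) ≤ T := by exact_mod_cast hT
  have hL2 : 1 ≤ 2 * L := one_le_two_mul_log hT
  have hL0 : 0 ≤ L := by linarith
  have hlogT : Real.log (Real.exp 1 * ((T : ℝ) + 1)) ≤ 4 * L := by
    rw [Real.log_mul (Real.exp_pos _).ne' (by positivity), Real.log_exp]
    have : Real.log ((T : ℝ) + 1) ≤ 2 * L := by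
      have h2 : 2 * L = Real.log ((T : ℝ) ^ 2) := by rw [Real.log_pow]; push_cast; ring
      rw [h2]
      exact Real.log_le_log (by positivity) (by nlinarith only [hT'])
    linarith
  have hlog0 := log_exp_one_mul_nonneg T
  have hX' : b.X ≤ b.X / r := le_div_self hX hr0 hr1
  have hΘ' : b.Θ ≤ b.Θ / r := le_div_self hΘ hr0 hr1
  have h1 : b.U * b.Ω * b.Φ * (b.U * b.B / r + b.X) / √lam * Real.log (Real.exp 1 * ((T : ℝ) + 1))
      ≤ b.U * b.Ω * b.Φ * (b.U * b.B / r + b.X / r) / √lam * (4 * L) := by gcongr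
  have h2 : (b.Θ + b.Ω * b.B * b.Φ / r) * √lam
      ≤ (b.Θ / r + b.Ω * b.B * b.Φ / r) * √lam * (2 * L) := by
    calc _ ≤ (b.Θ / r + b.Ω * b.B * b.Φ / r) * √lam := by gcongr
      _ ≤ _ := le_mul_of_one_le_right (by positivity) hL2
  calc _ ≤ _ := add_le_add h1 h2
    _ = _ := by ring

/-- The noise part of the exploration coefficient, for a confidence level `δ` with
`log (1 / δ) ≤ a d log T`. -/
lemma beta_noise_sq_le (ha : 0 ≤ a) (hρ : 0 < ρbar) (hρ1 : ρbar < 1) (hlam : 0 < lam) (hT : 2 ≤ T)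
    (hδ : Real.log (1 / δ) ≤ a * d * Real.log T)
    (hlog : Real.log (1 + T * b.U ^ 2 / (d * lam))
      ≤ (1 + 2 * Real.log (1 + b.U ^ 2 / lam)) * Real.log T) :
    √(2 * noiseProxy b ρbar σ * (Real.log (1 / δ)
        + d / 2 * Real.log (1 + T * b.U ^ 2 / (d * lam)))) ^ 2
      ≤ ((1 + b.Ω ^ 2 * b.Φ ^ 2) * (2 * a + (1 + 2 * Real.log (1 + b.U ^ 2 / lam))))
          * σ ^ 2 * d * Real.log T / (1 - ρbar) := by
  set L := Real.log T with hL
  set r := 1 - ρbar with hr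
  have hr0 : 0 < r := by rw [hr]; linarith
  have hL2 : 1 ≤ 2 * L := one_le_two_mul_log hT
  have hL0 : 0 ≤ L := by linarith
  set q := 1 + 2 * Real.log (1 + b.U ^ 2 / lam) with hq
  have hq0 : 0 ≤ q := by
    have : 0 ≤ Real.log (1 + b.U ^ 2 / lam) :=
      Real.log_nonneg (le_add_of_nonneg_right (by positivity))
    positivity
  have hv0 : 0 ≤ noiseProxy b ρbar σ := noiseProxy_nonneg hρ.le hρ1
  have hv : noiseProxy b ρbar σ ≤ σ ^ 2 * (1 + b.Ω ^ 2 * b.Φ ^ 2) / r := by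
    have h0 : ρbar ^ 2 ≤ ρbar := by rw [sq]; exact mul_le_of_le_one_right hρ.le hρ1.le
    have h1 : r ≤ 1 - ρbar ^ 2 := by rw [hr]; linarith
    have h2 : b.Ω ^ 2 * b.Φ ^ 2 / (1 - ρbar ^ 2) ≤ b.Ω ^ 2 * b.Φ ^ 2 / r := by gcongr
    have h3 : 1 ≤ 1 / r := by rw [le_div_iff₀ hr0]; linarith
    calc noiseProxy b ρbar σ ≤ σ ^ 2 * (1 / r + b.Ω ^ 2 * b.Φ ^ 2 / r) := by
          rw [noiseProxy]; gcongr
      _ = _ := by ring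
  have hy : Real.log (1 / δ) + d / 2 * Real.log (1 + T * b.U ^ 2 / (d * lam))
      ≤ (2 * a + q) * d * L / 2 := by
    have : d / 2 * Real.log (1 + T * b.U ^ 2 / (d * lam)) ≤ d / 2 * (q * L) := by gcongr
    linarith
  have hbd : 0 ≤ ((1 + b.Ω ^ 2 * b.Φ ^ 2) * (2 * a + q)) * σ ^ 2 * d * L / r := by positivity
  refine (pow_le_pow_left₀ (Real.sqrt_nonneg _) (Real.sqrt_le_sqrt ?_) 2).trans
    (Real.sq_sqrt hbd).le
  calc _ ≤ 2 * noiseProxy b ρbar σ * ((2 * a + q) * d * L / 2) := by gcongr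
    _ ≤ 2 * (σ ^ 2 * (1 + b.Ω ^ 2 * b.Φ ^ 2) / r) * ((2 * a + q) * d * L / 2) := by gcongr
    _ = _ := by ring

lemma log_one_add_le (hlam : 0 < lam) (hd : 0 < d) (hT : 2 ≤ T) (U : ℝ) :
    Real.log (1 + T * U ^ 2 / (d * lam)) ≤ (1 + 2 * Real.log (1 + U ^ 2 / lam)) * Real.log T := by
  have hT' : (2 : ℝ) ≤ T := by exact_mod_cast hT
  have hd' : (1 : ℝ) ≤ d := by exact_mod_cast hd
  have hL2 := one_le_two_mul_log hT
  have h0 : 0 ≤ Real.log (1 + U ^ 2 / lam) :=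
    Real.log_nonneg (le_add_of_nonneg_right (by positivity))
  have h1 : 1 + T * U ^ 2 / (d * lam) ≤ T * (1 + U ^ 2 / lam) := by
    have h2 : T * U ^ 2 / (d * lam) ≤ T * U ^ 2 / lam := by
      gcongr; exact le_mul_of_one_le_left hlam.le hd'
    rw [mul_add, mul_one, ← mul_div_assoc]
    linarith
  calc _ ≤ Real.log (T * (1 + U ^ 2 / lam)) := Real.log_le_log (by positivity) h1
    _ = Real.log T + Real.log (1 + U ^ 2 / lam) := Real.log_mul (by positivity) (by positivity)
    _ ≤ _ := by nlinarith only [h0, hL2]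

/-- The regret on the good event is of the claimed order. -/
lemma exists_rate (b : Bounds) (lam : ℝ) (hlam : 0 < lam) (a : ℝ) (ha : 0 ≤ a) (N₀ : ℕ) :
    ∃ C : ℝ, 0 ≤ C ∧ ∀ (ρbar σ δ : ℝ) (d T : ℕ), b.Nonneg → 0 < ρbar → ρbar < 1 → 0 ≤ σ → 0 < d →
      2 ≤ T → Real.log (1 / δ) ≤ a * d * Real.log T →
      √(T * (1 + Real.log T / (1 - ρbar))
          * (4 * N₀ + 8 * (1 + beta b ρbar σ lam δ d T ^ 2)
            * (d * Real.log (1 + T * b.U ^ 2 / (d * lam)))))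
        ≤ C * (d * σ * √T * Real.log T ^ (3 / 2 : ℝ) / (1 - ρbar)
            + √(d * T) * Real.log T ^ 2 / (1 - ρbar) ^ (3 / 2 : ℝ)) := by
  set q := 1 + 2 * Real.log (1 + b.U ^ 2 / lam) with hq
  set κ := 4 * (b.U * b.Ω * b.Φ * (b.U * b.B + b.X) / √lam)
          + 2 * ((b.Θ + b.Ω * b.B * b.Φ) * √lam) with hκ
  set ν := (1 + b.Ω ^ 2 * b.Φ ^ 2) * (2 * a + q) with hν
  have hq0 : 0 ≤ q := by
    have : 0 ≤ Real.log (1 + b.U ^ 2 / lam) :=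
      Real.log_nonneg (le_add_of_nonneg_right (by positivity))
    positivity
  have hν0 : 0 ≤ ν := by positivity
  set P := 32 * N₀ + 8 * q * (4 + 2 * κ ^ 2) with hP
  set Q := 16 * q * ν with hQ
  have hP0 : 0 ≤ P := by positivity
  have hQ0 : 0 ≤ Q := by positivity
  refine ⟨√(3 * (P + Q)), Real.sqrt_nonneg _, ?_⟩
  intro ρbar σ δ d T hb hρ hρ1 hσ hd hT hδ
  have hlog := log_one_add_le hlam hd hT b.U
  have hbias := beta_bias_le (lam := lam) hb hρ hρ1 hT
  have hnoise := beta_noise_sq_le (b := b) (σ := σ) ha hρ hρ1 hlam hT hδ hlog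
  set L := Real.log T with hL
  set r := 1 - ρbar with hr
  have hr0 : 0 < r := by rw [hr]; linarith
  have hr1 : r ≤ 1 := by rw [hr]; linarith
  have hL2 : 1 ≤ 2 * L := one_le_two_mul_log hT
  have hL0 : 0 < L := by linarith
  have hd1 : (1 : ℝ) ≤ d := by exact_mod_cast hd
  have hT0 : (0 : ℝ) < T := by have : 0 < T := by omega
                               exact_mod_cast this
  have hLr : 1 ≤ 2 * (L / r) := by
    have : L ≤ L / r := le_div_self hL0.le hr0 hr1
    linarith
  have hLr2 : 1 ≤ 4 * (L / r) ^ 2 := by nlinarith only [hLr]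
  have hbias0 : 0 ≤ b.U * b.Ω * b.Φ * (b.U * b.B / r + b.X) / √lam
      * Real.log (Real.exp 1 * ((T : ℝ) + 1)) + (b.Θ + b.Ω * b.B * b.Φ / r) * √lam := by
    obtain ⟨hΘ, hΩ, hB, hU, hX, hΦ⟩ := hb
    have hlog0 := log_exp_one_mul_nonneg T
    positivity
  have hβ : beta b ρbar σ lam δ d T ^ 2 ≤ 2 * (κ * L / r) ^ 2 + 2 * (ν * σ ^ 2 * d * L / r) := by
    rw [beta_eq]
    calc _ ≤ 2 * (b.U * b.Ω * b.Φ * (b.U * b.B / r + b.X) / √lam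
          * Real.log (Real.exp 1 * ((T : ℝ) + 1)) + (b.Θ + b.Ω * b.B * b.Φ / r) * √lam) ^ 2
        + 2 * √(2 * noiseProxy b ρbar σ * (Real.log (1 / δ)
          + d / 2 * Real.log (1 + T * b.U ^ 2 / (d * lam)))) ^ 2 :=
          add_sq_le.trans (le_of_eq (mul_add _ _ _))
      _ ≤ _ := by gcongr
  have hlog0 : 0 ≤ Real.log (1 + T * b.U ^ 2 / (d * lam)) :=
    Real.log_nonneg (le_add_of_nonneg_right (by positivity))
  -- everything is absorbed into two terms, using `1 ≤ 2 L`, `1 ≤ 2 L / r` and `1 ≤ d`; up to `T L / r`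
  -- these are the squares of the two rates `E` and `A` below
  have hmain : 4 * N₀ + 8 * (1 + beta b ρbar σ lam δ d T ^ 2)
        * (d * Real.log (1 + T * b.U ^ 2 / (d * lam)))
      ≤ P * d * L * (L / r) ^ 2 + Q * σ ^ 2 * d ^ 2 * L * (L / r) := by
    have h1 : (4 * N₀ : ℝ) ≤ 32 * N₀ * d * L * (L / r) ^ 2 := by
      have h2 : 1 ≤ d * (2 * L) * (4 * (L / r) ^ 2) :=
        one_le_mul_of_one_le_of_one_le (one_le_mul_of_one_le_of_one_le hd1 hL2) hLr2
      have h3 : (0 : ℝ) ≤ 4 * N₀ := by positivity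
      calc (4 * N₀ : ℝ) ≤ 4 * N₀ * (d * (2 * L) * (4 * (L / r) ^ 2)) := le_mul_of_one_le_right h3 h2
        _ = _ := by ring
    have h4 : 1 + beta b ρbar σ lam δ d T ^ 2
        ≤ (4 + 2 * κ ^ 2) * (L / r) ^ 2 + 2 * ν * σ ^ 2 * d * (L / r) := by
      calc 1 + beta b ρbar σ lam δ d T ^ 2
          ≤ 4 * (L / r) ^ 2 + (2 * (κ * L / r) ^ 2 + 2 * (ν * σ ^ 2 * d * L / r)) :=
            add_le_add hLr2 hβ
        _ = _ := by ring
    have h5 : 8 * (1 + beta b ρbar σ lam δ d T ^ 2)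
          * (d * Real.log (1 + T * b.U ^ 2 / (d * lam)))
        ≤ 8 * ((4 + 2 * κ ^ 2) * (L / r) ^ 2 + 2 * ν * σ ^ 2 * d * (L / r)) * (d * (q * L)) := by
      gcongr
    calc _ ≤ 32 * N₀ * d * L * (L / r) ^ 2 + 8 * ((4 + 2 * κ ^ 2) * (L / r) ^ 2
          + 2 * ν * σ ^ 2 * d * (L / r)) * (d * (q * L)) := add_le_add h1 h5
      _ = _ := by rw [hP, hQ]; ring
  set A := d * σ * √T * L ^ (3 / 2 : ℝ) / r with hA
  set E := √(d * T) * L ^ 2 / r ^ (3 / 2 : ℝ) with hE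
  have hA0 : 0 ≤ A := by positivity
  have hE0 : 0 ≤ E := by positivity
  have hpow : ∀ x : ℝ, 0 ≤ x → (x ^ (3 / 2 : ℝ)) ^ 2 = x ^ 3 := by
    intro x hx
    rw [← Real.rpow_natCast, ← Real.rpow_mul hx, ← Real.rpow_natCast x 3]
    norm_num
  have hA2 : A ^ 2 = d ^ 2 * σ ^ 2 * T * L ^ 3 / r ^ 2 := by
    rw [hA, div_pow, mul_pow, mul_pow, mul_pow, hpow L hL0.le, Real.sq_sqrt hT0.le]
  have hE2 : E ^ 2 = d * T * L ^ 4 / r ^ 3 := by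
    rw [hE, div_pow, mul_pow, hpow r hr0.le, Real.sq_sqrt (by positivity), ← pow_mul]
  refine Real.sqrt_le_iff.2 ⟨by positivity, ?_⟩
  rw [mul_pow, Real.sq_sqrt (by positivity)]
  calc _ ≤ T * (3 * (L / r)) * (P * d * L * (L / r) ^ 2 + Q * σ ^ 2 * d ^ 2 * L * (L / r)) := by
        gcongr
        linarith
    _ = 3 * (P * E ^ 2 + Q * A ^ 2) := by rw [hA2, hE2]; field_simp
    _ ≤ 3 * (P + Q) * (A + E) ^ 2 := by
        have h1 : E ^ 2 ≤ (A + E) ^ 2 := pow_le_pow_left₀ hE0 (by linarith) 2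
        have h2 : A ^ 2 ≤ (A + E) ^ 2 := pow_le_pow_left₀ hA0 (by linarith) 2
        calc 3 * (P * E ^ 2 + Q * A ^ 2) ≤ 3 * (P * (A + E) ^ 2 + Q * (A + E) ^ 2) := by gcongr
          _ = _ := by ring

end Rate

/-! ### Regret with high probability and in expectation -/

section Main

variable {n d : ℕ} {S : Type*} {mS : MeasurableSpace S} {μ : Measure S} [IsProbabilityMeasure μ]
  {ℱ : Filtration ℕ mS} {D : Bandit n d S} {π : Rule d}
  {𝒰 : Set (EuclideanSpace ℝ (Fin d))} {b : Bounds} {ρbar σ lam δ : ℝ}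

lemma Noise.measure_not_offRegret_le (hN : Noise μ ℱ D σ) (hS : Stable D b ρbar)
    (hB : Bounded μ D 𝒰 b π) (hρ : 0 < ρbar)
    (hπ : IsDynLinUCB 𝒰 b ρbar σ lam δ π) (hd : 0 < d) (hlam : 0 < lam) (hδ : 0 < δ) {T N₀ : ℕ}
    (hwarm : ∀ k, N₀ ≤ k → b.U = 0 ∨
      2 * √lam ≤ ρbar * b.U * Real.log (Real.exp 1 * ((epochEnd ρbar k : ℝ) + 1)))
    {R : ℝ} (hR : √(T * (1 + Real.log T / (1 - ρbar))
      * (4 * N₀ + 8 * (1 + beta b ρbar σ lam δ d T ^ 2)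
        * (d * Real.log (1 + T * b.U ^ 2 / (d * lam))))) ≤ R) :
    μ {s | ¬ offRegret μ D 𝒰 π T s ≤ R} ≤ ENNReal.ofReal δ := by
  have hsub : {s | ¬ offRegret μ D 𝒰 π T s ≤ R}
      ⊆ {s | ∃ k < T, ¬ NoiseControlled D π b ρbar σ lam δ k s}
        ∪ {s | ¬ ∀ t, ‖state D π t s‖ ≤ b.X} := by
    intro s hs
    by_contra hcon
    rw [Set.mem_union, not_or] at hcon
    obtain ⟨h1, h2⟩ := hcon
    simp only [Set.mem_ofPred_eq, not_exists, not_and, not_not] at h1 h2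
    exact hs ((hN.offRegret_le hS hB hρ hπ hd hlam h2 h1 hwarm).trans hR)
  calc _ ≤ μ ({s | ∃ k < T, ¬ NoiseControlled D π b ρbar σ lam δ k s}
        ∪ {s | ¬ ∀ t, ‖state D π t s‖ ≤ b.X}) := measure_mono hsub
    _ ≤ μ {s | ∃ k < T, ¬ NoiseControlled D π b ρbar σ lam δ k s}
        + μ {s | ¬ ∀ t, ‖state D π t s‖ ≤ b.X} := measure_union_le _ _
    _ = μ {s | ∃ k < T, ¬ NoiseControlled D π b ρbar σ lam δ k s} := by
        rw [ae_iff.1 hB.state_le, add_zero]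
    _ ≤ ENNReal.ofReal δ :=
        hN.measure_not_noiseControlled_le hS hB.omega_le hρ.le hπ.policy hlam hδ T

lemma Noise.integrable_regret (hN : Noise μ ℱ D σ) (hB : Bounded μ D 𝒰 b π) (hπ : IsPolicy 𝒰 π)
    (T : ℕ) : Integrable (regret μ D 𝒰 π T) μ :=
  (integrable_const _).sub (integrable_finsetSum _ fun t _ =>
    hN.integrable_reward hπ.measurable (hB.state_le.mono fun _ h => h 0)
      (fun t s => hB.action_le _ (action_mem hπ t s)) t)

lemma Noise.measurable_offRegret (hN : Noise μ ℱ D σ) (hS : Stable D b ρbar)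
    (hB : Bounded μ D 𝒰 b π) (hρ : 0 ≤ ρbar) (hπ : IsPolicy 𝒰 π) (T : ℕ) :
    Measurable (offRegret μ D 𝒰 π T) := by
  rw [funext (hN.offRegret_eq hS hB hρ T)]
  refine Finset.measurable_fun_sum _ fun t _ => measurable_const.sub ?_
  have hin : Measurable fun u : EuclideanSpace ℝ (Fin d) => inner ℝ (cumMarkov D) u :=
    (continuous_const.inner continuous_id).measurable
  exact hin.comp ((hN.measurable_action hπ.measurable t).mono (ℱ.le t) le_rfl)

lemma Noise.integrable_offRegret (hN : Noise μ ℱ D σ) (hS : Stable D b ρbar)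
    (hB : Bounded μ D 𝒰 b π) (hρ : 0 ≤ ρbar) (hπ : IsPolicy 𝒰 π) (T : ℕ) :
    Integrable (offRegret μ D 𝒰 π T) μ := by
  rw [funext (hN.offRegret_eq hS hB hρ T)]
  exact integrable_finsetSum _ fun t _ => (integrable_const _).sub
    ((hN.integrable_action hπ.measurable
      (fun t s => hB.action_le _ (action_mem hπ t s)) t).const_inner _)

lemma Noise.abs_integral_offRegret_sub_le (hN : Noise μ ℱ D σ) (hS : Stable D b ρbar)
    (hB : Bounded μ D 𝒰 b π) (hρ : 0 ≤ ρbar) (hπ : IsPolicy 𝒰 π) (T : ℕ) :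
    |(∫ s, offRegret μ D 𝒰 π T s ∂μ) - ∫ s, regret μ D 𝒰 π T s ∂μ|
      ≤ b.Ω * (normRatio D.A).toReal * b.B * b.U / (1 - specRad D.A) ^ 2
        + b.Ω * (normRatio D.A).toReal * b.X / (1 - specRad D.A) := by
  have hb := hB.nonneg hS hπ
  have hs : 0 < 1 - specRad D.A := by linarith [hS.specRad_le, hS.lt_one]
  have hΦ : 0 ≤ (normRatio D.A).toReal := ENNReal.toReal_nonneg
  rw [← integral_sub (hN.integrable_offRegret hS hB hρ hπ T) (hN.integrable_regret hB hπ T)]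
  have hpt : ∀ s, offRegret μ D 𝒰 π T s - regret μ D 𝒰 π T s = ∑ t ∈ Finset.range T,
      (reward D π t s - inner ℝ (cumMarkov D) (action D π t s)) := by
    intro s
    rw [hN.offRegret_eq hS hB hρ, regret]
    simp only [Finset.sum_sub_distrib, Finset.sum_const, Finset.card_range, nsmul_eq_mul]
    ring
  simp only [hpt]
  refine (hN.abs_integral_sum_sub_le hπ.measurable (norm_pow_le_normRatio hS.normRatio_ne_top) hΦ
    (specRad_nonneg _) (by linarith) (hB.state_le.mono fun _ h => h 0)
    (fun t s => hB.action_le _ (action_mem hπ t s)) T).trans ?_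
  obtain ⟨h1, h2, h3, h4, h5, h6⟩ := hb
  have := hB.omega_le
  have := hB.matrix_le
  gcongr

/-- On an event of probability at most `1 / T` the offline regret is at most `2 T`, which
contributes at most two to the expectation. -/
lemma Noise.integral_offRegret_le (hN : Noise μ ℱ D σ) (hS : Stable D b ρbar)
    (hB : Bounded μ D 𝒰 b π) (hρ : 0 ≤ ρbar) (hπ : IsPolicy 𝒰 π) {T : ℕ} (hT : 0 < T) {R : ℝ}
    (hR : 0 ≤ R) (hbad : μ {s | ¬ offRegret μ D 𝒰 π T s ≤ R} ≤ ENNReal.ofReal (1 / T)) :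
    ∫ s, offRegret μ D 𝒰 π T s ∂μ ≤ R + 2 := by
  set F : Set S := {s | ¬ offRegret μ D 𝒰 π T s ≤ R} with hF
  have hFm : MeasurableSet F :=
    (measurableSet_le (hN.measurable_offRegret hS hB hρ hπ T) measurable_const).compl
  have hT' : (0 : ℝ) < T := by exact_mod_cast hT
  have hpt : ∀ s, offRegret μ D 𝒰 π T s ≤ R + F.indicator (fun _ => (2 * T : ℝ)) s := by
    intro s
    by_cases hs : s ∈ F
    · rw [Set.indicator_of_mem hs, hN.offRegret_eq hS hB hρ]
      have : ∑ t ∈ Finset.range T, (optReward μ D 𝒰 - inner ℝ (cumMarkov D) (action D π t s))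
          ≤ ∑ t ∈ Finset.range T, (2 : ℝ) :=
        Finset.sum_le_sum fun t _ => hN.gap_le_two hS hB hρ hπ t s
      rw [Finset.sum_const, Finset.card_range, nsmul_eq_mul] at this
      linarith
    · rw [Set.indicator_of_notMem hs, add_zero]
      exact not_not.1 hs
  have hind : Integrable (F.indicator fun _ => (2 * T : ℝ)) μ :=
    (integrable_const _).indicator hFm
  have hFr : μ.real F ≤ 1 / T := ENNReal.toReal_le_of_le_ofReal (by positivity) hbad
  calc ∫ s, offRegret μ D 𝒰 π T s ∂μ ≤ ∫ s, (R + F.indicator (fun _ => (2 * T : ℝ)) s) ∂μ :=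
        integral_mono (hN.integrable_offRegret hS hB hρ hπ T) ((integrable_const _).add hind) hpt
    _ = R + μ.real F * (2 * T) := by
        rw [integral_add (integrable_const _) hind, integral_indicator hFm]; simp
    _ ≤ R + 1 / T * (2 * T) := by gcongr
    _ = R + 2 := by field_simp

end Main

end DLB

theorem theorem3 (b : DLB.Bounds) (lam ρ₀ : ℝ) (hlam : 0 < lam) (hρ₀ : 0 < ρ₀) :
    (∀ δ : ℝ, 0 < δ → δ < 1 → ∃ C : ℝ,
      ∀ (n d : ℕ) (S : Type*) (mS : MeasurableSpace S) (μ : Measure S) (ℱ : Filtration ℕ mS)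
        (D : DLB.Bandit n d S) (𝒰 : Set (EuclideanSpace ℝ (Fin d))) (σ ρbar : ℝ)
        (π : DLB.Rule d) (T : ℕ),
        IsProbabilityMeasure μ → 0 < d → 0 ≤ σ → ρ₀ ≤ ρbar → 2 ≤ T →
        DLB.Noise μ ℱ D σ → DLB.Stable D b ρbar → DLB.Bounded μ D 𝒰 b π →
        DLB.IsDynLinUCB 𝒰 b ρbar σ lam δ π →
        ENNReal.ofReal (1 - δ) ≤ μ {s | DLB.offRegret μ D 𝒰 π T s ≤
          C * (d * σ * √T * Real.log T ^ (3 / 2 : ℝ) / (1 - ρbar)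
            + √(d * T) * Real.log T ^ 2 / (1 - ρbar) ^ (3 / 2 : ℝ))}) ∧
    ∃ C : ℝ,
      ∀ (n d : ℕ) (S : Type*) (mS : MeasurableSpace S) (μ : Measure S) (ℱ : Filtration ℕ mS)
        (D : DLB.Bandit n d S) (𝒰 : Set (EuclideanSpace ℝ (Fin d))) (σ ρbar : ℝ)
        (π : DLB.Rule d) (T : ℕ),
        IsProbabilityMeasure μ → 0 < d → 0 ≤ σ → ρ₀ ≤ ρbar → 2 ≤ T →
        DLB.Noise μ ℱ D σ → DLB.Stable D b ρbar → DLB.Bounded μ D 𝒰 b π →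
        DLB.IsDynLinUCB 𝒰 b ρbar σ lam (1 / T) π →
        Integrable (DLB.regret μ D 𝒰 π T) μ ∧
        Integrable (DLB.offRegret μ D 𝒰 π T) μ ∧
        |(∫ s, DLB.offRegret μ D 𝒰 π T s ∂μ) - ∫ s, DLB.regret μ D 𝒰 π T s ∂μ| ≤
          b.Ω * (DLB.normRatio D.A).toReal * b.B * b.U / (1 - DLB.specRad D.A) ^ 2
            + b.Ω * (DLB.normRatio D.A).toReal * b.X / (1 - DLB.specRad D.A) ∧
        (∫ s, DLB.regret μ D 𝒰 π T s ∂μ) ≤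
          C * (d * σ * √T * Real.log T ^ (3 / 2 : ℝ) / (1 - ρbar)
            + √(d * T) * Real.log T ^ 2 / (1 - ρbar) ^ (3 / 2 : ℝ)
            + 1 / (1 - DLB.specRad D.A) ^ 2) := by
  obtain ⟨N₀, hN₀⟩ := DLB.exists_warm_epoch b lam hρ₀
  refine ⟨fun δ hδ hδ1 => ?_, ?_⟩
  · have hlogδ : 0 ≤ Real.log (1 / δ) := Real.log_nonneg (by rw [le_div_iff₀ hδ]; linarith)
    obtain ⟨C, -, hC⟩ := DLB.exists_rate b lam hlam (2 * Real.log (1 / δ)) (by positivity) N₀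
    refine ⟨C, ?_⟩
    intro n d S mS μ ℱ D 𝒰 σ ρbar π T hμ hd hσ hρ hT hN hS hB hπ
    have hρpos : 0 < ρbar := hρ₀.trans_le hρ
    have hb := hB.nonneg hS hπ.policy
    have hd1 : (1 : ℝ) ≤ d := by exact_mod_cast hd
    have hδT : Real.log (1 / δ) ≤ 2 * Real.log (1 / δ) * d * Real.log T := by
      calc Real.log (1 / δ) ≤ Real.log (1 / δ) * (d * (2 * Real.log T)) :=
            le_mul_of_one_le_right hlogδ
              (one_le_mul_of_one_le_of_one_le hd1 (DLB.one_le_two_mul_log hT))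
        _ = _ := by ring
    have hbad := hN.measure_not_offRegret_le hS hB hρpos hπ hd hlam hδ
      (hN₀ ρbar hρ hb.U) (hC ρbar σ δ d T hb hρpos hS.lt_one hσ hd hT hδT)
    rw [ENNReal.ofReal_sub _ hδ.le, ENNReal.ofReal_one, tsub_le_iff_right, ← measure_univ (μ := μ)]
    refine le_trans ?_ (add_le_add_right hbad _)
    refine le_trans (measure_mono fun s _ => ?_) (measure_union_le _ _)
    exact em _
  · obtain ⟨C, hC0, hC⟩ := DLB.exists_rate b lam hlam 1 zero_le_one N₀
    refine ⟨C + (2 + |b.Ω * b.Φ * b.B * b.U + b.Ω * b.Φ * b.X|), ?_⟩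
    intro n d S mS μ ℱ D 𝒰 σ ρbar π T hμ hd hσ hρ hT hN hS hB hπ
    have hρpos : 0 < ρbar := hρ₀.trans_le hρ
    have hb := hB.nonneg hS hπ.policy
    have hd1 : (1 : ℝ) ≤ d := by exact_mod_cast hd
    have hT0 : 0 < T := by omega
    have hlogT : 0 ≤ Real.log T := Real.log_natCast_nonneg T
    have hδT : Real.log (1 / (1 / (T : ℝ))) ≤ 1 * d * Real.log T := by
      rw [one_div_one_div, one_mul]
      exact le_mul_of_one_le_left hlogT hd1
    set G := d * σ * √T * Real.log T ^ (3 / 2 : ℝ) / (1 - ρbar)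
            + √(d * T) * Real.log T ^ 2 / (1 - ρbar) ^ (3 / 2 : ℝ) with hG
    have hr0 : 0 < 1 - ρbar := by linarith [hS.lt_one]
    have hG0 : 0 ≤ G := by positivity
    have hbad := hN.measure_not_offRegret_le hS hB hρpos hπ hd hlam (by positivity)
      (hN₀ ρbar hρ hb.U) (hC ρbar σ (1 / T) d T hb hρpos hS.lt_one hσ hd hT hδT)
    have hoff := hN.integral_offRegret_le hS hB hρpos.le hπ.policy hT0 (by positivity) hbad
    have hdiff := hN.abs_integral_offRegret_sub_le hS hB hρpos.le hπ.policy T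
    refine ⟨hN.integrable_regret hB hπ.policy T,
      hN.integrable_offRegret hS hB hρpos.le hπ.policy T, hdiff, ?_⟩
    set x := 1 - DLB.specRad D.A with hx
    have hx0 : 0 < x := by rw [hx]; linarith [hS.specRad_le]
    have hx1 : x ≤ 1 := by rw [hx]; linarith [DLB.specRad_nonneg D.A]
    have hx2 : 1 ≤ 1 / x ^ 2 := by
      rw [le_div_iff₀ (by positivity), one_mul]; exact pow_le_one₀ hx0.le hx1
    obtain ⟨h1, h2, h3, h4, h5, h6⟩ := hb
    have hΦ := hS.toReal_normRatio_le
    have hΦ0 : 0 ≤ (DLB.normRatio D.A).toReal := ENNReal.toReal_nonneg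
    have hK : b.Ω * (DLB.normRatio D.A).toReal * b.B * b.U / x ^ 2
          + b.Ω * (DLB.normRatio D.A).toReal * b.X / x
        ≤ |b.Ω * b.Φ * b.B * b.U + b.Ω * b.Φ * b.X| * (1 / x ^ 2) := by
      rw [abs_of_nonneg (by positivity)]
      have hxx : x ^ 2 ≤ x := by rw [sq]; exact mul_le_of_le_one_right hx0.le hx1
      calc _ ≤ b.Ω * b.Φ * b.B * b.U / x ^ 2 + b.Ω * b.Φ * b.X / x ^ 2 := by gcongr
        _ = _ := by ring
    have hle : ∫ s, DLB.regret μ D 𝒰 π T s ∂μ ≤ C * G + 2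
        + |b.Ω * b.Φ * b.B * b.U + b.Ω * b.Φ * b.X| * (1 / x ^ 2) := by
      have := (abs_le.1 hdiff).1
      linarith
    have habs := abs_nonneg (b.Ω * b.Φ * b.B * b.U + b.Ω * b.Φ * b.X)
    have hx20 : 0 ≤ 1 / x ^ 2 := by positivity
    have e1 : 0 ≤ C * (1 / x ^ 2) := by positivity
    have e2 : 0 ≤ (2 + |b.Ω * b.Φ * b.B * b.U + b.Ω * b.Φ * b.X|) * G := by positivity
    calc _ ≤ _ := hle
      _ ≤ C * G + 2 * (1 / x ^ 2)
        + |b.Ω * b.Φ * b.B * b.U + b.Ω * b.Φ * b.X| * (1 / x ^ 2) := by linarith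
      _ ≤ C * G + 2 * (1 / x ^ 2)
        + |b.Ω * b.Φ * b.B * b.U + b.Ω * b.Φ * b.X| * (1 / x ^ 2) + C * (1 / x ^ 2)
        + (2 + |b.Ω * b.Φ * b.B * b.U + b.Ω * b.Φ * b.X|) * G := by linarith
      _ = _ := by ring
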